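/- **Conventions.** For an integral generalised Cartan matrix $A$ let $\mathfrak g(A)$ be the real Lie algebra with Chevalley generators $e_i,f_i,h_i$ and the Chevalley–Serre relations, $\omega$ the involution $e_i\mapsto -f_i$, $f_i\mapsto -e_i$, $h_i\mapsto -h_i$, $K(\mathfrak g(A))$ its fixed-point subalgebra, and $x_i=e_i-f_i\in K(\mathfrak g(A))$. Elements $y_i$ of a Lie algebra $L$ satisfy the *Berman relations* if $P_{-A_{ij}}(\mathrm{ad}_{y_i})y_j=0$ for $i\neq j$, where $P_0(t)=t$, $P_1(t)=t^2+1$, $P_m(t)=(t^2+m^2)P_{m-2}(t)$. We say that $x_i\mapsto y_i$ is a *representation* of $K(\mathfrak g(A))$ in $L$ ($L$ an associative algebra with the commutator bracket) if the $y_i$ satisfy the Berman relations and there is a unique Lie algebra homomorphism $\rho:K(\mathfrak g(A))\to L$ with $\rho(x_i)=y_i$. In rank $n$ let $G^{ab}=\delta^{ab}-\frac1{n-1}$, let $G_{ab}$ be its inverse, let a vector $\alpha$ have components $\alpha_a$, and let $\alpha^a=G^{ab}\alpha_b$. Round brackets denote symmetrisation of total weight one. Let $\Gamma_0,\dots,\Gamma_d$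 be real gamma matrices, $\{\Gamma_\mu,\Gamma_\nu\}=2\eta_{\mu\nu}$, $\eta=\mathrm{diag}(-1,1,\dots,1)$, with $\Gamma_0$ antisymmetric and $\Gamma_1,\dots,\Gamma_d$ symmetric, and put $\Gamma_*=\Gamma_0\Gamma_1\cdots\Gamma_d$, $\Gamma_{ab}=\Gamma_a\Gamma_b$ ($a\ne b$). A polarisation tensor $X_{a_1\dots a_s}{}^{b_1\dots b_s}$ and a matrix $\Gamma$ define the operator $J=-2X\otimes\Gamma$ on the spin-$(s+\frac12)$ spinors $\phi_{a_1\dots a_s,\beta}$ (symmetric in the $a_i$). We say that $X(\alpha_i)$ *solves the Berman relations* if $x_i\mapsto J(\alpha_i)=-2X(\alpha_i)\otimes\Gamma(\alpha_i)$ is a representation. **I. $K(AE_3)$.** Let $A=\begin{pmatrix}2&-1&0\\-1&2&-2\\0&-2&2\end{pmatrix}$, $n=d=3$, $\alpha_1=(1,-1,0)$, $\alpha_2=(0,1,-1)$, $\alpha_3=(0,0,2)$, so that $\alpha_i\cdot\alpha_j=G^{ab}(\alpha_i)_a(\alpha_j)_b=A_{ij}$. Real $4\times4$ matrices $\Gamma_0,\dots,\Gamma_3$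 as above exist. For any such choice and for $\alpha=(p_1,p_2,p_3)$ in the root lattice $\bigoplus_i\mathbb Z\alpha_i$ put $\Gamma(\alpha)=\Gamma_1^{p_1}\Gamma_2^{p_2}\Gamma_3^{p_3}\Gamma_*^{(p_1+p_2+p_3)/2}$. Then: 1. $\Gamma(\alpha_1)=\Gamma_{12}$, $\Gamma(\alpha_2)=\Gamma_{23}$, $\Gamma(\alpha_3)=\Gamma_*$, and for all $\alpha,\beta$ in the root lattice $\Gamma(\alpha)\Gamma(\beta)=(-1)^{\alpha\cdot\beta}\Gamma(\beta)\Gamma(\alpha)$, $\Gamma(\alpha)^T=(-1)^{\frac12\alpha\cdot\alpha}\Gamma(\alpha)$, $\Gamma(\alpha)^2=(-1)^{\frac12\alpha\cdot\alpha}\mathbb 1$ (with integer exponents). 2. (Spin $\frac12$.) $x_i\mapsto\frac12\Gamma(\alpha_i)$ is a representation of $K(AE_3)$ on $\mathbb R^4$; its image is isomorphic to $\mathfrak u(2)$, and $\Gamma_*$ commutes with the image. 3. (Central element.) Let $\mathcal A$ be a nonzero real associative unital algebra with elements $\phi^a_\alpha$ ($1\le a\le3$, $1\le\alpha\le4$)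 such that $\{\phi^a_\alpha,\phi^b_\beta\}=G^{ab}\delta_{\alpha\beta}$ (such $\mathcal A$ exist). With $X(\alpha)_{ab}=-\frac12\alpha_a\alpha_b+\frac14G_{ab}$, the assignment $x_i\mapsto X(\alpha_i)_{ab}\,\phi^a_\alpha\,\Gamma(\alpha_i)_{\alpha\beta}\,\phi^b_\beta$ is a representation of $K(AE_3)$ in $\mathcal A$, and $\mathcal Z=\phi^a_\alpha G_{ab}(\Gamma_*)_{\alpha\beta}\phi^b_\beta$ commutes with its image and is not a multiple of $1$. 4. (Spin $\frac32$ and $\frac52$.) The tensors $X(\alpha)_a{}^b=-\frac12\alpha_a\alpha^b+\frac14\delta_a^b$ and $X(\alpha)_{ab}{}^{cd}=\frac12\alpha_a\alpha_b\alpha^c\alpha^d-\alpha_{(a}\delta_{b)}^{(c}\alpha^{d)}+\frac14\delta_{(a}^{(c}\delta_{b)}^{d)}$ solve the Berman relations. 5. (Spin $\frac72$.) For real $u,v$ put $$\begin{aligned}X(\alpha)_{abc}{}^{def}={}&-\tfrac13\alpha_a\alpha_b\alpha_c\alpha^d\alpha^e\alpha^f+\tfrac32\alpha_{(a}\alpha_b\delta_{c)}^{(d}\alpha^e\alpha^{f)}-\tfrac32\alpha_{(a}\delta_b^{(d}\delta_{c)}^e\alpha^{f)}+\tfrac14\delta_{(a}^{(d}\delta_b^e\delta_{c)}^{f)}\\&+u\,\alpha_{(a}G_{bc)}G^{(de}\alpha^{f)}-v\bigl(\alpha_{(a}\alpha_b\alpha_{c)}G^{(de}\alpha^{f)}+\alpha_{(a}G_{bc)}\alpha^{(d}\alpha^e\alpha^{f)}\bigr).\end{aligned}$$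 This solves the Berman relations for $(u,v)=\bigl(\frac{17\pm2\sqrt{66}}{25},\frac{6\pm\sqrt{66}}{30}\bigr)$ and for $(u,v)=\bigl(\frac{19\pm4\sqrt{21}}{50},\frac{6\pm\sqrt{21}}{30}\bigr)$ (upper signs together or lower signs together). The two solutions are distinct: for every choice of the signs the $\sqrt{66}$ representation and the $\sqrt{21}$ representation are inequivalent. **II. $K(G_2^{++})$.** Let $A=\begin{pmatrix}2&-1&0&0\\-1&2&-1&0\\0&-1&2&-1\\0&0&-3&2\end{pmatrix}$, $n=d=4$, $\alpha_1=(1,-1,0,0)$, $\alpha_2=(0,1,-1,0)$, $\alpha_3=(0,0,1,-1)$, $\alpha_4=(0,0,0,1)$. With the rescaled product $\alpha\cdot\beta=3G^{ab}\alpha_a\beta_b$ one has $\alpha_i\cdot\alpha_j=D_iA_{ij}$, $D=(3,3,3,1)$. Real $8\times8$ matrices $\Gamma_0,\dots,\Gamma_4$ as above exist. For any such choice put $\Gamma(\alpha_1)=\Gamma_{12}$, $\Gamma(\alpha_2)=\Gamma_{23}$, $\Gamma(\alpha_3)=\Gamma_{34}$, $\Gamma(\alpha_4)=\Gamma_4\Gamma_*$.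 Then the simple roots satisfy the three relations of I.1 with respect to the rescaled product; $x_i\mapsto\frac12\Gamma(\alpha_i)$ is a representation of $K(G_2^{++})$; and the spin-$\frac32$ tensors $$X(\alpha)_a{}^b=\varepsilon\bigl(-\tfrac12\alpha_a\alpha^b+\tfrac14\delta_a^b\bigr)\ \ (\alpha=\alpha_1,\alpha_2,\alpha_3),\qquad X(\alpha_4)_a{}^b=\varepsilon'\bigl(\tfrac32(\alpha_4)_a(\alpha_4)^b-\tfrac34\delta_a^b\bigr),$$ with $\varepsilon,\varepsilon'\in\{1,-1\}$ and indices raised with the unrescaled metric $G^{ab}=\delta^{ab}-\frac13$, solve the Berman relations. -/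

import Mathlib

open scoped Matrix

/- Associative rings carry the commutator bracket. -/
attribute [local instance 100] LieRing.ofAssociativeRing

noncomputable section

/-! ### Split real Kac-Moody algebras and their maximal compact subalgebras -/

namespace KacMoody

/-- A Lie algebra homomorphism vanishing on an ideal descends to the quotient. -/
def quotLift {L L' : Type*} [LieRing L] [LieAlgebra ℝ L] [LieRing L'] [LieAlgebra ℝ L']
    (I : LieIdeal ℝ L) (φ : L →ₗ⁅ℝ⁆ L') (hφ : ∀ x ∈ I, φ x = 0) : L ⧸ I →ₗ⁅ℝ⁆ L' :=
  { Submodule.liftQ I.toSubmodule (φ : L →ₗ[ℝ] L') (fun x hx => hφ x hx) with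
    map_lie' := by
      rintro ⟨x⟩ ⟨y⟩
      exact φ.map_lie x y }

/-- The split real Kac-Moody algebra `𝔤(A)` in its Chevalley-Serre presentation. -/
abbrev KM {n : ℕ} (A : Matrix (Fin n) (Fin n) ℤ) : Type := Matrix.ToLieAlgebra ℝ A

section generators

variable {n : ℕ} (A : Matrix (Fin n) (Fin n) ℤ)

/-- The projection from the free Lie algebra on the Chevalley generators onto `𝔤(A)`. -/
def proj : FreeLieAlgebra ℝ (CartanMatrix.Generators (Fin n)) →ₗ⁅ℝ⁆ KM A :=
  { Submodule.mkQ (CartanMatrix.Relations.toIdeal ℝ A).toSubmodule with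
    map_lie' := fun {_ _} => rfl }

/-- The Chevalley generator `e i`. -/
def e (i : Fin n) : KM A := proj A (FreeLieAlgebra.of ℝ (CartanMatrix.Generators.E i))

/-- The Chevalley generator `f i`. -/
def f (i : Fin n) : KM A := proj A (FreeLieAlgebra.of ℝ (CartanMatrix.Generators.F i))

/-- The Chevalley generator `h i`. -/
def h (i : Fin n) : KM A := proj A (FreeLieAlgebra.of ℝ (CartanMatrix.Generators.H i))

/-- The images of the Chevalley generators under the Cartan-Chevalley involution. -/
def invGen : CartanMatrix.Generators (Fin n) → KM A
  | .H i => -h A i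
  | .E i => -f A i
  | .F i => -e A i

/-- The Cartan-Chevalley involution, on the free Lie algebra. -/
def invFree : FreeLieAlgebra ℝ (CartanMatrix.Generators (Fin n)) →ₗ⁅ℝ⁆ KM A :=
  FreeLieAlgebra.lift ℝ (invGen A)

theorem proj_eq_zero {x : FreeLieAlgebra ℝ (CartanMatrix.Generators (Fin n))}
    (hx : x ∈ CartanMatrix.Relations.toSet ℝ A) : proj A x = 0 :=
  (Submodule.Quotient.mk_eq_zero _).2 (LieSubmodule.subset_lieSpan hx)

theorem hom_ad_pow {L L' : Type*} [LieRing L] [LieAlgebra ℝ L] [LieRing L'] [LieAlgebra ℝ L']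
    (φ : L →ₗ⁅ℝ⁆ L') (x y : L) (k : ℕ) :
    φ ((LieAlgebra.ad ℝ L x ^ k) y) = (LieAlgebra.ad ℝ L' (φ x) ^ k) (φ y) := by
  induction k with
  | zero => simp
  | succ k ih => simp [pow_succ', ih]

theorem ad_neg_pow {L : Type*} [LieRing L] [LieAlgebra ℝ L] (x y : L) (k : ℕ)
    (hxy : (LieAlgebra.ad ℝ L x ^ k) y = 0) : (LieAlgebra.ad ℝ L (-x) ^ k) y = 0 := by
  rw [map_neg, neg_pow]
  simp [hxy]

theorem invFree_eq_zero (x : FreeLieAlgebra ℝ (CartanMatrix.Generators (Fin n)))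
    (hx : x ∈ CartanMatrix.Relations.toIdeal ℝ A) : invFree A x = 0 := by
  have key : CartanMatrix.Relations.toIdeal ℝ A ≤ (invFree A).ker := by
    refine LieSubmodule.lieSpan_le.2 ?_
    rintro x hx
    have oE : ∀ i, invFree A (FreeLieAlgebra.of ℝ (CartanMatrix.Generators.E i)) = -f A i :=
      fun i => FreeLieAlgebra.lift_of_apply _ _
    have oF : ∀ i, invFree A (FreeLieAlgebra.of ℝ (CartanMatrix.Generators.F i)) = -e A i :=
      fun i => FreeLieAlgebra.lift_of_apply _ _
    have oH : ∀ i, invFree A (FreeLieAlgebra.of ℝ (CartanMatrix.Generators.H i)) = -h A i :=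
      fun i => FreeLieAlgebra.lift_of_apply _ _
    simp only [SetLike.mem_coe, LieHom.mem_ker]
    rcases hx with ((((⟨⟨i, j⟩, rfl⟩ | ⟨⟨i, j⟩, rfl⟩) | ⟨⟨i, j⟩, rfl⟩) | ⟨⟨i, j⟩, rfl⟩) |
      ⟨⟨i, j⟩, rfl⟩) | ⟨⟨i, j⟩, rfl⟩
    · have := proj_eq_zero A (x := CartanMatrix.Relations.HH ℝ (i, j)) (by
        simp [CartanMatrix.Relations.toSet])
      simp only [CartanMatrix.Relations.HH, Function.uncurry, Function.comp, LieHom.map_lie] at this ⊢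
      simp only [oH, neg_lie, lie_neg, neg_neg]
      exact this
    · have := proj_eq_zero A (x := CartanMatrix.Relations.EF ℝ (j, i)) (by
        simp [CartanMatrix.Relations.toSet])
      simp only [CartanMatrix.Relations.EF, Function.uncurry, Function.comp] at this ⊢
      by_cases hij : i = j
      · subst hij
        simp only [if_true, LieHom.map_lie, map_sub, oE, oF, oH, neg_lie, lie_neg, neg_neg] at this ⊢
        have h2 : ⁅e A i, f A i⁆ - h A i = 0 := this
        rw [← lie_skew, ← neg_sub_neg] at h2
        rw [sub_neg_eq_add, ← lie_skew, ← neg_eq_zero, neg_add, neg_neg, ← sub_eq_add_neg]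
        exact this
      · rw [if_neg hij]
        rw [if_neg (Ne.symm hij)] at this
        simp only [LieHom.map_lie, oE, oF, neg_lie, lie_neg, neg_neg] at this ⊢
        rw [← lie_skew, neg_eq_zero]
        exact this
    · have := proj_eq_zero A (x := CartanMatrix.Relations.HF ℝ A (i, j)) (by
        simp [CartanMatrix.Relations.toSet])
      simp only [CartanMatrix.Relations.HE, CartanMatrix.Relations.HF, Function.uncurry,
        Function.comp, LieHom.map_lie, map_sub, map_add, map_zsmul] at this ⊢
      simp only [oH, oE, neg_lie, lie_neg, neg_neg, smul_neg, sub_neg_eq_add]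
      exact this
    · have := proj_eq_zero A (x := CartanMatrix.Relations.HE ℝ A (i, j)) (by
        simp [CartanMatrix.Relations.toSet])
      simp only [CartanMatrix.Relations.HE, CartanMatrix.Relations.HF, Function.uncurry,
        Function.comp, LieHom.map_lie, map_sub, map_add, map_zsmul] at this ⊢
      simp only [oH, oF, neg_lie, lie_neg, neg_neg, smul_neg, ← sub_eq_add_neg]
      exact this
    · have := proj_eq_zero A (x := CartanMatrix.Relations.adF ℝ A (i, j)) (by
        simp [CartanMatrix.Relations.toSet])
      simp only [CartanMatrix.Relations.adE, CartanMatrix.Relations.adF, Function.uncurry,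
        Function.comp, hom_ad_pow, LieHom.map_lie] at this ⊢
      simp only [oE, neg_lie, lie_neg, neg_neg]
      exact ad_neg_pow _ _ _ this
    · have := proj_eq_zero A (x := CartanMatrix.Relations.adE ℝ A (i, j)) (by
        simp [CartanMatrix.Relations.toSet])
      simp only [CartanMatrix.Relations.adE, CartanMatrix.Relations.adF, Function.uncurry,
        Function.comp, hom_ad_pow, LieHom.map_lie] at this ⊢
      simp only [oF, neg_lie, lie_neg, neg_neg]
      exact ad_neg_pow _ _ _ this
  exact key hx

/-- The Cartan-Chevalley involution `ω`. -/
def ω : KM A →ₗ⁅ℝ⁆ KM A :=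
  quotLift (CartanMatrix.Relations.toIdeal ℝ A) (invFree A) (invFree_eq_zero A)

theorem ω_e (i : Fin n) : ω A (e A i) = -f A i := FreeLieAlgebra.lift_of_apply _ _

theorem ω_f (i : Fin n) : ω A (f A i) = -e A i := FreeLieAlgebra.lift_of_apply _ _

theorem ω_h (i : Fin n) : ω A (h A i) = -h A i := FreeLieAlgebra.lift_of_apply _ _

/-- The maximal compact subalgebra `K(𝔤)`: the fixed points of `ω`. -/
def K : LieSubalgebra ℝ (KM A) where
  carrier := {x | ω A x = x}
  add_mem' := fun {x y} (hx : ω A x = x) (hy : ω A y = y) => by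
    change ω A (x + y) = x + y
    rw [map_add, hx, hy]
  zero_mem' := map_zero _
  smul_mem' := fun c x (hx : ω A x = x) => by
    change ω A (c • x) = c • x
    rw [map_smul, hx]
  lie_mem' := fun {x y} (hx : ω A x = x) (hy : ω A y = y) => by
    change ω A ⁅x, y⁆ = ⁅x, y⁆
    rw [LieHom.map_lie, hx, hy]

/-- The generator `x i = e i - f i` of `K(𝔤)`. -/
def x (i : Fin n) : K A :=
  ⟨e A i - f A i, by
    change ω A (e A i - f A i) = e A i - f A i
    rw [map_sub, ω_e, ω_f]; abel⟩

end generators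

/-- `P 0 = t`, `P 1 = t² + 1`, `P m = (t² + m²) P (m-2)`. -/
def bermanPoly : ℕ → Polynomial ℝ
  | 0 => Polynomial.X
  | 1 => Polynomial.X ^ 2 + 1
  | m + 2 => (Polynomial.X ^ 2 + Polynomial.C (((m + 2 : ℕ) : ℝ) ^ 2)) * bermanPoly m

/-- The Berman relations `P_{-A i j}(ad y_i) y_j = 0` (`i ≠ j`). -/
def BermanRelations {n : ℕ} (A : Matrix (Fin n) (Fin n) ℤ) {L : Type*} [LieRing L]
    [LieAlgebra ℝ L] (y : Fin n → L) : Prop :=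
  ∀ i j, i ≠ j →
    Polynomial.aeval (LieAlgebra.ad ℝ L (y i)) (bermanPoly (-A i j).toNat) (y j) = 0

/-- The elements `y i` satisfy the Berman relations, and `x i ↦ y i` defines a (necessarily unique)
homomorphism of Lie algebras on `K(𝔤(A))`. For `L` an algebra of endomorphisms or matrices this says
that `x i ↦ y i` is a representation of `K(𝔤(A))`. -/
def DefinesRep {n : ℕ} (A : Matrix (Fin n) (Fin n) ℤ) {L : Type*} [LieRing L]
    [LieAlgebra ℝ L] (y : Fin n → L) : Prop :=
  BermanRelations A y ∧ ∃! ρ : K A →ₗ⁅ℝ⁆ L, ∀ i, ρ (x A i) = y i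

/-! ### Cartan matrices, roots, DeWitt metric -/

/-- The Cartan matrix of `AE₃`. -/
def cartanAE3 : Matrix (Fin 3) (Fin 3) ℤ :=
  !![2, -1, 0; -1, 2, -2; 0, -2, 2]

/-- The Cartan matrix of `G₂⁺⁺`. -/
def cartanG2pp : Matrix (Fin 4) (Fin 4) ℤ :=
  !![2, -1, 0, 0; -1, 2, -1, 0; 0, -1, 2, -1; 0, 0, -3, 2]

/-- Wall-basis components of the simple roots of `AE₃`. -/
def rootAE3 : Fin 3 → Fin 3 → ℤ :=
  ![![1, -1, 0], ![0, 1, -1], ![0, 0, 2]]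

/-- Wall-basis components of the simple roots of `G₂⁺⁺`. -/
def rootG2pp : Fin 4 → Fin 4 → ℤ :=
  ![![1, -1, 0, 0], ![0, 1, -1, 0], ![0, 0, 1, -1], ![0, 0, 0, 1]]

/-- Real components of an integral vector. -/
def toReal {n : ℕ} (p : Fin n → ℤ) : Fin n → ℝ := fun a => (p a : ℝ)

/-- The DeWitt metric `G^{ab} = δ^{ab} - 1/(n-1)`. -/
def deWitt (n : ℕ) : Matrix (Fin n) (Fin n) ℝ :=
  fun a b => (if a = b then 1 else 0) - 1 / ((n : ℝ) - 1)

/-- The inner product `α_a G^{ab} β_b`. -/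
def rootInner {n : ℕ} (G : Matrix (Fin n) (Fin n) ℝ) (α β : Fin n → ℝ) : ℝ := α ⬝ᵥ (G *ᵥ β)

/-! ### Gamma matrices -/

/-- The diagonal entries of the Minkowski metric (mostly plus). -/
def η {d : ℕ} (μ : Fin (d + 1)) : ℝ := if μ = 0 then -1 else 1

/-- Real `N × N` gamma matrices `Γ_0, …, Γ_d` of `SO(1,d)`, with `Γ_1, …, Γ_d` symmetric and `Γ_0`
antisymmetric. -/
structure IsGamma {d N : ℕ} (Γ : Fin (d + 1) → Matrix (Fin N) (Fin N) ℝ) : Prop where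
  clifford : ∀ μ ν, Γ μ * Γ ν + Γ ν * Γ μ = if μ = ν then (2 * η μ) • 1 else 0
  transpose : ∀ μ, (Γ μ)ᵀ = η μ • Γ μ

/-- `Γ_* = Γ_0 Γ_1 ⋯ Γ_d`. -/
def gammaStar {d N : ℕ} (Γ : Fin (d + 1) → Matrix (Fin N) (Fin N) ℝ) :
    Matrix (Fin N) (Fin N) ℝ := (List.ofFn Γ).prod

/-- `Γ(α) = Γ_1^{p_1} Γ_2^{p_2} Γ_3^{p_3} Γ_*^{(p_1+p_2+p_3)/2}` for `α = (p_1, p_2, p_3)`. -/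
def gammaAE3 (Γ : Fin 4 → Matrix (Fin 4) (Fin 4) ℝ) (p : Fin 3 → ℤ) :
    Matrix (Fin 4) (Fin 4) ℝ :=
  Γ 1 ^ p 0 * Γ 2 ^ p 1 * Γ 3 ^ p 2 * gammaStar Γ ^ ((p 0 + p 1 + p 2) / 2)

/-- The simple-root assignment `Γ_{12}, Γ_{23}, Γ_{34}, Γ_4 Γ_*` for `G₂⁺⁺`. -/
def gammaG2pp (Γ : Fin 5 → Matrix (Fin 8) (Fin 8) ℝ) : Fin 4 → Matrix (Fin 8) (Fin 8) ℝ :=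
  ![Γ 1 * Γ 2, Γ 2 * Γ 3, Γ 3 * Γ 4, Γ 4 * gammaStar Γ]

/-- The relations `Γ(α)Γ(β) = (-1)^{α·β} Γ(β)Γ(α)`, `Γ(α)ᵀ = (-1)^{α·α/2} Γ(α)`,
`Γ(α)² = (-1)^{α·α/2}` for a family of roots `α i` and matrices `g i`; the exponents are integers. -/
def GammaRelations {n N : ℕ} {ι : Type*} (G : Matrix (Fin n) (Fin n) ℝ) (α : ι → Fin n → ℝ)
    (g : ι → Matrix (Fin N) (Fin N) ℝ) : Prop :=
  (∀ i j, ∃ m : ℤ, (m : ℝ) = rootInner G (α i) (α j) ∧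
    g i * g j = ((-1 : ℝ) ^ m) • (g j * g i)) ∧
  (∀ i, ∃ m : ℤ, (m : ℝ) = rootInner G (α i) (α i) / 2 ∧
    (g i)ᵀ = ((-1 : ℝ) ^ m) • g i ∧ g i * g i = ((-1 : ℝ) ^ m) • 1)

/-- The real Lie algebra `𝔲(m)` of skew-Hermitian complex matrices. -/
def unitaryLie (m : ℕ) : LieSubalgebra ℝ (Matrix (Fin m) (Fin m) ℂ) where
  carrier := {M | Mᴴ = -M}
  add_mem' := fun {M N} (hM : Mᴴ = -M) (hN : Nᴴ = -N) => by
    change (M + N)ᴴ = -(M + N)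
    rw [Matrix.conjTranspose_add, hM, hN]; abel
  zero_mem' := by simp
  smul_mem' := fun c M (hM : Mᴴ = -M) => by
    change (c • M)ᴴ = -(c • M)
    rw [Matrix.conjTranspose_smul, hM]; simp
  lie_mem' := fun {M N} hM hN => by
    have hM' : Mᴴ = -M := hM
    have hN' : Nᴴ = -N := hN
    change (⁅M, N⁆)ᴴ = -⁅M, N⁆
    rw [Ring.lie_def, Matrix.conjTranspose_sub, Matrix.conjTranspose_mul,
      Matrix.conjTranspose_mul, hM', hN']
    simp

/-! ### Tensor-spinors and polarisation tensors -/

/-- The spinors `φ_{a_1 … a_s, α}` of spin `s + 1/2`, i.e. the space `V ⊗ W` in components: symmetric in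
the `s` indices `a_i` (`V` is the `s`-fold symmetric tensor power of the `n`-dimensional root space),
with `α` a spinor index (`W = ℝ^N`). -/
def Spinor (n s N : ℕ) : Submodule ℝ ((Fin s → Fin n) → Fin N → ℝ) where
  carrier := {φ | ∀ (σ : Equiv.Perm (Fin s)) (A : Fin s → Fin n), φ (A ∘ σ) = φ A}
  add_mem' := fun {φ ψ} hφ hψ σ A => by simp [hφ σ A, hψ σ A]
  zero_mem' := fun _ _ => rfl
  smul_mem' := fun c φ hφ σ A => by simp [hφ σ A]

/-- Tensors `k_{a_1…a_s}{}^{b_1…b_s}`. -/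
abbrev Tensor (n s : ℕ) : Type := (Fin s → Fin n) → (Fin s → Fin n) → ℝ

/-- Symmetrisation (with total weight one) of `k_{a_1…a_s}{}^{b_1…b_s}` in the lower and in the upper
indices. -/
def symmetrise {n s : ℕ} (k : Tensor n s) : Tensor n s := fun A B =>
  (1 / (Nat.factorial s : ℝ) ^ 2) *
    ∑ σ : Equiv.Perm (Fin s), ∑ τ : Equiv.Perm (Fin s), k (A ∘ σ) (B ∘ τ)

theorem symmetrise_comp {n s : ℕ} (k : Tensor n s) (ρ : Equiv.Perm (Fin s)) (A B : Fin s → Fin n) :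
    symmetrise k (A ∘ ρ) B = symmetrise k A B := by
  unfold symmetrise
  congr 1
  exact Fintype.sum_equiv (Equiv.mulLeft ρ) _ _ fun σ => rfl

/-- `J = -2 X ⊗ Γ`, that is `(J φ)_{A α} = -2 ∑ X_A{}^B Γ_{α β} φ_{B β}`, where `X` is the symmetrisation
of `k` in its lower and upper indices. -/
def higherSpinJ {n s N : ℕ} (k : Tensor n s) (g : Matrix (Fin N) (Fin N) ℝ) :
    Module.End ℝ (Spinor n s N) where
  toFun φ := ⟨fun A α => -2 * ∑ B, ∑ β, symmetrise k A B * g α β * φ.1 B β, by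
    intro ρ A
    simp only [symmetrise_comp]⟩
  map_add' φ ψ := by
    ext A α
    simp [mul_add, Finset.sum_add_distrib]
  map_smul' c φ := by
    ext A α
    simp [Finset.mul_sum, mul_left_comm]

/-- Kronecker delta. -/
def δ {n : ℕ} (a b : Fin n) : ℝ := if a = b then 1 else 0

/-- `α^a = G^{ab} α_b`, with `G` the DeWitt metric. -/
def up {n : ℕ} (α : Fin n → ℝ) : Fin n → ℝ := deWitt n *ᵥ α

/-- `c₁ α_a α^b + c₂ δ_a^b`. (Here and below, symmetrisation in the lower and upper indices is left to
`higherSpinJ`.) -/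
def X32 {n : ℕ} (c₁ c₂ : ℝ) (α : Fin n → ℝ) : Tensor n 1 :=
  fun A B => c₁ * (α (A 0) * up α (B 0)) + c₂ * δ (A 0) (B 0)

/-- `½ α_a α_b α^c α^d - α_(a δ_b)^(c α^d) + ¼ δ_a^(c δ_b^d)`. -/
def X52 {n : ℕ} (α : Fin n → ℝ) : Tensor n 2 :=
  fun A B =>
    1 / 2 * (α (A 0) * α (A 1) * up α (B 0) * up α (B 1))
    - α (A 0) * δ (A 1) (B 0) * up α (B 1)
    + 1 / 4 * (δ (A 0) (B 0) * δ (A 1) (B 1))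

/-- `-⅓ α_a α_b α_c α^d α^e α^f + (3/2) α_(a α_b δ_c)^(d α^e α^f) - (3/2) α_(a δ_b^(d δ_c)^e α^f)
+ ¼ δ_(a^(d δ_b^e δ_c)^f) + u α_(a G_bc) G^(de α^f)
- v (α_(a α_b α_c) G^(de α^f) + α_(a G_bc) α^(d α^e α^f))`,
where `G_{ab}` is the inverse of the DeWitt metric `G^{ab}`. -/
def X72 {n : ℕ} (u v : ℝ) (α : Fin n → ℝ) : Tensor n 3 :=
  fun A B =>
    - (1 / 3) * (α (A 0) * α (A 1) * α (A 2) * up α (B 0) * up α (B 1) * up α (B 2))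
    + 3 / 2 * (α (A 0) * α (A 1) * δ (A 2) (B 0) * up α (B 1) * up α (B 2))
    - 3 / 2 * (α (A 0) * δ (A 1) (B 0) * δ (A 2) (B 1) * up α (B 2))
    + 1 / 4 * (δ (A 0) (B 0) * δ (A 1) (B 1) * δ (A 2) (B 2))
    + u * (α (A 0) * (deWitt n)⁻¹ (A 1) (A 2) * deWitt n (B 0) (B 1) * up α (B 2))
    - v * (α (A 0) * α (A 1) * α (A 2) * deWitt n (B 0) (B 1) * up α (B 2)
        + α (A 0) * (deWitt n)⁻¹ (A 1) (A 2) * up α (B 0) * up α (B 1) * up α (B 2))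

/-- Two families of operators, indexed by generators, are intertwined by a linear isomorphism. -/
def Equivalent {ι V V' : Type*} [AddCommGroup V] [Module ℝ V] [AddCommGroup V'] [Module ℝ V']
    (J : ι → Module.End ℝ V) (J' : ι → Module.End ℝ V') : Prop :=
  ∃ T : V ≃ₗ[ℝ] V', ∀ i v, T (J i v) = J' i (T v)

/-! ### Second quantisation -/

/-- The anticommutation relations `{φ^a_α, φ^b_β} = G^{ab} δ_{αβ}`. -/
def IsCAR {n N : ℕ} {𝒜 : Type*} [Ring 𝒜] [Algebra ℝ 𝒜] (φ : Fin n → Fin N → 𝒜) : Prop :=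
  ∀ a b α β, φ a α * φ b β + φ b β * φ a α = algebraMap ℝ 𝒜 (deWitt n a b * δ α β)

/-- The bilinear operator `X_{ab} φ^a_α M_{αβ} φ^b_β`. -/
def bilinearOp {n N : ℕ} {𝒜 : Type*} [Ring 𝒜] [Algebra ℝ 𝒜] (φ : Fin n → Fin N → 𝒜)
    (X : Matrix (Fin n) (Fin n) ℝ) (M : Matrix (Fin N) (Fin N) ℝ) : 𝒜 :=
  ∑ a, ∑ b, ∑ α, ∑ β, (X a b * M α β) • (φ a α * φ b β)

/-- The spin-3/2 polarisation tensor with both indices down,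
`X(α)_{ab} = -½ α_a α_b + ¼ G_{ab}`. -/
def X32low {n : ℕ} (α : Fin n → ℝ) : Matrix (Fin n) (Fin n) ℝ :=
  fun a b => -(1 / 2) * (α a * α b) + 1 / 4 * (deWitt n)⁻¹ a b

/-- The operator `𝒵 = φ^a_α G_{ab} (Γ_*)_{αβ} φ^b_β`. -/
def centralZ {n d N : ℕ} {𝒜 : Type*} [Ring 𝒜] [Algebra ℝ 𝒜] (φ : Fin n → Fin N → 𝒜)
    (Γ : Fin (d + 1) → Matrix (Fin N) (Fin N) ℝ) : 𝒜 :=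
  bilinearOp φ (deWitt n)⁻¹ (gammaStar Γ)

end KacMoody

end

/-! The proof has two halves: the Berman relations present K(𝔤) (`BermanRelations.definesRep`), and
the operators in question satisfy them.

Presentation. On the string of e j under ad (e i), the operator ad (x i) acts like an element of 𝔰𝔩₂
whose characteristic polynomial is the Berman polynomial; hence the x i satisfy the relations
(`bermanRelations_x`). They generate K(𝔤) by induction on bracket length (`K_lieSpan`). Completeness
is a filtration argument, since a Berman relation is a Serre relation plus shorter brackets. Let a
Lie polynomial vanish at the x i. The algebra 𝔤 acts on the associative algebra presented by the
Serre relations as on a Verma module of highest weight zero (`exists_action`). There x i is left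
multiplication by a generator plus an operator preserving the filtration by word length, so acting
on 1 shows that the leading part vanishes modulo Serre (`toSerre_leading`). Conversely, a
homogeneous polynomial vanishing modulo Serre equals a combination of shorter brackets in any Lie
algebra with the Berman relations (`mem_brFil_of_toSerre_eq_zero`). The vanishing is known only in
an associative algebra; instead of Poincaré-Birkhoff-Witt, the graded adjoint action is enlarged by
a degree derivation, from which an element of positive degree can be read off. Induction on length
then puts every relation in the Berman ideal.

Verification. For J = ±2 X ⊗ Γ, where the Γ square to −1 and commute or anticommute, ad J becomes a
commutator or anticommutator with X up to sign, and the Berman relations turn into polynomial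
identities for X alone (`bermanRelations_of_sol`). On the independent components of symmetric
tensors, with denominators cleared, these are identities of explicit matrices over ℤ, or for spin
7/2 over ℤ√66 and ℤ√21, whose two real embeddings give the two signs. The gamma relations come from
bimultiplicative bookkeeping of signs (`SignComm`). The spin 7/2 representations are separated by
the equation (4J² + 1)(4J² + 9) = 0 for the first generator, which holds only in the √21 case.

For the fermions, S ↦ φSφ transports the Lie algebra of matrices 2Sg, with S antisymmetric and g the
anticommutator form, so the spin 3/2 solution can be reused (`bermanRelations_quad`). The spin 1/2
image is spanned by two anticommuting imaginary units, their product and a central imaginary unit,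
which is 𝔲(2) (`IsQuaternionic`). -/

noncomputable section
namespace KacMoody

/-! ### Generation of Lie algebras by brackets -/

section brackets

/-- The right-normed bracket `[x_{i₁}, [x_{i₂}, …, [x_{iₖ}, x_j]]]`. -/
def br {L : Type*} [LieRing L] {ι : Type*} (x : ι → L) (j : ι) (l : List ι) : L := l.foldr (fun i w => ⁅x i, w⁆) (x j)

@[simp] theorem br_nil {L : Type*} [LieRing L] {ι : Type*} (x : ι → L) (j : ι) : br x j [] = x j := rfl

@[simp] theorem br_cons {L : Type*} [LieRing L] {ι : Type*} (x : ι → L) (j i : ι) (l : List ι) :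
    br x j (i :: l) = ⁅x i, br x j l⁆ := rfl

variable {L : Type*} [LieRing L] [LieAlgebra ℝ L] {L' : Type*} [LieRing L'] [LieAlgebra ℝ L']

/-- The elements of `L` whose adjoint action preserves a subspace. -/
def adStabiliser (M : Submodule ℝ L) : LieSubalgebra ℝ L where
  carrier := {z | ∀ m ∈ M, ⁅z, m⁆ ∈ M}
  add_mem' := fun {a b} ha hb m hm => by
    rw [add_lie]; exact M.add_mem (ha m hm) (hb m hm)
  zero_mem' := fun m _ => by rw [zero_lie]; exact M.zero_mem
  smul_mem' := fun c a ha m hm => by rw [smul_lie]; exact M.smul_mem c (ha m hm)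
  lie_mem' := fun {a b} ha hb m hm => by
    rw [lie_lie]; exact M.sub_mem (ha _ (hb m hm)) (hb _ (ha m hm))

theorem map_br {ι : Type*} (φ : L →ₗ⁅ℝ⁆ L') (x : ι → L) (j : ι) (l : List ι) :
    φ (br x j l) = br (fun i => φ (x i)) j l := by
  induction l with
  | nil => rfl
  | cons i l ih => rw [br_cons, br_cons, LieHom.map_lie, ih]

/-- By the Jacobi identity the elements whose adjoint action preserves the span form a Lie
subalgebra; it contains every x i, since bracketing with x i only lengthens a right-normed bracket.
-/
theorem lieSpan_le_span_br {ι : Type*} (x : ι → L) {z : L}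
    (hz : z ∈ LieSubalgebra.lieSpan ℝ L (Set.range x)) :
    z ∈ Submodule.span ℝ {w | ∃ j l, w = br x j l} := by
  set M := Submodule.span ℝ {w | ∃ j l, w = br x j l} with hM
  have hx : ∀ i, x i ∈ adStabiliser M := by
    intro i m hm
    induction hm using Submodule.span_induction with
    | mem w hw =>
      obtain ⟨j, l, rfl⟩ := hw
      exact Submodule.subset_span ⟨j, i :: l, rfl⟩
    | zero => rw [lie_zero]; exact M.zero_mem
    | add a b _ _ ha hb => rw [lie_add]; exact M.add_mem ha hb
    | smul c a _ ha => rw [lie_smul]; exact M.smul_mem c ha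
  have hle : LieSubalgebra.lieSpan ℝ L (Set.range x) ≤ adStabiliser M := by
    rw [LieSubalgebra.lieSpan_le]
    rintro _ ⟨i, rfl⟩
    exact hx i
  induction hz using LieSubalgebra.lieSpan_induction with
  | mem w hw => obtain ⟨j, rfl⟩ := hw; exact Submodule.subset_span ⟨j, [], rfl⟩
  | zero => exact M.zero_mem
  | add a b _ _ ha hb => exact M.add_mem ha hb
  | smul c a _ ha => exact M.smul_mem c ha
  | lie a b ha' _ _ hb => exact hle ha' b hb

/-- Lifting the generators into the subalgebra they span and including it back fixes the generators,
so by the universal property it is the identity. -/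
theorem freeLie_lieSpan (ι : Type*) :
    LieSubalgebra.lieSpan ℝ (FreeLieAlgebra ℝ ι) (Set.range (FreeLieAlgebra.of ℝ)) = ⊤ := by
  set S := LieSubalgebra.lieSpan ℝ (FreeLieAlgebra ℝ ι) (Set.range (FreeLieAlgebra.of ℝ))
  have hid : S.incl.comp (FreeLieAlgebra.lift ℝ fun i =>
      (⟨FreeLieAlgebra.of ℝ i, LieSubalgebra.subset_lieSpan ⟨i, rfl⟩⟩ : S)) = LieHom.id := by
    refine FreeLieAlgebra.hom_ext fun i => ?_
    simp [FreeLieAlgebra.lift_of_apply]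
  rw [eq_top_iff]
  intro z _
  have := LieHom.congr_fun hid z
  rw [LieHom.comp_apply, LieHom.id_apply] at this
  rw [← this]
  exact Subtype.property _

theorem map_aeval_ad (φ : L →ₗ⁅ℝ⁆ L') (x y : L) (p : Polynomial ℝ) :
    φ (Polynomial.aeval (LieAlgebra.ad ℝ L x) p y) =
      Polynomial.aeval (LieAlgebra.ad ℝ L' (φ x)) p (φ y) := by
  induction p using Polynomial.induction_on' with
  | add p q hp hq => simp [hp, hq]
  | monomial k c => simp [Polynomial.aeval_monomial, Module.algebraMap_end_apply, hom_ad_pow]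

theorem BermanRelations.map {n : ℕ} {A : Matrix (Fin n) (Fin n) ℤ} {y : Fin n → L}
    (hy : BermanRelations A y) (φ : L →ₗ⁅ℝ⁆ L') : BermanRelations A (fun i => φ (y i)) := by
  intro i j hij
  rw [← map_aeval_ad, hy i j hij, map_zero]

end brackets

/-! ### The Berman polynomials of low degree -/

section polys

variable {V : Type*} [AddCommGroup V] [Module ℝ V] (T : Module.End ℝ V) (v : V)

theorem aeval_bermanPoly_zero : Polynomial.aeval T (bermanPoly 0) v = T v := by
  simp [bermanPoly]

theorem aeval_bermanPoly_one : Polynomial.aeval T (bermanPoly 1) v = T (T v) + v := by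
  simp [bermanPoly, pow_two]

theorem aeval_bermanPoly_two :
    Polynomial.aeval T (bermanPoly 2) v = T (T (T v)) + (4 : ℝ) • T v := by
  simp [bermanPoly, pow_two, Module.algebraMap_end_apply]
  module

theorem aeval_bermanPoly_three :
    Polynomial.aeval T (bermanPoly 3) v =
      T (T (T (T v))) + (10 : ℝ) • T (T v) + (9 : ℝ) • v := by
  simp [bermanPoly, pow_two, Module.algebraMap_end_apply]
  module

end polys

/-- Generalised Cartan matrices with off-diagonal entries at least `-3`. -/
structure IsSmallCartan {n : ℕ} (A : Matrix (Fin n) (Fin n) ℤ) : Prop where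
  diag : ∀ i, A i i = 2
  off : ∀ i j, i ≠ j → A i j = 0 ∨ A i j = -1 ∨ A i j = -2 ∨ A i j = -3
  symm_zero : ∀ i j, A i j = 0 → A j i = 0

theorem isSmallCartan_AE3 : IsSmallCartan cartanAE3 := by
  constructor <;> unfold cartanAE3
  · decide
  · intro i j; fin_cases i <;> fin_cases j <;> decide
  · intro i j; fin_cases i <;> fin_cases j <;> decide

theorem isSmallCartan_G2pp : IsSmallCartan cartanG2pp := by
  constructor <;> unfold cartanG2pp
  · decide
  · intro i j; fin_cases i <;> fin_cases j <;> decide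
  · intro i j; fin_cases i <;> fin_cases j <;> decide

/-- The Berman relations spelled out. -/
theorem bermanRelations_iff {n : ℕ} {A : Matrix (Fin n) (Fin n) ℤ} (hA : IsSmallCartan A)
    {L : Type*} [LieRing L] [LieAlgebra ℝ L] (y : Fin n → L) :
    BermanRelations A y ↔ ∀ i j, i ≠ j →
      (A i j = 0 → ⁅y i, y j⁆ = 0) ∧
      (A i j = -1 → ⁅y i, ⁅y i, y j⁆⁆ + y j = 0) ∧
      (A i j = -2 → ⁅y i, ⁅y i, ⁅y i, y j⁆⁆⁆ + (4 : ℝ) • ⁅y i, y j⁆ = 0) ∧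
      (A i j = -3 → ⁅y i, ⁅y i, ⁅y i, ⁅y i, y j⁆⁆⁆⁆ + (10 : ℝ) • ⁅y i, ⁅y i, y j⁆⁆
        + (9 : ℝ) • y j = 0) := by
  unfold BermanRelations
  refine forall_congr' fun i => forall_congr' fun j => forall_congr' fun hij => ?_
  have h1 : ((1 : ℤ)).toNat = 1 := rfl
  have h2 : ((2 : ℤ)).toNat = 2 := rfl
  have h3 : ((3 : ℤ)).toNat = 3 := rfl
  rcases hA.off i j hij with h | h | h | h <;> rw [h] <;>
    simp [h1, h2, h3, aeval_bermanPoly_zero, aeval_bermanPoly_one, aeval_bermanPoly_two,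
      aeval_bermanPoly_three]

/-! ### Chevalley relations -/

/-- The Chevalley relations (without the Serre relations). -/
structure IsChevalley {n : ℕ} (A : Matrix (Fin n) (Fin n) ℤ) {L : Type*} [LieRing L]
    [LieAlgebra ℝ L] (e f h : Fin n → L) : Prop where
  hh : ∀ i j, ⁅h i, h j⁆ = 0
  ef : ∀ i j, ⁅e i, f j⁆ = if i = j then h i else 0
  he : ∀ i j, ⁅h i, e j⁆ = (A i j : ℝ) • e j
  hf : ∀ i j, ⁅h i, f j⁆ = -((A i j : ℝ) • f j)

namespace IsChevalley

variable {n : ℕ} {A : Matrix (Fin n) (Fin n) ℤ} {L : Type*} [LieRing L] [LieAlgebra ℝ L]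
  {e f h : Fin n → L}

theorem fe (H : IsChevalley A e f h) (i j : Fin n) : ⁅f i, e j⁆ = if i = j then -h i else 0 := by
  rw [← lie_skew, H.ef]
  by_cases hij : i = j
  · subst hij; simp
  · simp [hij, Ne.symm hij]

theorem lie_h_pow (H : IsChevalley A e f h) (i j k : Fin n) (p : ℕ) :
    ⁅h k, (LieAlgebra.ad ℝ L (e i) ^ p) (e j)⁆ =
      ((A k j : ℝ) + p * A k i) • (LieAlgebra.ad ℝ L (e i) ^ p) (e j) := by
  induction p with
  | zero => simp [H.he]
  | succ p ih =>
    rw [pow_succ', Module.End.mul_apply, LieAlgebra.ad_apply, leibniz_lie, H.he, ih, smul_lie,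
      lie_smul, ← add_smul]
    congr 1
    push_cast; ring

/-- The 𝔰𝔩₂ lowering formula: f i kills e j, and moving f i through the string collects minus the
weights A i j + 2q for q ≤ p, whose sum is (p + 1)(A i j + p). -/
theorem lie_f_pow (H : IsChevalley A e f h) (hA : IsSmallCartan A) {i j : Fin n} (hij : i ≠ j)
    (p : ℕ) : ⁅f i, (LieAlgebra.ad ℝ L (e i) ^ (p + 1)) (e j)⁆ =
      (-((p + 1 : ℝ) * (A i j + p))) • (LieAlgebra.ad ℝ L (e i) ^ p) (e j) := by
  induction p with
  | zero =>
    rw [zero_add, pow_one, LieAlgebra.ad_apply, leibniz_lie, H.fe, H.fe, if_pos rfl, if_neg hij,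
      lie_zero, neg_lie, H.he]
    simp
  | succ p ih =>
    rw [pow_succ', Module.End.mul_apply, LieAlgebra.ad_apply, leibniz_lie, ih, H.fe, if_pos rfl,
      neg_lie, H.lie_h_pow, lie_smul, hA.diag i, ← LieAlgebra.ad_apply ℝ L (e i),
      ← Module.End.mul_apply, ← pow_succ', ← neg_smul, ← add_smul]
    congr 1
    push_cast; ring

/-- `f k` commutes with the Serre elements. -/
theorem lie_f_serre (H : IsChevalley A e f h) (hA : IsSmallCartan A) {i j : Fin n} (hij : i ≠ j)
    (k : Fin n) : ⁅f k, (LieAlgebra.ad ℝ L (e i) ^ ((-A i j).toNat + 1)) (e j)⁆ = 0 := by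
  have hm : ((-A i j).toNat : ℝ) = -(A i j : ℝ) := by
    have : ((-A i j).toNat : ℤ) = -A i j := by
      rcases hA.off i j hij with h | h | h | h <;> rw [h] <;> rfl
    exact_mod_cast this
  -- For k = i the lowering coefficient vanishes exactly at p = −A i j. For k ≠ i, f k commutes with
  -- e i, so only its bracket with e j matters.
  by_cases hki : k = i
  · subst hki
    rw [H.lie_f_pow hA hij, hm]; simp
  · have key : ∀ p, ⁅f k, (LieAlgebra.ad ℝ L (e i) ^ p) (e j)⁆ =
        (LieAlgebra.ad ℝ L (e i) ^ p) ⁅f k, e j⁆ := by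
      intro p
      induction p with
      | zero => rfl
      | succ p ih =>
        rw [pow_succ', Module.End.mul_apply, LieAlgebra.ad_apply, leibniz_lie, ih, H.fe k i,
          if_neg hki, zero_lie, zero_add]
        rfl
    rw [key, H.fe]
    by_cases hkj : k = j
    · subst hkj
      rw [if_pos rfl, pow_succ, Module.End.mul_apply, LieAlgebra.ad_apply, lie_neg, ← lie_skew,
        neg_neg, H.he, map_smul]
      -- What is left is (ad e i)^(−A i k) applied to A k i • e i: either the coefficient is zero by
      -- `symm_zero`, or at least one factor ad (e i) hits e i.
      by_cases h0 : A i k = 0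
      · simp [hA.symm_zero i k h0]
      · obtain ⟨m, hm⟩ : ∃ m, (-A i k).toNat = m + 1 := by
          refine ⟨(-A i k).toNat - 1, ?_⟩
          rcases hA.off i k hij with h | h | h | h <;> rw [h] <;> first | rfl | exact absurd h h0
        rw [hm, pow_succ, Module.End.mul_apply, LieAlgebra.ad_apply, lie_self, map_zero, smul_zero]
    · rw [if_neg hkj, map_zero]

/-- A representation of `𝔤(A)` from elements satisfying the defining relations. -/
theorem exists_hom (H : IsChevalley A e f h)
    (hE : ∀ i j, i ≠ j → (LieAlgebra.ad ℝ L (e i) ^ ((-A i j).toNat + 1)) (e j) = 0)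
    (hF : ∀ i j, i ≠ j → (LieAlgebra.ad ℝ L (f i) ^ ((-A i j).toNat + 1)) (f j) = 0) :
    ∃ φ : KM A →ₗ⁅ℝ⁆ L, (∀ i, φ (KacMoody.e A i) = e i) ∧ (∀ i, φ (KacMoody.f A i) = f i) ∧
      ∀ i, φ (KacMoody.h A i) = h i := by
  let g : CartanMatrix.Generators (Fin n) → L := fun
    | .H i => h i
    | .E i => e i
    | .F i => f i
  let φ₀ := FreeLieAlgebra.lift ℝ g
  have oE : ∀ i, φ₀ (FreeLieAlgebra.of ℝ (CartanMatrix.Generators.E i)) = e i :=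
    fun i => FreeLieAlgebra.lift_of_apply _ _
  have oF : ∀ i, φ₀ (FreeLieAlgebra.of ℝ (CartanMatrix.Generators.F i)) = f i :=
    fun i => FreeLieAlgebra.lift_of_apply _ _
  have oH : ∀ i, φ₀ (FreeLieAlgebra.of ℝ (CartanMatrix.Generators.H i)) = h i :=
    fun i => FreeLieAlgebra.lift_of_apply _ _
  have key : CartanMatrix.Relations.toIdeal ℝ A ≤ φ₀.ker := by
    refine LieSubmodule.lieSpan_le.2 ?_
    rintro x hx
    simp only [SetLike.mem_coe, LieHom.mem_ker]
    rcases hx with ((((⟨⟨i, j⟩, rfl⟩ | ⟨⟨i, j⟩, rfl⟩) | ⟨⟨i, j⟩, rfl⟩) | ⟨⟨i, j⟩, rfl⟩) |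
      ⟨⟨i, j⟩, rfl⟩) | ⟨⟨i, j⟩, rfl⟩
    · simp [CartanMatrix.Relations.HH, Function.uncurry, oH, H.hh]
    · by_cases hij : i = j
      · subst hij
        simp [CartanMatrix.Relations.EF, Function.uncurry, oH, oE, oF, H.ef]
      · simp [CartanMatrix.Relations.EF, Function.uncurry, oE, oF, H.ef, hij]
    · simp only [CartanMatrix.Relations.HE, Function.uncurry, Function.comp, LieHom.map_lie,
        map_sub, map_zsmul, oH, oE, H.he]
      rw [Int.cast_smul_eq_zsmul, sub_self]
    · simp only [CartanMatrix.Relations.HF, Function.uncurry, Function.comp, LieHom.map_lie,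
        map_add, map_zsmul, oH, oF, H.hf]
      rw [Int.cast_smul_eq_zsmul, neg_add_cancel]
    · simp only [CartanMatrix.Relations.adE, Function.uncurry, Function.comp, hom_ad_pow,
        LieHom.map_lie, oE]
      by_cases hij : i = j
      · subst hij; simp
      · have := hE i j hij
        rwa [pow_succ, Module.End.mul_apply, LieAlgebra.ad_apply] at this
    · simp only [CartanMatrix.Relations.adF, Function.uncurry, Function.comp, hom_ad_pow,
        LieHom.map_lie, oF]
      by_cases hij : i = j
      · subst hij; simp
      · have := hF i j hij
        rwa [pow_succ, Module.End.mul_apply, LieAlgebra.ad_apply] at this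
  exact ⟨quotLift _ φ₀ fun x hx => key hx, oE, oF, oH⟩

end IsChevalley

/-! ### Chevalley, Serre and Berman relations inside 𝔤(A) -/

section KM

variable {n : ℕ} (A : Matrix (Fin n) (Fin n) ℤ)

theorem isChevalley_KM : IsChevalley A (e A) (f A) (h A) where
  hh i j := by
    have := proj_eq_zero A (x := CartanMatrix.Relations.HH ℝ (i, j)) (by
      simp [CartanMatrix.Relations.toSet])
    simp only [CartanMatrix.Relations.HH, Function.uncurry, Function.comp, LieHom.map_lie] at this
    exact this
  ef i j := by
    have := proj_eq_zero A (x := CartanMatrix.Relations.EF ℝ (i, j)) (by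
      simp [CartanMatrix.Relations.toSet])
    simp only [CartanMatrix.Relations.EF, Function.uncurry, Function.comp] at this
    by_cases hij : i = j
    · subst hij
      simp only [if_true, LieHom.map_lie, map_sub] at this ⊢
      exact sub_eq_zero.1 this
    · rw [if_neg hij] at this ⊢
      simp only [LieHom.map_lie] at this
      exact this
  he i j := by
    have := proj_eq_zero A (x := CartanMatrix.Relations.HE ℝ A (i, j)) (by
      simp [CartanMatrix.Relations.toSet])
    simp only [CartanMatrix.Relations.HE, Function.uncurry, Function.comp, LieHom.map_lie, map_sub,
      map_zsmul] at this
    rw [Int.cast_smul_eq_zsmul]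
    exact sub_eq_zero.1 this
  hf i j := by
    have := proj_eq_zero A (x := CartanMatrix.Relations.HF ℝ A (i, j)) (by
      simp [CartanMatrix.Relations.toSet])
    simp only [CartanMatrix.Relations.HF, Function.uncurry, Function.comp, LieHom.map_lie, map_add,
      map_zsmul] at this
    rw [Int.cast_smul_eq_zsmul]
    exact eq_neg_of_add_eq_zero_left this

theorem serre_e (i j : Fin n) :
    (LieAlgebra.ad ℝ (KM A) (e A i) ^ ((-A i j).toNat + 1)) (e A j) = 0 := by
  have := proj_eq_zero A (x := CartanMatrix.Relations.adE ℝ A (i, j)) (by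
    simp [CartanMatrix.Relations.toSet])
  simp only [CartanMatrix.Relations.adE, Function.uncurry, Function.comp, hom_ad_pow,
    LieHom.map_lie] at this
  rw [pow_succ, Module.End.mul_apply, LieAlgebra.ad_apply]
  exact this

/-- The generators of `𝔤(A)` generate it as a Lie algebra. -/
theorem KM_lieSpan (S : LieSubalgebra ℝ (KM A)) (he : ∀ i, e A i ∈ S) (hf : ∀ i, f A i ∈ S)
    (hh : ∀ i, h A i ∈ S) (z : KM A) : z ∈ S := by
  obtain ⟨w, rfl⟩ : ∃ w, proj A w = z := Submodule.mkQ_surjective _ z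
  have : (⊤ : LieSubalgebra ℝ _) ≤ S.comap (proj A) := by
    rw [← freeLie_lieSpan, LieSubalgebra.lieSpan_le]
    rintro _ ⟨g, rfl⟩
    cases g
    · exact hh _
    · exact he _
    · exact hf _
  exact this (Set.mem_univ w)

/-- The generators of `K(𝔤)` satisfy the Berman relations. -/
theorem bermanRelations_x (hA : IsSmallCartan A) : BermanRelations A (x A) := by
  have H := isChevalley_KM A
  have hω : ∀ i, ω A (e A i - f A i) = e A i - f A i := fun i => (x A i).2
  have main : ∀ i j, i ≠ j → Polynomial.aeval (LieAlgebra.ad ℝ (KM A) (e A i - f A i))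
      (bermanPoly (-A i j).toNat) (e A j) = 0 := by
    intro i j hij
    -- On the string v_p = (ad e i)^p (e j), ad (x i) is tridiagonal with zero diagonal: v_{p+1}
    -- goes to v_{p+2} + (p + 1)(A i j + p) v_p. The string stops at v_{1 − A i j} = 0 by Serre, and
    -- the Berman polynomial is the characteristic polynomial of the truncated matrix.
    have step : ∀ p : ℕ, ⁅e A i - f A i, (LieAlgebra.ad ℝ (KM A) (e A i) ^ (p + 1)) (e A j)⁆ =
        (LieAlgebra.ad ℝ (KM A) (e A i) ^ (p + 2)) (e A j) +
        ((p + 1 : ℝ) * (A i j + p)) • (LieAlgebra.ad ℝ (KM A) (e A i) ^ p) (e A j) := by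
      intro p
      rw [sub_lie, H.lie_f_pow hA hij, pow_succ' _ (p + 1), Module.End.mul_apply,
        LieAlgebra.ad_apply, neg_smul, sub_neg_eq_add]
    have step0 : ⁅e A i - f A i, e A j⁆ = (LieAlgebra.ad ℝ (KM A) (e A i) ^ 1) (e A j) := by
      rw [sub_lie, H.fe, if_neg hij, sub_zero, pow_one, LieAlgebra.ad_apply]
    have s0 := step 0
    have s1 := step 1
    have s2 := step 2
    have hs := serre_e A i j
    simp only [Nat.reduceAdd, pow_zero, Module.End.one_apply] at s0 s1 s2
    rcases hA.off i j hij with h | h | h | h <;> rw [h] at hs s0 s1 s2 ⊢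
    · change Polynomial.aeval (LieAlgebra.ad ℝ (KM A) (e A i - f A i)) (bermanPoly 0) (e A j) = 0
      rw [aeval_bermanPoly_zero, LieAlgebra.ad_apply, step0]
      exact hs
    · change Polynomial.aeval (LieAlgebra.ad ℝ (KM A) (e A i - f A i)) (bermanPoly 1) (e A j) = 0
      change (LieAlgebra.ad ℝ (KM A) (e A i) ^ 2) (e A j) = 0 at hs
      rw [aeval_bermanPoly_one, LieAlgebra.ad_apply, LieAlgebra.ad_apply, step0, s0, hs]
      push_cast
      module
    · change Polynomial.aeval (LieAlgebra.ad ℝ (KM A) (e A i - f A i)) (bermanPoly 2) (e A j) = 0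
      change (LieAlgebra.ad ℝ (KM A) (e A i) ^ 3) (e A j) = 0 at hs
      simp only [aeval_bermanPoly_two, LieAlgebra.ad_apply, step0, s0, lie_add, lie_smul, s1, hs]
      push_cast
      module
    · change Polynomial.aeval (LieAlgebra.ad ℝ (KM A) (e A i - f A i)) (bermanPoly 3) (e A j) = 0
      change (LieAlgebra.ad ℝ (KM A) (e A i) ^ 4) (e A j) = 0 at hs
      simp only [aeval_bermanPoly_three, LieAlgebra.ad_apply, step0, s0, lie_add, lie_smul, s1, s2,
        hs]
      push_cast
      module
  intro i j hij
  apply Subtype.ext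
  have h1 := map_aeval_ad (K A).incl (x A i) (x A j) (bermanPoly (-A i j).toNat)
  refine h1.trans ?_
  change Polynomial.aeval (LieAlgebra.ad ℝ (KM A) (e A i - f A i)) (bermanPoly (-A i j).toNat)
    (e A j - f A j) = 0
  -- The involution fixes e i − f i and sends e j to −f j, so the identity for f j follows from the
  -- one for e j.
  have h2 := congrArg (ω A) (main i j hij)
  rw [map_aeval_ad, hω, ω_e, map_zero, map_neg, neg_eq_zero] at h2
  rw [map_sub, main i j hij, h2, sub_zero]

end KM


/-! ### The generators of `K(𝔤)` -/

namespace IsChevalley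

variable {n : ℕ} {A : Matrix (Fin n) (Fin n) ℤ} {L : Type*} [LieRing L] [LieAlgebra ℝ L]
  {e f h : Fin n → L}

theorem lie_h_br (H : IsChevalley A e f h) (k j : Fin n) (l : List (Fin n)) :
    ∃ c : ℝ, ⁅h k, br e j l⁆ = c • br e j l := by
  induction l with
  | nil => exact ⟨_, H.he k j⟩
  | cons i l ih =>
    obtain ⟨c, hc⟩ := ih
    refine ⟨A k i + c, ?_⟩
    rw [br_cons, leibniz_lie, H.he, hc, smul_lie, lie_smul, add_smul]

/-- When f i meets a letter e i it leaves −h i, which acts on the remaining bracket by a scalar; so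
the length drops. The span of the h's is what a single letter, or the last letter of the word,
contributes. -/
theorem lie_f_br (H : IsChevalley A e f h) (i j : Fin n) (l : List (Fin n)) :
    ⁅f i, br e j l⁆ ∈ Submodule.span ℝ {w | ∃ j' l', l'.length < l.length ∧ w = br e j' l'} ⊔
      Submodule.span ℝ (Set.range h) := by
  induction l with
  | nil =>
    rw [br_nil, H.fe]
    refine Submodule.mem_sup_right ?_
    split_ifs
    · exact Submodule.neg_mem _ (Submodule.subset_span ⟨i, rfl⟩)
    · exact Submodule.zero_mem _
  | cons k l ih =>
    rw [br_cons, leibniz_lie]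
    refine Submodule.add_mem _ ?_ ?_
    · rw [H.fe]
      split_ifs
      · obtain ⟨c, hc⟩ := H.lie_h_br i j l
        rw [neg_lie, hc]
        refine Submodule.mem_sup_left (Submodule.neg_mem _ (Submodule.smul_mem _ _ ?_))
        exact Submodule.subset_span ⟨j, l, by simp, rfl⟩
      · rw [zero_lie]; exact Submodule.zero_mem _
    · obtain ⟨a, ha, b, hb, hab⟩ := Submodule.mem_sup.1 ih
      rw [← hab, lie_add]
      refine Submodule.add_mem _ ?_ ?_ <;> refine Submodule.mem_sup_left ?_
      · clear hab
        induction ha using Submodule.span_induction with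
        | mem w hw =>
          obtain ⟨j', l', hl, rfl⟩ := hw
          exact Submodule.subset_span ⟨j', k :: l', by simpa using hl, rfl⟩
        | zero => rw [lie_zero]; exact Submodule.zero_mem _
        | add x y _ _ hx hy => rw [lie_add]; exact Submodule.add_mem _ hx hy
        | smul c x _ hx => rw [lie_smul]; exact Submodule.smul_mem _ _ hx
      · clear hab
        induction hb using Submodule.span_induction with
        | mem w hw =>
          obtain ⟨m, rfl⟩ := hw
          rw [← lie_skew, H.he]
          exact Submodule.neg_mem _ (Submodule.smul_mem _ _
            (Submodule.subset_span ⟨k, [], by simp, rfl⟩))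
        | zero => rw [lie_zero]; exact Submodule.zero_mem _
        | add x y _ _ hx hy => rw [lie_add]; exact Submodule.add_mem _ hx hy
        | smul c x _ hx => rw [lie_smul]; exact Submodule.smul_mem _ _ hx

end IsChevalley

section generation

variable {n : ℕ} (A : Matrix (Fin n) (Fin n) ℤ)

theorem ω_ω (z : KM A) : ω A (ω A z) = z := by
  let S : LieSubalgebra ℝ (KM A) :=
    { carrier := {z | ω A (ω A z) = z}
      add_mem' := fun {a b} (ha : _ = _) (hb : _ = _) => by
        change ω A (ω A (a + b)) = a + b
        rw [map_add, map_add, ha, hb]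
      zero_mem' := by change ω A (ω A 0) = 0; rw [map_zero, map_zero]
      smul_mem' := fun c a (ha : _ = _) => by
        change ω A (ω A (c • a)) = c • a
        rw [map_smul, map_smul, ha]
      lie_mem' := fun {a b} (ha : _ = _) (hb : _ = _) => by
        change ω A (ω A ⁅a, b⁆) = ⁅a, b⁆
        rw [LieHom.map_lie, LieHom.map_lie, ha, hb] }
  refine KM_lieSpan A S (fun i => ?_) (fun i => ?_) (fun i => ?_) z
  · change ω A (ω A (e A i)) = e A i
    rw [ω_e, map_neg, ω_f, neg_neg]
  · change ω A (ω A (f A i)) = f A i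
    rw [ω_f, map_neg, ω_e, neg_neg]
  · change ω A (ω A (h A i)) = h A i
    rw [ω_h, map_neg, ω_h, neg_neg]

/-- The span of the right-normed brackets of the `e i`. -/
def nPos : Submodule ℝ (KM A) := Submodule.span ℝ {w | ∃ j l, w = br (e A) j l}

/-- The span of the `h i`. -/
def cartanPart : Submodule ℝ (KM A) := Submodule.span ℝ (Set.range (h A))

theorem ω_mem_cartanPart {z : KM A} (hz : z ∈ cartanPart A) : ω A z = -z := by
  induction hz using Submodule.span_induction with
  | mem w hw => obtain ⟨i, rfl⟩ := hw; exact ω_h A i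
  | zero => rw [map_zero, neg_zero]
  | add a b _ _ ha hb => rw [map_add, ha, hb, neg_add]
  | smul c a _ ha => rw [map_smul, ha, smul_neg]

theorem lie_e_nPos (i : Fin n) {z : KM A} (hz : z ∈ nPos A) : ⁅e A i, z⁆ ∈ nPos A := by
  induction hz using Submodule.span_induction with
  | mem w hw => obtain ⟨j, l, rfl⟩ := hw; exact Submodule.subset_span ⟨j, i :: l, rfl⟩
  | zero => rw [lie_zero]; exact Submodule.zero_mem _
  | add a b _ _ ha hb => rw [lie_add]; exact Submodule.add_mem _ ha hb
  | smul c a _ ha => rw [lie_smul]; exact Submodule.smul_mem _ _ ha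

theorem lie_e_cartanPart (i : Fin n) {z : KM A} (hz : z ∈ cartanPart A) :
    ⁅e A i, z⁆ ∈ nPos A := by
  induction hz using Submodule.span_induction with
  | mem w hw =>
    obtain ⟨j, rfl⟩ := hw
    rw [← lie_skew, (isChevalley_KM A).he]
    exact Submodule.neg_mem _ (Submodule.smul_mem _ _ (Submodule.subset_span ⟨i, [], rfl⟩))
  | zero => rw [lie_zero]; exact Submodule.zero_mem _
  | add a b _ _ ha hb => rw [lie_add]; exact Submodule.add_mem _ ha hb
  | smul c a _ ha => rw [lie_smul]; exact Submodule.smul_mem _ _ ha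

theorem lie_f_nPos (i : Fin n) {z : KM A} (hz : z ∈ nPos A) :
    ⁅f A i, z⁆ ∈ nPos A ⊔ cartanPart A := by
  induction hz using Submodule.span_induction with
  | mem w hw =>
    obtain ⟨j, l, rfl⟩ := hw
    have hle : Submodule.span ℝ {w | ∃ j' l', l'.length < l.length ∧ w = br (e A) j' l'} ≤
        nPos A := by
      refine Submodule.span_mono ?_
      rintro w ⟨j', l', -, rfl⟩
      exact ⟨j', l', rfl⟩
    have := (isChevalley_KM A).lie_f_br i j l
    exact (sup_le (hle.trans le_sup_left) le_sup_right :
      _ ≤ nPos A ⊔ cartanPart A) this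
  | zero => rw [lie_zero]; exact Submodule.zero_mem _
  | add a b _ _ ha hb => rw [lie_add]; exact Submodule.add_mem _ ha hb
  | smul c a _ ha => rw [lie_smul]; exact Submodule.smul_mem _ _ ha

/-- The triangular decomposition (as a sum): `𝔤 = 𝔫₊ + 𝔥 + ω(𝔫₊)`. -/
theorem triangular (z : KM A) :
    ∃ p ∈ nPos A, ∃ c ∈ cartanPart A, ∃ q ∈ nPos A, z = p + c + ω A q := by
  let M : Submodule ℝ (KM A) :=
    nPos A ⊔ cartanPart A ⊔ (nPos A).map (ω A : KM A →ₗ[ℝ] KM A)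
  have hMdef : ∀ z, z ∈ M ↔
      ∃ p ∈ nPos A, ∃ c ∈ cartanPart A, ∃ q ∈ nPos A, z = p + c + ω A q := by
    intro z
    constructor
    · intro hz
      obtain ⟨a, ha, b, ⟨q, hq, rfl⟩, rfl⟩ := Submodule.mem_sup.1 hz
      obtain ⟨p, hp, c, hc, rfl⟩ := Submodule.mem_sup.1 ha
      exact ⟨p, hp, c, hc, q, hq, rfl⟩
    · rintro ⟨p, hp, c, hc, q, hq, rfl⟩
      exact Submodule.add_mem_sup (Submodule.add_mem_sup hp hc) ⟨q, hq, rfl⟩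
  have hωM : ∀ z ∈ M, ω A z ∈ M := by
    intro z hz
    obtain ⟨p, hp, c, hc, q, hq, rfl⟩ := (hMdef z).1 hz
    refine (hMdef _).2 ⟨q, hq, -c, Submodule.neg_mem _ hc, p, hp, ?_⟩
    rw [map_add, map_add, ω_ω, ω_mem_cartanPart A hc]
    abel
  have heM : ∀ i, e A i ∈ adStabiliser M := by
    intro i z hz
    obtain ⟨p, hp, c, hc, q, hq, rfl⟩ := (hMdef z).1 hz
    -- On the negative part e i acts as the ω-conjugate of −f i on the positive part, which
    -- `lie_f_nPos` controls. Stability under f i then follows by conjugating once more, and under h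
    -- i = ⁅e i, f i⁆ by taking brackets.
    have h1 : ⁅e A i, ω A q⁆ = ω A (-⁅f A i, q⁆) := by
      rw [map_neg, LieHom.map_lie, ω_f, neg_lie, neg_neg]
    have h2 : -⁅f A i, q⁆ ∈ M :=
      M.neg_mem (Submodule.mem_sup_left (lie_f_nPos A i hq))
    rw [lie_add, lie_add, h1]
    refine M.add_mem (M.add_mem ?_ ?_) (hωM _ h2)
    · exact Submodule.mem_sup_left (Submodule.mem_sup_left (lie_e_nPos A i hp))
    · exact Submodule.mem_sup_left (Submodule.mem_sup_left (lie_e_cartanPart A i hc))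
  have hfM : ∀ i, f A i ∈ adStabiliser M := by
    intro i z hz
    have h1 : ⁅f A i, z⁆ = -ω A ⁅e A i, ω A z⁆ := by
      rw [LieHom.map_lie, ω_e, ω_ω, neg_lie, neg_neg]
    rw [h1]
    exact M.neg_mem (hωM _ (heM i _ (hωM _ hz)))
  have hhM : ∀ i, h A i ∈ adStabiliser M := by
    intro i
    have := (isChevalley_KM A).ef i i
    rw [if_pos rfl] at this
    rw [← this]
    exact (adStabiliser M).lie_mem (heM i) (hfM i)
  have hst := KM_lieSpan A (adStabiliser M) heM hfM hhM
  let S : LieSubalgebra ℝ (KM A) := { M with lie_mem' := fun {a b} _ hb => hst a b hb }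
  have heS : ∀ i, e A i ∈ M := fun i =>
    Submodule.mem_sup_left (Submodule.mem_sup_left (Submodule.subset_span ⟨i, [], rfl⟩))
  refine (hMdef z).1 (KM_lieSpan A S heS (fun i => ?_) (fun i => ?_) z)
  · have := hωM _ (heS i)
    rw [ω_e] at this
    exact (M.neg_mem_iff).1 this
  · exact Submodule.mem_sup_left (Submodule.mem_sup_right (Submodule.subset_span ⟨i, rfl⟩))

/-- `K(𝔤)` is generated by the elements `x i`. -/
theorem K_lieSpan : LieSubalgebra.lieSpan ℝ (K A) (Set.range (x A)) = ⊤ := by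
  set S := (LieSubalgebra.lieSpan ℝ (K A) (Set.range (x A))).map (K A).incl with hS
  have hx : ∀ i, e A i - f A i ∈ S := fun i =>
    ⟨x A i, LieSubalgebra.subset_lieSpan ⟨i, rfl⟩, rfl⟩
  -- A fixed point z is ½ (z + ω z), so it is enough that z + ω z lies in the subalgebra generated
  -- by the x i for every z in 𝔤.
  let G : Submodule ℝ (KM A) :=
    S.toSubmodule.comap (LinearMap.id + (ω A : KM A →ₗ[ℝ] KM A))
  have hG : ∀ z, z ∈ G ↔ z + ω A z ∈ S := fun z => Iff.rfl
  have hH : cartanPart A ≤ G := by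
    intro c hc
    rw [hG, ω_mem_cartanPart A hc, add_neg_cancel]
    exact S.zero_mem
  have hw : ∀ m : ℕ, ∀ l : List (Fin n), l.length < m → ∀ j, br (e A) j l ∈ G := by
    intro m
    induction m with
    | zero => intro l hl; simp at hl
    | succ m ih =>
      intro l hl j
      cases l with
      | nil =>
        rw [br_nil, hG, ω_e, ← sub_eq_add_neg]
        exact hx j
      | cons k l =>
        have hl' : l.length < m := by simpa using hl
        have hQ : ⁅f A k, br (e A) j l⁆ ∈ G := by
          refine (sup_le (Submodule.span_le.2 ?_) hH) ((isChevalley_KM A).lie_f_br k j l)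
          rintro _ ⟨j', l', hll, rfl⟩
          exact ih l' (hll.trans hl') j'
        -- With u the shorter bracket, ⁅e k − f k, u + ω u⁆ equals the symmetrisation z + ω z of z =
        -- ⁅e k, u⁆ minus that of z = ⁅f k, u⁆; the latter involves only shorter brackets and Cartan
        -- elements.
        have hw := S.lie_mem (hx k) ((hG _).1 (ih l hl' j))
        rw [hG] at hQ ⊢
        have := S.add_mem hw hQ
        convert this using 1
        rw [br_cons, LieHom.map_lie, LieHom.map_lie, ω_e, ω_f]
        simp only [lie_add, sub_lie, neg_lie]
        abel
  have hP : nPos A ≤ G := by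
    refine Submodule.span_le.2 ?_
    rintro _ ⟨j, l, rfl⟩
    exact hw _ l (Nat.lt_succ_self _) j
  have hall : ∀ z, z ∈ G := by
    intro z
    obtain ⟨p, hp, c, hc, q, hq, rfl⟩ := triangular A z
    refine G.add_mem (G.add_mem (hP hp) (hH hc)) ?_
    rw [hG, ω_ω, add_comm]
    exact hP hq
  rw [eq_top_iff]
  intro z _
  have hz : ω A z.1 = z.1 := z.2
  have h1 := (hG _).1 (hall ((1 / 2 : ℝ) • z.1))
  rw [map_smul, hz, ← add_smul] at h1
  norm_num at h1
  obtain ⟨w, hw, hwz⟩ := h1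
  have : w = z := Subtype.ext hwz
  exact this ▸ hw

end generation


/-! ### The associative algebra with Serre relations and the action of `𝔤(A)` on it -/

section serreAlgebra

variable {n : ℕ} (A : Matrix (Fin n) (Fin n) ℤ)

/-- The Serre element `ad(y_i)^{1-A_ij} y_j`. -/
def serre {L : Type*} [LieRing L] [LieAlgebra ℝ L] (y : Fin n → L) (i j : Fin n) : L :=
  (LieAlgebra.ad ℝ L (y i) ^ ((-A i j).toNat + 1)) (y j)

theorem map_serre {L L' : Type*} [LieRing L] [LieAlgebra ℝ L] [LieRing L'] [LieAlgebra ℝ L']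
    (φ : L →ₗ⁅ℝ⁆ L') (y : Fin n → L) (i j : Fin n) :
    φ (serre A y i j) = serre A (fun k => φ (y k)) i j := hom_ad_pow _ _ _ _

/-- The Serre relations in the free associative algebra. -/
def SerreRel (a b : FreeAlgebra ℝ (Fin n)) : Prop :=
  ∃ i j, i ≠ j ∧ a = serre A (FreeAlgebra.ι ℝ) i j ∧ b = 0

/-- The associative algebra presented by the Serre relations. -/
def SerreAlg : Type := RingQuot (SerreRel A)

instance : Ring (SerreAlg A) := inferInstanceAs (Ring (RingQuot (SerreRel A)))

instance : Algebra ℝ (SerreAlg A) := inferInstanceAs (Algebra ℝ (RingQuot (SerreRel A)))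

/-- The projection from the free algebra. -/
def toSerreAlg : FreeAlgebra ℝ (Fin n) →ₐ[ℝ] SerreAlg A := RingQuot.mkAlgHom ℝ (SerreRel A)

/-- The generators of `SerreAlg`. -/
def gen (i : Fin n) : SerreAlg A := toSerreAlg A (FreeAlgebra.ι ℝ i)

theorem serre_gen {i j : Fin n} (hij : i ≠ j) : serre A (gen A) i j = 0 := by
  have h1 : toSerreAlg A (serre A (FreeAlgebra.ι ℝ) i j) = toSerreAlg A 0 :=
    RingQuot.mkAlgHom_rel ℝ (s := SerreRel A) ⟨i, j, hij, rfl, rfl⟩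
  rw [map_zero] at h1
  rw [← h1]
  exact (map_serre A (toSerreAlg A).toLieHom (FreeAlgebra.ι ℝ) i j).symm

/-- The universal property of `SerreAlg`. -/
theorem exists_algHom {S : Type*} [Ring S] [Algebra ℝ S] (y : Fin n → S)
    (hy : ∀ i j, i ≠ j → serre A y i j = 0) :
    ∃ φ : SerreAlg A →ₐ[ℝ] S, ∀ i, φ (gen A i) = y i := by
  have hrel : ∀ ⦃a b⦄, SerreRel A a b → FreeAlgebra.lift ℝ y a = FreeAlgebra.lift ℝ y b := by
    rintro a b ⟨i, j, hij, rfl, rfl⟩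
    rw [map_zero]
    refine (map_serre A (FreeAlgebra.lift ℝ y).toLieHom (FreeAlgebra.ι ℝ) i j).trans ?_
    convert hy i j hij using 2
    funext k
    exact FreeAlgebra.lift_ι_apply _ _
  refine ⟨(RingQuot.liftAlgHom ℝ ⟨FreeAlgebra.lift ℝ y, hrel⟩ : RingQuot (SerreRel A) →ₐ[ℝ] S),
    fun i => ?_⟩
  exact (RingQuot.liftAlgHom_mkAlgHom_apply ℝ _ hrel _).trans (FreeAlgebra.lift_ι_apply _ _)

variable {A} in
theorem SerreAlg.induction {P : SerreAlg A → Prop} (h1 : ∀ c : ℝ, P (algebraMap ℝ _ c))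
    (hX : ∀ i, P (gen A i)) (hadd : ∀ u v, P u → P v → P (u + v))
    (hmul : ∀ u v, P u → P v → P (u * v)) (u : SerreAlg A) : P u := by
  obtain ⟨z, rfl⟩ : ∃ z, toSerreAlg A z = u := RingQuot.mkAlgHom_surjective ℝ (SerreRel A) u
  induction z with
  | grade0 c => rw [AlgHom.commutes]; exact h1 c
  | grade1 i => exact hX i
  | mul a b ha hb => rw [map_mul]; exact hmul _ _ ha hb
  | add a b ha hb => rw [map_add]; exact hadd _ _ ha hb

/-- A subspace containing `1` and stable under left multiplication by generators is everything. -/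
theorem SerreAlg.mem_of_left {M : Submodule ℝ (SerreAlg A)} (h1 : 1 ∈ M)
    (hX : ∀ i, ∀ v ∈ M, gen A i * v ∈ M) (u : SerreAlg A) : u ∈ M := by
  have key : ∀ u : SerreAlg A, ∀ v ∈ M, u * v ∈ M := by
    intro u
    induction u using SerreAlg.induction with
    | h1 c => intro v hv; rw [← Algebra.smul_def]; exact M.smul_mem c hv
    | hX i => exact hX i
    | hadd a b ha hb => intro v hv; rw [add_mul]; exact M.add_mem (ha v hv) (hb v hv)
    | hmul a b ha hb => intro v hv; rw [mul_assoc]; exact ha _ (hb v hv)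
  simpa using key u 1 h1

/-- Upper triangular matrices with constant diagonal. -/
def tri {S : Type*} [Ring S] (u d w h : S) : Matrix (Fin 3) (Fin 3) S :=
  !![u, d, w; 0, u, h; 0, 0, u]

theorem tri_mul {S : Type*} [Ring S] (u d w h u' d' w' h' : S) :
    tri u d w h * tri u' d' w' h' =
      tri (u * u') (u * d' + d * u') (u * w' + d * h' + w * u') (u * h' + h * u') := by
  ext i j
  fin_cases i <;> fin_cases j <;> simp [tri, Matrix.mul_apply, Fin.sum_univ_three]

theorem tri_add {S : Type*} [Ring S] (u d w h u' d' w' h' : S) :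
    tri u d w h + tri u' d' w' h' = tri (u + u') (d + d') (w + w') (h + h') := by
  ext i j
  fin_cases i <;> fin_cases j <;> simp [tri]

theorem tri_sub {S : Type*} [Ring S] (u d w h u' d' w' h' : S) :
    tri u d w h - tri u' d' w' h' = tri (u - u') (d - d') (w - w') (h - h') := by
  ext i j
  fin_cases i <;> fin_cases j <;> simp [tri]

theorem tri_lie {S : Type*} [Ring S] (u d w h u' d' w' h' : S) :
    ⁅tri u d w h, tri u' d' w' h'⁆ =
      tri ⁅u, u'⁆ (u * d' + d * u' - (u' * d + d' * u))
        (u * w' + d * h' + w * u' - (u' * w + d' * h + w' * u))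
        (u * h' + h * u' - (u' * h + h' * u)) := by
  rw [Ring.lie_def, tri_mul, tri_mul, tri_sub, Ring.lie_def]

/-- The image of the generator `j` under the homomorphism encoding the operator `e k`. -/
def triGen (k j : Fin n) : Matrix (Fin 3) (Fin 3) (SerreAlg A) :=
  tri (gen A j) (if k = j then 1 else 0) 0 (-(A k j : ℝ) • gen A j)

/-- Closed form of a Serre string under the triangular encoding. The entry (0, 1) is a derivation
with scalar values on generators, so it dies after one bracket. The corner is the counterpart of
lowering: for k = i it has the 𝔰𝔩₂ coefficient, with A k i kept symbolic in place of 2. -/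
theorem ad_pow_triGen (k i j : Fin n) (hij : i ≠ j) (p : ℕ) :
    (LieAlgebra.ad ℝ _ (triGen A k i) ^ (p + 1)) (triGen A k j) =
      tri ((LieAlgebra.ad ℝ _ (gen A i) ^ (p + 1)) (gen A j)) 0
        (if k = i then (-((p + 1 : ℝ) * (A k j + p * (A k i / 2)))) •
            (LieAlgebra.ad ℝ _ (gen A i) ^ p) (gen A j)
          else if k = j then (LieAlgebra.ad ℝ _ (gen A i) ^ p) ((A k i : ℝ) • gen A i) else 0)
        (-((A k j : ℝ) + (p + 1) * A k i) • (LieAlgebra.ad ℝ _ (gen A i) ^ (p + 1)) (gen A j)) := by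
  induction p with
  | zero =>
    rw [zero_add, pow_one, pow_one, pow_zero, LieAlgebra.ad_apply, LieAlgebra.ad_apply, triGen,
      triGen, tri_lie]
    congr 1
    · split_ifs <;> simp [add_comm]
    · by_cases hki : k = i
      · have hkj : k ≠ j := fun h => hij (hki.symm.trans h)
        simp [hki, hij]
      · by_cases hkj : k = j
        · subst hkj
          simp only [hki, if_true, if_false, Module.End.one_apply, mul_zero, zero_mul,
            one_mul]
          module
        · simp [hki, hkj]
    · simp only [Ring.lie_def, mul_smul_comm, smul_mul_assoc]
      push_cast
      module
  | succ p ih =>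
    rw [pow_succ', Module.End.mul_apply, ih, LieAlgebra.ad_apply, triGen, tri_lie,
      pow_succ' _ (p + 1), Module.End.mul_apply, LieAlgebra.ad_apply]
    set W := (LieAlgebra.ad ℝ (SerreAlg A) (gen A i) ^ (p + 1)) (gen A j) with hW
    congr 1
    · split_ifs <;> simp
    · by_cases hki : k = i
      · simp only [hki, if_true]
        have hW' : W = gen A i * (LieAlgebra.ad ℝ (SerreAlg A) (gen A i) ^ p) (gen A j) -
            (LieAlgebra.ad ℝ (SerreAlg A) (gen A i) ^ p) (gen A j) * gen A i := by
          rw [hW, pow_succ', Module.End.mul_apply, LieAlgebra.ad_apply, Ring.lie_def]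
        rw [mul_smul_comm, smul_mul_assoc, mul_smul_comm, one_mul, mul_zero, zero_mul, zero_mul,
          zero_add, hW']
        simp only [smul_sub]
        push_cast
        module
      · simp only [hki, if_false]
        split_ifs with hkj
        · rw [pow_succ', Module.End.mul_apply, LieAlgebra.ad_apply, Ring.lie_def]
          simp
        · simp
    · simp only [Ring.lie_def, mul_smul_comm, smul_mul_assoc, smul_sub]
      push_cast
      module

/-- This lets the encoding, and hence the operators E and H, descend to `SerreAlg`. The cases are
those of `lie_f_serre`: the 𝔰𝔩₂ coefficient vanishes for k = i, and for k = j either A k i = 0 or a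
generator is bracketed with itself. -/
theorem serre_triGen (hA : IsSmallCartan A) (k i j : Fin n) (hij : i ≠ j) :
    serre A (triGen A k) i j = 0 := by
  have hz : tri (0 : SerreAlg A) 0 0 0 = 0 := by
    ext a b; fin_cases a <;> fin_cases b <;> rfl
  have hm : ((-A i j).toNat : ℝ) = -(A i j : ℝ) := by
    have : ((-A i j).toNat : ℤ) = -A i j := by
      rcases hA.off i j hij with h | h | h | h <;> rw [h] <;> rfl
    exact_mod_cast this
  have hs := serre_gen A hij
  unfold serre at hs ⊢
  rw [ad_pow_triGen A k i j hij, hs, smul_zero, ← hz]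
  congr 1
  split_ifs with hki hkj
  · subst hki
    rw [hm, hA.diag]
    simp
  · subst hkj
    by_cases h0 : A i k = 0
    · simp [hA.symm_zero i k h0]
    · obtain ⟨m, hm⟩ : ∃ m, (-A i k).toNat = m + 1 := by
        refine ⟨(-A i k).toNat - 1, ?_⟩
        rcases hA.off i k hij with h | h | h | h <;> rw [h] <;> first | rfl | exact absurd h h0
      rw [hm, map_smul, pow_succ, Module.End.mul_apply, LieAlgebra.ad_apply, lie_self, map_zero,
        smul_zero]
  · rfl

/-- The operators `e k` and `h k` on `SerreAlg`. -/
theorem exists_operators (hA : IsSmallCartan A) (k : Fin n) :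
    ∃ E H : Module.End ℝ (SerreAlg A), E 1 = 0 ∧ H 1 = 0 ∧
      (∀ j v, E (gen A j * v) = gen A j * E v + if k = j then H v else 0) ∧
      (∀ j v, H (gen A j * v) = gen A j * H v - (A k j : ℝ) • (gen A j * v)) := by
  obtain ⟨Φ, hΦ⟩ := exists_algHom A (triGen A k) (fun i j hij => serre_triGen A hA k i j hij)
  -- The diagonal of Φ u is u itself, so the last column of Φ (gen j * v) expresses the recursions
  -- for E and H.
  have hdiag : ∀ u, ∃ d w h, Φ u = tri u d w h := by
    intro u
    induction u using SerreAlg.induction with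
    | h1 c =>
      refine ⟨0, 0, 0, ?_⟩
      rw [AlgHom.commutes]
      ext a b
      fin_cases a <;> fin_cases b <;> simp [tri, Matrix.algebraMap_matrix_apply]
    | hX i => exact ⟨_, _, _, hΦ i⟩
    | hadd u v hu hv =>
      obtain ⟨_, _, _, hu⟩ := hu
      obtain ⟨_, _, _, hv⟩ := hv
      exact ⟨_, _, _, by rw [map_add, hu, hv, tri_add]⟩
    | hmul u v hu hv =>
      obtain ⟨_, _, _, hu⟩ := hu
      obtain ⟨_, _, _, hv⟩ := hv
      exact ⟨_, _, _, by rw [map_mul, hu, hv, tri_mul]⟩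
  have h1 : Φ 1 = 1 := map_one Φ
  -- E is the corner entry of Φ and H the entry (1, 2); the entry (0, 1) = δ_kj of a generator
  -- couples H into the recursion for E.
  refine ⟨⟨⟨fun u => Φ u 0 2, fun u v => by simp⟩, fun c u => by simp⟩,
    ⟨⟨fun u => Φ u 1 2, fun u v => by simp⟩, fun c u => by simp⟩, ?_, ?_, ?_, ?_⟩
  · simp [h1]
  · simp [h1]
  · intro j v
    obtain ⟨d, w, h, hv⟩ := hdiag v
    simp only [LinearMap.coe_mk, AddHom.coe_mk, map_mul, hΦ, hv, triGen, tri_mul]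
    simp [tri]
  · intro j v
    obtain ⟨d, w, h, hv⟩ := hdiag v
    simp only [LinearMap.coe_mk, AddHom.coe_mk, map_mul, hΦ, hv, triGen, tri_mul]
    simp only [tri, Matrix.of_apply, Matrix.cons_val]
    rw [smul_mul_assoc]
    module

/-- An operator commuting with left multiplication by the generators and vanishing at `1` is zero. -/
theorem operator_eq_zero (Q : Module.End ℝ (SerreAlg A)) (h1 : Q 1 = 0)
    (hQ : ∀ j, ⁅LinearMap.mulLeft ℝ (gen A j), Q⁆ = 0) : Q = 0 := by
  ext v
  refine SerreAlg.mem_of_left A (M := LinearMap.ker Q) h1 (fun i v hv => ?_) v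
  have := LinearMap.congr_fun (hQ i) v
  rw [Ring.lie_def, LinearMap.sub_apply, Module.End.mul_apply, Module.End.mul_apply,
    LinearMap.mem_ker.1 hv, map_zero, zero_sub, LinearMap.zero_apply, neg_eq_zero] at this
  exact this

end serreAlgebra


/-! ### The Verma-type action and leading terms -/

section action

variable {n : ℕ} (A : Matrix (Fin n) (Fin n) ℤ)

theorem IsChevalley.symm {L : Type*} [LieRing L] [LieAlgebra ℝ L] {e f h : Fin n → L}
    (H : IsChevalley A e f h) : IsChevalley A f e (fun i => -h i) where
  hh i j := by rw [neg_lie, lie_neg, H.hh]; simp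
  ef := H.fe
  he i j := by rw [neg_lie, H.hf, neg_neg]
  hf i j := by rw [neg_lie, H.he]

/-- Used to let f i act by minus left multiplication, so that x i = e i − f i has left
multiplication by a generator, with a plus sign, as leading term. -/
theorem IsChevalley.neg {L : Type*} [LieRing L] [LieAlgebra ℝ L] {e f h : Fin n → L}
    (H : IsChevalley A e f h) : IsChevalley A (fun i => -e i) (fun i => -f i) h where
  hh := H.hh
  ef i j := by rw [neg_lie, lie_neg, neg_neg, H.ef]
  he i j := by rw [lie_neg, H.he, smul_neg]
  hf i j := by rw [lie_neg, H.hf, smul_neg]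

theorem lie_mulLeft_eq {S : Type*} [Ring S] [Algebra ℝ S] (u v : S) :
    ⁅LinearMap.mulLeft ℝ u, LinearMap.mulLeft ℝ v⁆ = LinearMap.mulLeft ℝ ⁅u, v⁆ := by
  ext w
  simp [Ring.lie_def, sub_mul, mul_assoc]

/-- The words of length at most `k` span a filtration of `SerreAlg`. -/
def algFil (k : ℕ) : Submodule ℝ (SerreAlg A) :=
  Submodule.span ℝ {w | ∃ l : List (Fin n), l.length ≤ k ∧ w = (l.map (gen A)).prod}

theorem algFil_mono {k k' : ℕ} (hk : k ≤ k') : algFil A k ≤ algFil A k' := by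
  refine Submodule.span_mono ?_
  rintro _ ⟨l, hl, rfl⟩
  exact ⟨l, hl.trans hk, rfl⟩

theorem one_mem_algFil (k : ℕ) : 1 ∈ algFil A k := Submodule.subset_span ⟨[], by simp, by simp⟩

theorem gen_mul_mem_algFil (i : Fin n) {k : ℕ} {v : SerreAlg A} (hv : v ∈ algFil A k) :
    gen A i * v ∈ algFil A (k + 1) := by
  induction hv using Submodule.span_induction with
  | mem w hw =>
    obtain ⟨l, hl, rfl⟩ := hw
    exact Submodule.subset_span ⟨i :: l, by simpa using hl, by simp⟩
  | zero => rw [mul_zero]; exact Submodule.zero_mem _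
  | add a b _ _ ha hb => rw [mul_add]; exact Submodule.add_mem _ ha hb
  | smul c a _ ha => rw [mul_smul_comm]; exact Submodule.smul_mem _ _ ha

/-- `𝔤(A)` acts on `SerreAlg`, with `-f i` acting by left multiplication and with operators
`e i` preserving the filtration. -/
theorem exists_action (hA : IsSmallCartan A) :
    ∃ φ : KM A →ₗ⁅ℝ⁆ Module.End ℝ (SerreAlg A),
      (∀ i, φ (f A i) = -LinearMap.mulLeft ℝ (gen A i)) ∧
      ∀ i k, ∀ v ∈ algFil A k, φ (e A i) v ∈ algFil A k := by
  choose E H hE1 hH1 hE hH using exists_operators A hA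
  set F : Fin n → Module.End ℝ (SerreAlg A) := fun i => LinearMap.mulLeft ℝ (gen A i) with hF
  have hef : ∀ i j, ⁅E i, F j⁆ = if i = j then H i else 0 := by
    intro i j
    ext v
    rw [Ring.lie_def, LinearMap.sub_apply, Module.End.mul_apply, Module.End.mul_apply,
      LinearMap.mulLeft_apply, LinearMap.mulLeft_apply, hE, add_sub_cancel_left]
    split_ifs <;> rfl
  have hhf : ∀ i j, ⁅H i, F j⁆ = -((A i j : ℝ) • F j) := by
    intro i j
    ext v
    rw [Ring.lie_def, LinearMap.sub_apply, Module.End.mul_apply, Module.End.mul_apply,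
      LinearMap.mulLeft_apply, LinearMap.mulLeft_apply, hH, sub_sub_cancel_left]
    rfl
  -- The relations not involving F on the left-hand side are checked with `operator_eq_zero`: the
  -- difference of the two sides kills 1 and commutes with all left multiplications.
  have hhh : ∀ i j, ⁅H i, H j⁆ = 0 := by
    intro i j
    refine operator_eq_zero A _ ?_ fun k => ?_
    · rw [Ring.lie_def, LinearMap.sub_apply, Module.End.mul_apply, Module.End.mul_apply, hH1, hH1,
        map_zero, map_zero, sub_zero]
    · change ⁅F k, ⁅H i, H j⁆⁆ = 0
      rw [← lie_skew, lie_lie, hhf, hhf]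
      simp only [lie_neg, lie_smul, hhf, smul_neg, neg_neg, neg_eq_zero]
      rw [smul_comm, sub_self]
  have hhe : ∀ i j, ⁅H i, E j⁆ = (A i j : ℝ) • E j := by
    intro i j
    rw [← sub_eq_zero]
    refine operator_eq_zero A _ ?_ fun k => ?_
    · simp [Ring.lie_def, hE1, hH1]
    · change ⁅F k, _⁆ = 0
      rw [← lie_skew, neg_eq_zero, sub_lie, lie_lie, smul_lie, hef, hhf, lie_neg, lie_smul, hef]
      split_ifs with hjk
      · subst hjk; simp [hhh]
      · simp
  have HC : IsChevalley A E F H := ⟨hhh, hef, hhe, hhf⟩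
  have hsF : ∀ i j, i ≠ j → serre A F i j = 0 := by
    intro i j hij
    have : ∀ p, (LieAlgebra.ad ℝ _ (F i) ^ p) (F j) =
        LinearMap.mulLeft ℝ ((LieAlgebra.ad ℝ _ (gen A i) ^ p) (gen A j)) := by
      intro p
      induction p with
      | zero => rfl
      | succ p ih =>
        rw [pow_succ', Module.End.mul_apply, ih, LieAlgebra.ad_apply, lie_mulLeft_eq, pow_succ',
          Module.End.mul_apply, LieAlgebra.ad_apply]
    unfold serre
    rw [this]
    have h0 := serre_gen A hij
    unfold serre at h0
    rw [h0]
    ext v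
    simp
  have hsE : ∀ i j, i ≠ j → serre A E i j = 0 := by
    intro i j hij
    -- No Serre relation for E is built in: the Serre element commutes with every F k by the
    -- Chevalley relations alone, and it kills 1 because each E does.
    refine operator_eq_zero A _ ?_ fun k => HC.lie_f_serre hA hij k
    have : ∀ p, ((LieAlgebra.ad ℝ _ (E i) ^ p) (E j)) 1 = 0 := by
      intro p
      induction p with
      | zero => exact hE1 j
      | succ p ih =>
        rw [pow_succ', Module.End.mul_apply, LieAlgebra.ad_apply, Ring.lie_def,
          LinearMap.sub_apply, Module.End.mul_apply, Module.End.mul_apply, ih, hE1, map_zero,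
          map_zero, sub_zero]
    exact this _
  have hneg : ∀ y : Fin n → Module.End ℝ (SerreAlg A), ∀ i j, serre A y i j = 0 →
      serre A (fun i => -y i) i j = 0 := by
    intro y i j h0
    unfold serre at h0 ⊢
    rw [map_neg, ad_neg_pow _ _ _ h0, neg_zero]
  obtain ⟨φ, hφe, hφf, -⟩ := (HC.neg A).exists_hom (fun i j hij => hneg E i j (hsE i j hij))
    (fun i j hij => hneg F i j (hsF i j hij))
  refine ⟨φ, hφf, fun i k v hv => ?_⟩
  rw [hφe]
  have hHk : ∀ i l, H i ((List.map (gen A) l).prod) ∈ algFil A l.length := by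
    intro i l
    induction l with
    | nil => rw [List.map_nil, List.prod_nil, hH1]; exact Submodule.zero_mem _
    | cons j l ih =>
      rw [List.map_cons, List.prod_cons, hH]
      refine Submodule.sub_mem _ (gen_mul_mem_algFil A j ih) (Submodule.smul_mem _ _ ?_)
      exact Submodule.subset_span ⟨j :: l, le_rfl, by simp⟩
  have hEk : ∀ i l, E i ((List.map (gen A) l).prod) ∈ algFil A l.length := by
    intro i l
    induction l with
    | nil => rw [List.map_nil, List.prod_nil, hE1]; exact Submodule.zero_mem _
    | cons j l ih =>
      rw [List.map_cons, List.prod_cons, hE]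
      refine Submodule.add_mem _ (gen_mul_mem_algFil A j ih) ?_
      split_ifs
      · exact algFil_mono A (Nat.le_succ _) (hHk i l)
      · exact Submodule.zero_mem _
  rw [LinearMap.neg_apply]
  refine Submodule.neg_mem _ ?_
  induction hv using Submodule.span_induction with
  | mem w hw => obtain ⟨l, hl, rfl⟩ := hw; exact algFil_mono A hl (hEk i l)
  | zero => rw [map_zero]; exact Submodule.zero_mem _
  | add a b _ _ ha hb => rw [map_add]; exact Submodule.add_mem _ ha hb
  | smul c a _ ha => rw [map_smul]; exact Submodule.smul_mem _ _ ha

/-- The span of the right-normed brackets of length `r + 1` in the free Lie algebra. -/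
def homPart (n r : ℕ) : Submodule ℝ (FreeLieAlgebra ℝ (Fin n)) :=
  Submodule.span ℝ {w | ∃ j l, l.length = r ∧ w = br (FreeLieAlgebra.of ℝ) j l}

/-- The evaluation of Lie polynomials in `SerreAlg`. -/
def toSerre : FreeLieAlgebra ℝ (Fin n) →ₗ⁅ℝ⁆ SerreAlg A := FreeLieAlgebra.lift ℝ (gen A)

/-- The evaluation of Lie polynomials at the elements `e i - f i`. -/
def toK : FreeLieAlgebra ℝ (Fin n) →ₗ⁅ℝ⁆ KM A := FreeLieAlgebra.lift ℝ fun i => e A i - f A i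

/-- `SerreAlg` is graded: homogeneous Lie polynomials do not meet the lower filtration step. -/
theorem toSerre_eq_zero {r : ℕ} {w : FreeLieAlgebra ℝ (Fin n)} (hw : w ∈ homPart n r)
    (h : toSerre A w ∈ algFil A r) : toSerre A w = 0 := by
  have hpow : ∀ i j p, (LieAlgebra.ad ℝ (Polynomial (SerreAlg A))
      (Polynomial.monomial 1 (gen A i)) ^ p) (Polynomial.monomial 1 (gen A j)) =
      Polynomial.monomial (p + 1) ((LieAlgebra.ad ℝ (SerreAlg A) (gen A i) ^ p) (gen A j)) := by
    intro i j p
    induction p with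
    | zero => simp
    | succ p ih =>
      rw [pow_succ', Module.End.mul_apply, ih, LieAlgebra.ad_apply, Ring.lie_def,
        Polynomial.monomial_mul_monomial, Polynomial.monomial_mul_monomial, add_comm 1 (p + 1),
        ← map_sub, pow_succ', Module.End.mul_apply, LieAlgebra.ad_apply, Ring.lie_def]
  -- Sending each generator to itself times the variable is compatible with the homogeneous Serre
  -- relations and so realises the grading as polynomial degree.
  obtain ⟨γ, hγ⟩ := exists_algHom A (fun i => Polynomial.monomial 1 (gen A i)) (by
    intro i j hij
    have h0 := serre_gen A hij
    unfold serre at h0 ⊢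
    rw [hpow, h0, map_zero])
  have h1 : γ (toSerre A w) = Polynomial.monomial (r + 1) (toSerre A w) := by
    clear h
    induction hw using Submodule.span_induction with
    | mem w hw =>
      obtain ⟨j, l, rfl, rfl⟩ := hw
      rw [map_br]
      induction l with
      | nil => simp [toSerre, FreeLieAlgebra.lift_of_apply, hγ]
      | cons i l ih =>
        rw [br_cons, Ring.lie_def, map_sub, map_mul, map_mul, ih, toSerre,
          FreeLieAlgebra.lift_of_apply, hγ, Polynomial.monomial_mul_monomial,
          Polynomial.monomial_mul_monomial, add_comm 1 (l.length + 1), ← map_sub]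
        rfl
    | zero => simp
    | add a b _ _ ha hb => rw [map_add, map_add, map_add, ha, hb]
    | smul c a _ ha => rw [map_smul, map_smul, ha, Polynomial.smul_monomial]
  have h2 : ∀ u ∈ algFil A r, (γ u).coeff (r + 1) = 0 := by
    intro u hu
    induction hu using Submodule.span_induction with
    | mem u hu =>
      obtain ⟨l, hl, rfl⟩ := hu
      have : γ ((l.map (gen A)).prod) = Polynomial.monomial l.length ((l.map (gen A)).prod) := by
        clear hl
        induction l with
        | nil => simp
        | cons i l ih =>
          rw [List.map_cons, List.prod_cons, map_mul, ih, hγ, Polynomial.monomial_mul_monomial,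
            add_comm, List.length_cons]
      rw [this, Polynomial.coeff_monomial, if_neg (by omega)]
    | zero => simp
    | add a b _ _ ha hb => rw [map_add, Polynomial.coeff_add, ha, hb, add_zero]
    | smul c a _ ha => rw [map_smul, Polynomial.coeff_smul, ha, smul_zero]
  have h3 := h2 _ h
  rw [h1, Polynomial.coeff_monomial, if_pos rfl] at h3
  exact h3

/-- The leading term of the action of a Lie polynomial in the `e i - f i`. -/
theorem leading_term (φ : KM A →ₗ⁅ℝ⁆ Module.End ℝ (SerreAlg A))
    (hf : ∀ i, φ (f A i) = -LinearMap.mulLeft ℝ (gen A i))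
    (he : ∀ i k, ∀ v ∈ algFil A k, φ (e A i) v ∈ algFil A k) {r : ℕ}
    {w : FreeLieAlgebra ℝ (Fin n)} (hw : w ∈ homPart n r) (m : ℕ) (v : SerreAlg A)
    (hv : v ∈ algFil A m) :
    toSerre A w * v ∈ algFil A (m + r + 1) ∧
      φ (toK A w) v - toSerre A w * v ∈ algFil A (m + r) := by
  have hx : ∀ i v, φ (e A i - f A i) v = φ (e A i) v + gen A i * v := by
    intro i v
    rw [map_sub, hf, sub_neg_eq_add]
    rfl
  induction hw using Submodule.span_induction generalizing m v with
  | mem w hw =>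
    obtain ⟨j, l, rfl, rfl⟩ := hw
    induction l generalizing m v with
    | nil =>
      simp only [br_nil, toSerre, toK, FreeLieAlgebra.lift_of_apply, List.length_nil, add_zero, hx,
        add_sub_cancel_right]
      exact ⟨gen_mul_mem_algFil A j hv, he j m v hv⟩
    | cons i l ih =>
      set w := br (FreeLieAlgebra.of ℝ) j l
      have hS : toSerre A (FreeLieAlgebra.of ℝ i) = gen A i := FreeLieAlgebra.lift_of_apply _ _
      have hK : toK A (FreeLieAlgebra.of ℝ i) = e A i - f A i := FreeLieAlgebra.lift_of_apply _ _
      have hgv := gen_mul_mem_algFil A i hv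
      have hev := he i m v hv
      -- The bracket acts as x i ∘ w − w ∘ x i, and x i v splits into e i v in step m and gen i * v
      -- in step m + 1; the induction hypothesis is therefore needed at the three vectors v, gen i *
      -- v and e i v.
      obtain ⟨a1, a2⟩ := ih m v hv
      obtain ⟨b1, b2⟩ := ih (m + 1) (gen A i * v) hgv
      obtain ⟨c1, c2⟩ := ih m (φ (e A i) v) hev
      rw [br_cons, LieHom.map_lie, LieHom.map_lie, LieHom.map_lie, Ring.lie_def, Ring.lie_def,
        sub_mul, LinearMap.sub_apply, Module.End.mul_apply, Module.End.mul_apply, hS, hK, mul_assoc,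
        mul_assoc, hx, hx, map_add]
      have e1 : m + 1 + l.length = m + l.length + 1 := by omega
      rw [e1] at b1 b2
      rw [List.length_cons, ← add_assoc]
      constructor
      · exact Submodule.sub_mem _ (gen_mul_mem_algFil A i a1) b1
      · have d1 := he i _ _ (Submodule.add_mem _ (algFil_mono A (Nat.le_succ _) a2) a1)
        rw [sub_add_cancel] at d1
        have d2 := gen_mul_mem_algFil A i a2
        have d3 := Submodule.add_mem _ (algFil_mono A (Nat.le_succ _) c2) c1
        rw [sub_add_cancel] at d3
        have := Submodule.sub_mem _ (Submodule.sub_mem _ (Submodule.add_mem _ d1 d2) d3) b2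
        convert this using 1
        rw [mul_sub]
        abel
  | zero =>
    simp only [map_zero, zero_mul, LinearMap.zero_apply, sub_zero]
    exact ⟨Submodule.zero_mem _, Submodule.zero_mem _⟩
  | add a b _ _ ha hb =>
    obtain ⟨a1, a2⟩ := ha m v hv
    obtain ⟨b1, b2⟩ := hb m v hv
    rw [map_add, map_add, map_add, add_mul, LinearMap.add_apply]
    refine ⟨Submodule.add_mem _ a1 b1, ?_⟩
    convert Submodule.add_mem _ a2 b2 using 1
    abel
  | smul c a _ ha =>
    obtain ⟨a1, a2⟩ := ha m v hv
    rw [map_smul, map_smul, map_smul, smul_mul_assoc, LinearMap.smul_apply, ← smul_sub]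
    exact ⟨Submodule.smul_mem _ _ a1, Submodule.smul_mem _ _ a2⟩

/-- If a Lie polynomial vanishes at `e i - f i`, then its leading part vanishes in `SerreAlg`. -/
theorem toSerre_leading (hA : IsSmallCartan A) {r : ℕ} {w w' : FreeLieAlgebra ℝ (Fin n)}
    (hw : w ∈ homPart n r)
    (hw' : w' ∈ Submodule.span ℝ
      {w | ∃ j l, l.length < r ∧ w = br (FreeLieAlgebra.of (X := Fin n) ℝ) j l})
    (h : toK A (w + w') = 0) : toSerre A w = 0 := by
  obtain ⟨φ, hf, he⟩ := exists_action A hA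
  -- Acting on 1, of filtration 0: `toSerre A w` agrees modulo `algFil A r` with the action of w,
  -- hence with minus the action of w', which itself stays in `algFil A r`.
  obtain ⟨-, h2⟩ := leading_term A φ hf he hw 0 1 (one_mem_algFil A 0)
  have h3 : φ (toK A w') 1 ∈ algFil A r := by
    clear h
    induction hw' using Submodule.span_induction with
    | mem w hw =>
      obtain ⟨j, l, hl, rfl⟩ := hw
      obtain ⟨c1, c2⟩ := leading_term A φ hf he (Submodule.subset_span ⟨j, l, rfl, rfl⟩) 0 1
        (one_mem_algFil A 0)
      have := Submodule.add_mem _ (algFil_mono A (Nat.le_succ _) c2) c1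
      rw [sub_add_cancel] at this
      exact algFil_mono A (by omega) this
    | zero => simp
    | add a b _ _ ha hb =>
      rw [map_add, map_add, LinearMap.add_apply]; exact Submodule.add_mem _ ha hb
    | smul c a _ ha =>
      rw [map_smul, map_smul, LinearMap.smul_apply]; exact Submodule.smul_mem _ _ ha
  rw [map_add, add_eq_zero_iff_eq_neg] at h
  rw [h, map_neg, LinearMap.neg_apply, mul_one, zero_add] at h2
  refine toSerre_eq_zero A hw ?_
  have := Submodule.neg_mem _ (Submodule.add_mem _ h2 h3)
  convert this using 1
  abel

end action


/-! ### Berman's presentation of `K(𝔤)` -/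

section berman

variable {n : ℕ} (A : Matrix (Fin n) (Fin n) ℤ)

/-- The kernel of the presentation is the two-sided ideal generated by the Serre elements, obtained
by induction over the equivalence relation that defines the quotient ring. -/
theorem mem_of_toSerreAlg_eq_zero {Z : Submodule ℝ (FreeAlgebra ℝ (Fin n))}
    (hl : ∀ a, ∀ z ∈ Z, a * z ∈ Z) (hr : ∀ a, ∀ z ∈ Z, z * a ∈ Z)
    (hS : ∀ i j, i ≠ j → serre A (FreeAlgebra.ι ℝ) i j ∈ Z) {z : FreeAlgebra ℝ (Fin n)}
    (h : toSerreAlg A z = 0) : z ∈ Z := by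
  have h1 : RingQuot.mkAlgHom ℝ (SerreRel A) z = RingQuot.mkAlgHom ℝ (SerreRel A) 0 :=
    h.trans (map_zero (toSerreAlg A)).symm
  simp only [RingQuot.mkAlgHom_def, RingQuot.mkRingHom_def, AlgHom.coe_mk, RingHom.coe_mk,
    MonoidHom.coe_mk, OneHom.coe_mk, RingQuot.mk.injEq] at h1
  have key : ∀ a b, RingQuot.Rel (SerreRel A) a b → a - b ∈ Z := by
    intro a b hab
    induction hab with
    | of hab =>
      obtain ⟨i, j, hij, rfl, rfl⟩ := hab
      rw [sub_zero]; exact hS i j hij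
    | add_left _ ih => rw [add_sub_add_right_eq_sub]; exact ih
    | mul_left _ ih => rw [← sub_mul]; exact hr _ _ ih
    | mul_right _ ih => rw [← mul_sub]; exact hl _ _ ih
  have key2 : ∀ a b, Relation.EqvGen (RingQuot.Rel (SerreRel A)) a b → a - b ∈ Z := by
    intro a b hab
    induction hab with
    | rel a b hab => exact key a b hab
    | refl a => rw [sub_self]; exact Z.zero_mem
    | symm a b _ ih => rw [← neg_sub]; exact Z.neg_mem ih
    | trans a b c _ _ h1 h2 => rw [← sub_add_sub_cancel a b c]; exact Z.add_mem h1 h2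
  simpa using key2 _ _ (Quot.eqvGen_exact h1)

variable {L : Type*} [LieRing L] [LieAlgebra ℝ L]

/-- The span of the right-normed brackets of length at most `k`. -/
def brFil (y : Fin n → L) (k : ℕ) : Submodule ℝ L :=
  Submodule.span ℝ {w | ∃ j l, l.length < k ∧ w = br y j l}

theorem brFil_mono (y : Fin n → L) {k k' : ℕ} (hk : k ≤ k') : brFil y k ≤ brFil y k' := by
  refine Submodule.span_mono ?_
  rintro _ ⟨j, l, hl, rfl⟩
  exact ⟨j, l, hl.trans_le hk, rfl⟩

theorem br_mem_brFil (y : Fin n → L) (j : Fin n) (l : List (Fin n)) {k : ℕ} (hl : l.length < k) :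
    br y j l ∈ brFil y k := Submodule.subset_span ⟨j, l, hl, rfl⟩

theorem lie_gen_mem_brFil (y : Fin n → L) (i : Fin n) {k : ℕ} {v : L} (hv : v ∈ brFil y k) :
    ⁅y i, v⁆ ∈ brFil y (k + 1) := by
  induction hv using Submodule.span_induction with
  | mem w hw =>
    obtain ⟨j, l, hl, rfl⟩ := hw
    exact br_mem_brFil y j (i :: l) (by simpa using hl)
  | zero => rw [lie_zero]; exact Submodule.zero_mem _
  | add a b _ _ ha hb => rw [lie_add]; exact Submodule.add_mem _ ha hb
  | smul c a _ ha => rw [lie_smul]; exact Submodule.smul_mem _ _ ha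

/-- Lengths are subadditive: the Jacobi identity peels the letters off the left bracket one at a
time and applies them to the right one. -/
theorem lie_mem_brFil (y : Fin n → L) {k m : ℕ} {u v : L} (hu : u ∈ brFil y k)
    (hv : v ∈ brFil y m) : ⁅u, v⁆ ∈ brFil y (k + m) := by
  induction hu using Submodule.span_induction generalizing m v with
  | mem w hw =>
    obtain ⟨j, l, hl, rfl⟩ := hw
    induction l generalizing m v k with
    | nil =>
      refine brFil_mono y ?_ (lie_gen_mem_brFil y j hv)
      simp at hl; omega
    | cons i l ih =>
      obtain ⟨k, rfl⟩ : ∃ k', k = k' + 1 := ⟨k - 1, by simp at hl; omega⟩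
      have hl' : l.length < k := by simpa using hl
      rw [br_cons, lie_lie]
      refine Submodule.sub_mem _ ?_ ?_
      · exact brFil_mono y (by omega) (lie_gen_mem_brFil y i (ih hv hl'))
      · exact brFil_mono y (by omega) (ih (lie_gen_mem_brFil y i hv) hl')
  | zero => rw [zero_lie]; exact Submodule.zero_mem _
  | add a b _ _ ha hb => rw [add_lie]; exact Submodule.add_mem _ (ha hv) (hb hv)
  | smul c a _ ha => rw [smul_lie]; exact Submodule.smul_mem _ _ (ha hv)

/-- By the Berman relations, Serre elements drop in the filtration by length. -/
theorem serre_mem_brFil (hA : IsSmallCartan A) {y : Fin n → L} (hy : BermanRelations A y)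
    {i j : Fin n} (hij : i ≠ j) : serre A y i j ∈ brFil y ((-A i j).toNat + 1) := by
  obtain ⟨h0, h1, h2, h3⟩ := (bermanRelations_iff hA y).1 hy i j hij
  have m0 : ∀ k, y j ∈ brFil y (k + 1) := fun k => br_mem_brFil y j [] (by simp)
  unfold serre
  rcases hA.off i j hij with h | h | h | h
  · rw [h]
    change ⁅y i, y j⁆ ∈ _
    rw [h0 h]; exact Submodule.zero_mem _
  · rw [h]
    change ⁅y i, ⁅y i, y j⁆⁆ ∈ _
    rw [eq_neg_of_add_eq_zero_left (h1 h)]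
    exact Submodule.neg_mem _ (m0 _)
  · rw [h]
    change ⁅y i, ⁅y i, ⁅y i, y j⁆⁆⁆ ∈ brFil y 3
    rw [eq_neg_of_add_eq_zero_left (h2 h)]
    exact Submodule.neg_mem _ (Submodule.smul_mem _ _ (lie_gen_mem_brFil y i (m0 1)))
  · rw [h]
    change ⁅y i, ⁅y i, ⁅y i, ⁅y i, y j⁆⁆⁆⁆ ∈ brFil y 4
    have := h3 h
    rw [add_assoc] at this
    rw [eq_neg_of_add_eq_zero_left this]
    exact Submodule.neg_mem _ (Submodule.add_mem _ (Submodule.smul_mem _ _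
      (lie_gen_mem_brFil y i (lie_gen_mem_brFil y i (m0 1)))) (Submodule.smul_mem _ _ (m0 3)))

/-- The operator of degree `k` on sequences in `L`, extended by one dimension on which it acts like
`k` times evaluation. -/
def shiftAd (k : ℕ) : L →ₗ[ℝ] Module.End ℝ ((ℕ → L) × ℝ) :=
  LinearMap.mk₂ ℝ (fun w p => (fun d => if k ≤ d then
      ⁅w, p.1 (d - k)⁆ + if d = k then (p.2 * k) • w else 0 else 0, 0))
    (by
      intro a b p
      ext d
      · dsimp
        split_ifs <;> simp
        abel
      · simp)
    (by
      intro c a p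
      ext d
      · dsimp
        split_ifs
        · rw [smul_lie, smul_add, smul_comm]
        · rw [smul_lie, add_zero, add_zero]
        · rw [smul_zero]
      · simp)
    (by
      intro a p q
      ext d
      · dsimp
        split_ifs <;> simp [add_mul, add_smul]
        abel
      · simp)
    (by
      intro c a p
      ext d
      · dsimp
        split_ifs <;> simp [mul_smul]
      · simp)

theorem shiftAd_apply (k : ℕ) (w : L) (p : (ℕ → L) × ℝ) :
    shiftAd k w p = (fun d => if k ≤ d then
      ⁅w, p.1 (d - k)⁆ + if d = k then (p.2 * k) • w else 0 else 0, 0) := rfl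

/-- `shiftAd k w` is the adjoint action of w t^k on power series with coefficients in L, enlarged by
minus the degree derivation as the vector (0, 1), which w t^k sends to k w t^k. Degrees add under
brackets because k⁅u, w⁆ − ⁅w, u⁆ = (k + 1)⁅u, w⁆. -/
theorem shiftAd_lie (k : ℕ) (hk : 1 ≤ k) (u w : L) :
    ⁅shiftAd 1 u, shiftAd k w⁆ = shiftAd (k + 1) ⁅u, w⁆ := by
  refine LinearMap.ext fun p => ?_
  rw [Ring.lie_def, LinearMap.sub_apply, Module.End.mul_apply, Module.End.mul_apply]
  simp only [shiftAd_apply]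
  refine Prod.ext (funext fun d => ?_) (by simp)
  simp only [Prod.fst_sub, Pi.sub_apply]
  by_cases hd : k + 1 ≤ d
  · obtain ⟨m, rfl⟩ := Nat.exists_eq_add_of_le hd
    have e1 : k + 1 + m - 1 = k + m := by omega
    have e2 : k + 1 + m - k = m + 1 := by omega
    simp only [e1, e2, hd, show 1 ≤ k + 1 + m by omega, show k ≤ k + m by omega,
      show k ≤ k + 1 + m by omega, show 1 ≤ m + 1 by omega, if_true, Nat.add_sub_cancel,
      Nat.add_sub_cancel_left, show ¬ (k + 1 + m = 1) by omega, show ¬ (k + 1 + m = k) by omega,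
      if_false, zero_mul, zero_smul, add_zero]
    rcases m with _ | m
    · simp only [add_zero, zero_add, if_true, lie_add, lie_smul, lie_lie]
      rw [← lie_skew u w]
      push_cast
      module
    · simp only [show ¬ (k + (m + 1) = k) by omega, show ¬ (k + 1 + (m + 1) = k + 1) by omega,
        show ¬ (m + 1 + 1 = 1) by omega, if_false, add_zero, lie_lie]
  · by_cases hd1 : k ≤ d
    · have : d = k := by omega
      subst this
      simp [show ¬ (d + 1 ≤ d) by omega, show ¬ (d ≤ d - 1) by omega]
    · simp only [hd, if_false, hd1, sub_zero]
      by_cases h1 : 1 ≤ d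
      · simp only [h1, show ¬ (k ≤ d - 1) by omega, if_false, lie_zero, zero_mul,
          zero_smul, ite_self, add_zero]
      · simp [h1]

theorem shiftAd_ad_pow (u w : L) (p : ℕ) :
    (LieAlgebra.ad ℝ _ (shiftAd 1 u) ^ p) (shiftAd 1 w) =
      shiftAd (p + 1) ((LieAlgebra.ad ℝ L u ^ p) w) := by
  induction p with
  | zero => rfl
  | succ p ih =>
    rw [pow_succ', Module.End.mul_apply, ih, LieAlgebra.ad_apply, shiftAd_lie _ (by omega),
      pow_succ', Module.End.mul_apply, LieAlgebra.ad_apply]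

theorem shiftAd_br (y : Fin n → L) (j : Fin n) (l : List (Fin n)) :
    br (fun i => shiftAd 1 (y i)) j l = shiftAd (l.length + 1) (br y j l) := by
  induction l with
  | nil => rfl
  | cons i l ih => rw [br_cons, ih, shiftAd_lie _ (by omega), br_cons, List.length_cons]

/-- Homogeneous Lie polynomials that vanish modulo the Serre relations drop in the filtration of
every Lie algebra with the Berman relations. -/
theorem mem_brFil_of_toSerre_eq_zero (hA : IsSmallCartan A) {y : Fin n → L}
    (hy : BermanRelations A y) {r : ℕ} {w : FreeLieAlgebra ℝ (Fin n)} (hw : w ∈ homPart n r)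
    (h : toSerre A w = 0) : FreeLieAlgebra.lift ℝ y w ∈ brFil y r := by
  -- P holds the sequences whose entries respect the length filtration; Q asks for one step less and
  -- no derivation component. Moving P into Q means dropping in the filtration.
  let P : Submodule ℝ ((ℕ → L) × ℝ) :=
    { carrier := {p | ∀ k, p.1 k ∈ brFil y k}
      add_mem' := fun {p q} hp hq k => Submodule.add_mem _ (hp k) (hq k)
      zero_mem' := fun k => Submodule.zero_mem _
      smul_mem' := fun c p hp k => Submodule.smul_mem _ c (hp k) }
  let Q : Submodule ℝ ((ℕ → L) × ℝ) :=
    { carrier := {p | (∀ k, p.1 k ∈ brFil y (k - 1)) ∧ p.2 = 0}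
      add_mem' := fun {p q} hp hq => ⟨fun k => Submodule.add_mem _ (hp.1 k) (hq.1 k), by
        rw [Prod.snd_add, hp.2, hq.2, add_zero]⟩
      zero_mem' := ⟨fun k => Submodule.zero_mem _, rfl⟩
      smul_mem' := fun c p hp => ⟨fun k => Submodule.smul_mem _ c (hp.1 k), by
        rw [Prod.smul_snd, hp.2, smul_zero]⟩ }
  have hb0 : brFil y 0 = ⊥ := by
    rw [eq_bot_iff]
    refine Submodule.span_le.2 ?_
    rintro _ ⟨j, l, hl, -⟩
    simp at hl
  have hPP : ∀ k, 1 ≤ k → ∀ u ∈ brFil y k, ∀ p ∈ P, shiftAd k u p ∈ P := by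
    intro k _ u hu p hp d
    simp only [shiftAd_apply]
    split_ifs with h1 h2
    · refine Submodule.add_mem _ ?_ (Submodule.smul_mem _ _ (h2 ▸ hu))
      exact brFil_mono y (by omega) (lie_mem_brFil y hu (hp (d - k)))
    · rw [add_zero]
      exact brFil_mono y (by omega) (lie_mem_brFil y hu (hp (d - k)))
    · exact Submodule.zero_mem _
  have hPQ : ∀ k, 1 ≤ k → ∀ u ∈ brFil y (k - 1), ∀ p ∈ P, shiftAd k u p ∈ Q := by
    intro k hk u hu p hp
    refine ⟨fun d => ?_, rfl⟩
    simp only [shiftAd_apply]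
    split_ifs with h1 h2
    · refine Submodule.add_mem _ ?_ (Submodule.smul_mem _ _ (h2 ▸ hu))
      exact brFil_mono y (by omega) (lie_mem_brFil y hu (hp (d - k)))
    · rw [add_zero]
      exact brFil_mono y (by omega) (lie_mem_brFil y hu (hp (d - k)))
    · exact Submodule.zero_mem _
  have hQQ : ∀ i, ∀ p ∈ Q, shiftAd 1 (y i) p ∈ Q := by
    intro i p hp
    refine ⟨fun d => ?_, rfl⟩
    simp only [shiftAd_apply, hp.2, zero_mul, zero_smul, ite_self, add_zero]
    split_ifs with h1
    · have h2 := hp.1 (d - 1)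
      -- In degree 1 truncated subtraction makes the bounds of the entries 0 and 1 coincide, both
      -- being `brFil y 0`; this space is zero, so nothing is lost.
      by_cases h3 : d = 1
      · subst h3
        simp only [Nat.sub_self, Nat.zero_sub, hb0, Submodule.mem_bot] at h2 ⊢
        rw [h2, lie_zero]
      · exact brFil_mono y (by omega) (lie_gen_mem_brFil y i h2)
    · exact Submodule.zero_mem _
  have hgen : ∀ i, y i ∈ brFil y 1 := fun i => br_mem_brFil y i [] (by simp)
  obtain ⟨a, hai⟩ : ∃ a : FreeAlgebra ℝ (Fin n) →ₐ[ℝ] Module.End ℝ ((ℕ → L) × ℝ),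
      ∀ i, a (FreeAlgebra.ι ℝ i) = shiftAd 1 (y i) :=
    ⟨FreeAlgebra.lift ℝ fun i => shiftAd 1 (y i), fun i => FreeAlgebra.lift_ι_apply _ _⟩
  have ha : ∀ z, (∀ p ∈ P, a z p ∈ P) ∧ ∀ p ∈ Q, a z p ∈ Q := by
    intro z
    induction z with
    | grade0 c =>
      rw [AlgHom.commutes]
      exact ⟨fun p hp => P.smul_mem c hp, fun p hp => Q.smul_mem c hp⟩
    | grade1 i =>
      rw [hai]
      exact ⟨hPP 1 le_rfl _ (hgen i), hQQ i⟩
    | mul u v hu hv =>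
      rw [map_mul]
      exact ⟨fun p hp => hu.1 _ (hv.1 p hp), fun p hp => hu.2 _ (hv.2 p hp)⟩
    | add u v hu hv =>
      rw [map_add]
      exact ⟨fun p hp => P.add_mem (hu.1 p hp) (hv.1 p hp),
        fun p hp => Q.add_mem (hu.2 p hp) (hv.2 p hp)⟩
  -- Since the free algebra preserves both P and Q, the elements carrying P into Q form a two-sided
  -- ideal. It contains the Serre elements by `serre_mem_brFil`, hence the kernel of the projection
  -- to `SerreAlg`.
  let Z : Submodule ℝ (FreeAlgebra ℝ (Fin n)) :=
    { carrier := {z | ∀ p ∈ P, a z p ∈ Q}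
      add_mem' := fun {u v} hu hv p hp => by
        rw [map_add]; exact Q.add_mem (hu p hp) (hv p hp)
      zero_mem' := fun p _ => by rw [map_zero]; exact Q.zero_mem
      smul_mem' := fun c u hu p hp => by rw [map_smul]; exact Q.smul_mem c (hu p hp) }
  obtain ⟨s, hs0⟩ : ∃ s : FreeLieAlgebra ℝ (Fin n) →ₗ⁅ℝ⁆ FreeAlgebra ℝ (Fin n),
      ∀ i, s (FreeLieAlgebra.of ℝ i) = FreeAlgebra.ι ℝ i :=
    ⟨FreeLieAlgebra.lift ℝ (FreeAlgebra.ι ℝ), fun i => FreeLieAlgebra.lift_of_apply _ _⟩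
  have hs : toSerreAlg A (s w) = 0 := by
    rw [← h]
    have : (toSerreAlg A).toLieHom.comp s = toSerre A := by
      refine FreeLieAlgebra.hom_ext fun i => ?_
      rw [LieHom.comp_apply, toSerre, FreeLieAlgebra.lift_of_apply, hs0]
      rfl
    exact LieHom.congr_fun this w
  have hsZ : s w ∈ Z := by
    refine mem_of_toSerreAlg_eq_zero A ?_ ?_ ?_ hs
    · intro b z hz p hp
      rw [map_mul]; exact (ha b).2 _ (hz p hp)
    · intro b z hz p hp
      rw [map_mul]; exact hz _ ((ha b).1 p hp)
    · intro i j hij p hp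
      have h1 : a (serre A (FreeAlgebra.ι ℝ) i j) =
          shiftAd ((-A i j).toNat + 2) (serre A y i j) := by
        refine (map_serre A a.toLieHom (FreeAlgebra.ι ℝ) i j).trans ?_
        have h2 : (fun k => a.toLieHom (FreeAlgebra.ι ℝ k)) = fun k => shiftAd 1 (y k) :=
          funext hai
        rw [h2]
        exact shiftAd_ad_pow _ _ _
      have h3 := serre_mem_brFil A hA hy hij
      rw [h1]
      generalize (-A i j).toNat = m at h3 ⊢
      exact hPQ (m + 2) (by omega) _ h3 p hp
  have has : ∀ w ∈ homPart n r, a (s w) = shiftAd (r + 1) (FreeLieAlgebra.lift ℝ y w) := by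
    intro w hw
    induction hw using Submodule.span_induction with
    | mem w hw =>
      obtain ⟨j, l, rfl, rfl⟩ := hw
      refine (map_br (a.toLieHom.comp s) _ j l).trans ?_
      have h1 : (fun i => (a.toLieHom.comp s) (FreeLieAlgebra.of ℝ i)) =
          fun i => shiftAd 1 (y i) := by
        funext i
        rw [LieHom.comp_apply, hs0]
        exact hai i
      rw [h1, shiftAd_br, map_br]
      simp only [FreeLieAlgebra.lift_of_apply]
    | zero => simp only [map_zero]
    | add u v _ _ hu hv => simp only [map_add, hu, hv]
    | smul c u _ hu => simp only [map_smul, hu]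
  -- Evaluation at the derivation recovers (r + 1) times the value of w, in degree r + 1; membership
  -- in Q puts it in `brFil y r`, and r + 1 is invertible in ℝ.
  have hp : ((0, 1) : (ℕ → L) × ℝ) ∈ P := fun k => Submodule.zero_mem _
  have hfin := (hsZ _ hp).1 (r + 1)
  rw [has w hw, shiftAd_apply] at hfin
  simp only [le_refl, if_true, Pi.zero_apply, lie_zero, zero_add, one_mul,
    Nat.add_sub_cancel] at hfin
  have hr : ((r + 1 : ℕ) : ℝ) ≠ 0 := by positivity
  have := Submodule.smul_mem _ (((r + 1 : ℕ) : ℝ)⁻¹) hfin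
  rwa [smul_smul, inv_mul_cancel₀ hr, one_smul] at this

/-- The ideal of the free Lie algebra generated by the Berman relations. -/
def bermanIdeal : LieIdeal ℝ (FreeLieAlgebra ℝ (Fin n)) :=
  LieSubmodule.lieSpan ℝ (FreeLieAlgebra ℝ (Fin n)) {z | ∃ i j, i ≠ j ∧
    z = Polynomial.aeval (LieAlgebra.ad ℝ _ (FreeLieAlgebra.of ℝ i)) (bermanPoly (-A i j).toNat)
      (FreeLieAlgebra.of ℝ j)}

theorem lift_eq_zero_of_mem_bermanIdeal {y : Fin n → L} (hy : BermanRelations A y)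
    {z : FreeLieAlgebra ℝ (Fin n)} (hz : z ∈ bermanIdeal A) : FreeLieAlgebra.lift ℝ y z = 0 := by
  have : bermanIdeal A ≤ (FreeLieAlgebra.lift ℝ y).ker := by
    refine LieSubmodule.lieSpan_le.2 ?_
    rintro _ ⟨i, j, hij, rfl⟩
    rw [SetLike.mem_coe, LieHom.mem_ker, map_aeval_ad, FreeLieAlgebra.lift_of_apply,
      FreeLieAlgebra.lift_of_apply]
    exact hy i j hij
  exact this hz

/-- Every relation between the `x i` in `K(𝔤)` follows from the Berman relations. -/
theorem lift_eq_zero_of_toK_eq_zero (hA : IsSmallCartan A) {y : Fin n → L}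
    (hy : BermanRelations A y) {w : FreeLieAlgebra ℝ (Fin n)} (hw : toK A w = 0) :
    FreeLieAlgebra.lift ℝ y w = 0 := by
  let F := FreeLieAlgebra ℝ (Fin n)
  let I : LieIdeal ℝ F := bermanIdeal A
  let q : F →ₗ⁅ℝ⁆ F ⧸ I := { Submodule.mkQ I.toSubmodule with map_lie' := fun {_ _} => rfl }
  have hq0 : ∀ z, q z = 0 ↔ z ∈ I := fun z => Submodule.Quotient.mk_eq_zero _
  -- The universal Lie algebra with the Berman relations is where the leading part is rewritten by
  -- shorter brackets.
  have hqB : BermanRelations A fun i => q (FreeLieAlgebra.of ℝ i) := by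
    intro i j hij
    rw [← map_aeval_ad, hq0]
    exact LieSubmodule.subset_lieSpan ⟨i, j, hij, rfl⟩
  have hqlift : FreeLieAlgebra.lift ℝ (fun i => q (FreeLieAlgebra.of ℝ i)) = q :=
    FreeLieAlgebra.lift_comp_of q
  have main : ∀ k : ℕ, ∀ w ∈ brFil (FreeLieAlgebra.of (X := Fin n) ℝ) k, toK A w = 0 → w ∈ I := by
    intro k
    induction k with
    | zero =>
      intro w hw _
      have : brFil (FreeLieAlgebra.of (X := Fin n) ℝ) 0 ≤ I.toSubmodule := by
        refine Submodule.span_le.2 ?_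
        rintro _ ⟨j, l, hl, -⟩
        simp at hl
      exact this hw
    | succ k ih =>
      intro w hw hKw
      have hsup : brFil (FreeLieAlgebra.of (X := Fin n) ℝ) (k + 1) ≤
          homPart n k ⊔ brFil (FreeLieAlgebra.of ℝ) k := by
        refine Submodule.span_le.2 ?_
        rintro _ ⟨j, l, hl, rfl⟩
        rcases Nat.lt_succ_iff_lt_or_eq.1 hl with h | h
        · exact Submodule.mem_sup_right (Submodule.subset_span ⟨j, l, h, rfl⟩)
        · exact Submodule.mem_sup_left (Submodule.subset_span ⟨j, l, h, rfl⟩)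
      obtain ⟨u, hu, v, hv, rfl⟩ := Submodule.mem_sup.1 (hsup hw)
      have h1 := mem_brFil_of_toSerre_eq_zero A hA hqB hu (toSerre_leading A hA hu hv hKw)
      rw [hqlift] at h1
      have h2 : ∃ u' ∈ brFil (FreeLieAlgebra.of (X := Fin n) ℝ) k, q u' = q u := by
        have : brFil (fun i => q (FreeLieAlgebra.of ℝ i)) k ≤
            (brFil (FreeLieAlgebra.of ℝ) k).map (q : F →ₗ[ℝ] F ⧸ I) := by
          refine Submodule.span_le.2 ?_
          rintro _ ⟨j, l, hl, rfl⟩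
          exact ⟨br (FreeLieAlgebra.of ℝ) j l, br_mem_brFil _ j l hl, map_br q _ j l⟩
        exact this h1
      obtain ⟨u', hu', huu'⟩ := h2
      have h3 : u - u' ∈ I := by rw [← hq0, map_sub, huu', sub_self]
      -- Replacing u by the shorter u' changes the relation only by an element of the Berman ideal,
      -- which vanishes at the x i; so u' + v is again a relation and the induction applies.
      have hKI : ∀ z ∈ I, toK A z = 0 :=
        fun z hz => lift_eq_zero_of_mem_bermanIdeal A ((bermanRelations_x A hA).map (K A).incl) hz
      have h4 := ih (u' + v) (Submodule.add_mem _ hu' hv) (by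
        have := hKI _ h3
        rw [map_sub, sub_eq_zero] at this
        rw [map_add, ← this, ← map_add, hKw])
      have : u + v = (u - u') + (u' + v) := by abel
      rw [this]
      exact I.add_mem h3 h4
  have hex : ∃ k, w ∈ brFil (FreeLieAlgebra.of (X := Fin n) ℝ) k := by
    have hw := lieSpan_le_span_br (FreeLieAlgebra.of ℝ) (z := w) (by
      rw [freeLie_lieSpan]; exact Set.mem_univ w)
    clear * - hw
    induction hw using Submodule.span_induction with
    | mem w hw => obtain ⟨j, l, rfl⟩ := hw; exact ⟨_, br_mem_brFil _ j l (Nat.lt_succ_self _)⟩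
    | zero => exact ⟨0, Submodule.zero_mem _⟩
    | add a b _ _ ha hb =>
      obtain ⟨k, ha⟩ := ha
      obtain ⟨k', hb⟩ := hb
      exact ⟨max k k', Submodule.add_mem _ (brFil_mono _ (le_max_left _ _) ha)
        (brFil_mono _ (le_max_right _ _) hb)⟩
    | smul c a _ ha => obtain ⟨k, ha⟩ := ha; exact ⟨k, Submodule.smul_mem _ c ha⟩
  obtain ⟨k, hk⟩ := hex
  exact lift_eq_zero_of_mem_bermanIdeal A hy (main k w hk hw)

/-- Homomorphisms on `K(𝔤)` are determined by their values on the generators. -/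
theorem K_hom_ext {φ ψ : K A →ₗ⁅ℝ⁆ L} (h : ∀ i, φ (x A i) = ψ (x A i)) : φ = ψ := by
  refine LieHom.ext fun z => ?_
  have hz : z ∈ LieSubalgebra.lieSpan ℝ (K A) (Set.range (x A)) := by
    rw [K_lieSpan]; exact Set.mem_univ z
  induction hz using LieSubalgebra.lieSpan_induction with
  | mem w hw => obtain ⟨i, rfl⟩ := hw; exact h i
  | zero => rw [map_zero, map_zero]
  | add a b _ _ ha hb => rw [map_add, map_add, ha, hb]
  | smul c a _ ha => rw [map_smul, map_smul, ha]
  | lie a b _ _ ha hb => rw [LieHom.map_lie, LieHom.map_lie, ha, hb]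

/-- Berman's theorem: elements satisfying the Berman relations define a representation. -/
theorem BermanRelations.definesRep {A : Matrix (Fin n) (Fin n) ℤ} (hA : IsSmallCartan A)
    {y : Fin n → L} (hy : BermanRelations A y) : DefinesRep A y := by
  refine ⟨hy, ?_⟩
  let F := FreeLieAlgebra ℝ (Fin n)
  let π : F →ₗ⁅ℝ⁆ K A := FreeLieAlgebra.lift ℝ (x A)
  have hπx : ∀ i, π (FreeLieAlgebra.of ℝ i) = x A i := fun i => FreeLieAlgebra.lift_of_apply _ _
  have hπ : Function.Surjective π := by
    intro z
    have hz : (⊤ : LieSubalgebra ℝ (K A)) ≤ π.range := by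
      rw [← K_lieSpan, LieSubalgebra.lieSpan_le]
      rintro _ ⟨i, rfl⟩
      exact ⟨_, hπx i⟩
    exact hz (Set.mem_univ z)
  have hker : ∀ w, π w = 0 → FreeLieAlgebra.lift ℝ y w = 0 := by
    intro w hw
    refine lift_eq_zero_of_toK_eq_zero A hA hy ?_
    have : (K A).incl.comp π = toK A := by
      refine FreeLieAlgebra.hom_ext fun i => ?_
      rw [LieHom.comp_apply, hπx, toK, FreeLieAlgebra.lift_of_apply]
      rfl
    rw [← this, LieHom.comp_apply, hw, map_zero]
  have hker' : ∀ w w', π w = π w' → FreeLieAlgebra.lift ℝ y w = FreeLieAlgebra.lift ℝ y w' := by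
    intro w w' h
    rw [← sub_eq_zero, ← map_sub]
    exact hker _ (by rw [map_sub, h, sub_self])
  choose σ hσ using hπ
  let ρ : K A →ₗ⁅ℝ⁆ L :=
    { toFun := fun z => FreeLieAlgebra.lift ℝ y (σ z)
      map_add' := fun a b => by
        rw [← map_add]; exact hker' _ _ (by rw [map_add, hσ, hσ, hσ])
      map_smul' := fun c a => by
        rw [RingHom.id_apply, ← map_smul]; exact hker' _ _ (by rw [map_smul, hσ, hσ])
      map_lie' := fun {a b} => by
        rw [← LieHom.map_lie]; exact hker' _ _ (by rw [LieHom.map_lie, hσ, hσ, hσ]) }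
  have hρ : ∀ i, ρ (x A i) = y i := by
    intro i
    have := hker' (σ (x A i)) (FreeLieAlgebra.of ℝ i) (by rw [hσ, hπx])
    rw [FreeLieAlgebra.lift_of_apply] at this
    exact this
  exact ⟨ρ, hρ, fun ψ hψ => K_hom_ext A fun i => by rw [hψ, hρ]⟩

end berman


/-! ### Polarisation tensors and gamma matrices solving the Berman relations -/

section solutions

variable {n : ℕ}

/-- Elements with the (anti)commutation relations of the gamma matrices of simple real roots. -/
structure IsGammaSol (A : Matrix (Fin n) (Fin n) ℤ) {S : Type*} [Ring S] (g : Fin n → S) :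
    Prop where
  sq : ∀ i, g i * g i = -1
  comm : ∀ i j, i ≠ j → A i j = 0 ∨ A i j = -2 → g i * g j = g j * g i
  anti : ∀ i j, i ≠ j → A i j = -1 ∨ A i j = -3 → g i * g j = -(g j * g i)

/-- The equations for polarisation tensors corresponding to the Berman relations; `M` is a common
denominator. -/
structure IsPolSol (A : Matrix (Fin n) (Fin n) ℤ) {S : Type*} [Ring S] (M : S) (X : Fin n → S) :
    Prop where
  rel_zero : ∀ i j, i ≠ j → A i j = 0 → ⁅X i, X j⁆ = 0
  rel_one : ∀ i j, i ≠ j → A i j = -1 →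
    4 * (X i * (X i * X j + X j * X i) + (X i * X j + X j * X i) * X i) = M * (M * X j)
  rel_two : ∀ i j, i ≠ j → A i j = -2 →
    ⁅X i, ⁅X i, ⁅X i, X j⁆⁆⁆ = M * (M * ⁅X i, X j⁆)
  rel_three : ∀ i j, i ≠ j → A i j = -3 → ∀ D : S → S, (∀ Z, D Z = X i * Z + Z * X i) →
    16 * D (D (D (D (X j)))) - 40 * (M * (M * D (D (X j)))) + 9 * (M * (M * (M * (M * X j)))) = 0

variable {A : Matrix (Fin n) (Fin n) ℤ} {𝒳 𝒢 ℬ : Type*} [Ring 𝒳] [Algebra ℝ 𝒳] [Ring 𝒢] [Algebra ℝ 𝒢]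
  [Ring ℬ] [Algebra ℝ ℬ]

/-- Each relation is homogeneous in X and M together, so dividing by the denominator normalises it
to M = 1. This passes from exact integral matrices to real ones. -/
theorem IsPolSol.map_inv {S : Type*} [Ring S] {M : S} {X : Fin n → S} (h : IsPolSol A M X)
    (φ : S →+* 𝒳) (m : ℝ) (hm : m ≠ 0) (hM : φ M = algebraMap ℝ 𝒳 m) :
    IsPolSol A 1 fun i => m⁻¹ • φ (X i) := by
  have hMr : ∀ Z : 𝒳, φ M * Z = m • Z := fun Z => by rw [hM, ← Algebra.smul_def]
  constructor
  · intro i j hij hA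
    have := congrArg φ (h.rel_zero i j hij hA)
    simp only [Ring.lie_def, map_sub, map_mul, map_zero] at this ⊢
    simp only [smul_mul_assoc, mul_smul_comm, ← smul_sub, this, smul_zero]
  · intro i j hij hA
    have := congrArg φ (h.rel_one i j hij hA)
    simp only [map_add, map_mul, hMr, map_ofNat] at this
    simp only [smul_mul_assoc, mul_smul_comm, ← smul_add, this, one_mul]
    match_scalars
    field_simp
  · intro i j hij hA
    have hφ : ∀ u v, φ ⁅u, v⁆ = ⁅φ u, φ v⁆ := fun u v => by
      rw [Ring.lie_def, Ring.lie_def, map_sub, map_mul, map_mul]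
    have := congrArg φ (h.rel_two i j hij hA)
    simp only [hφ, map_mul, hMr] at this
    simp only [smul_lie, lie_smul, this, one_mul, smul_smul]
    congr 1
    field_simp
  · intro i j hij hA D hD
    let D₀ : S → S := fun Z => X i * Z + Z * X i
    have := congrArg φ (h.rel_three i j hij hA D₀ fun _ => rfl)
    have hDφ : ∀ (c : ℝ) Z, D (c • φ Z) = (c * m⁻¹) • φ (D₀ Z) := by
      intro c Z
      simp only [hD, D₀, map_add, map_mul, smul_mul_assoc, mul_smul_comm, smul_add, smul_smul,
        mul_comm]
    simp only [map_add, map_sub, map_mul, hMr, map_ofNat, map_zero] at this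
    simp only [hDφ, one_mul]
    have h2 := congrArg (fun Z => (m⁻¹ ^ 5) • Z) this
    simp only [smul_zero] at h2
    rw [← h2]
    simp only [smul_add, smul_sub, mul_smul_comm, smul_smul]
    congr 3 <;> field_simp

/-- The operators `c X ⊗ Γ` (`c = ±2`) satisfy the Berman relations. -/
theorem bermanRelations_of_sol (hA : IsSmallCartan A) {X : Fin n → 𝒳} {g : Fin n → 𝒢}
    (hX : IsPolSol A 1 X) (hg : IsGammaSol A g) (a : 𝒳 →ₐ[ℝ] ℬ) (b : 𝒢 →ₐ[ℝ] ℬ)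
    (hab : ∀ u v, a u * b v = b v * a u) (c : ℝ) (hc : c * c = 4) :
    BermanRelations A fun i => c • (a (X i) * b (g i)) := by
  rw [bermanRelations_iff hA]
  have hlie : ∀ (u u' : 𝒳) (v v' : 𝒢), ⁅a u * b v, a u' * b v'⁆ =
      a (u * u') * b (v * v') - a (u' * u) * b (v' * v) := by
    intro u u' v v'
    rw [Ring.lie_def, map_mul, map_mul, map_mul, map_mul]
    congr 1
    · rw [mul_assoc, mul_assoc, ← mul_assoc (b v), ← hab u' v, mul_assoc]
    · rw [mul_assoc, mul_assoc, ← mul_assoc (b v'), ← hab u v', mul_assoc]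
  intro i j hij
  have hsq := hg.sq i
  have hsq' : ∀ v, g i * (g i * v) = -v := fun v => by rw [← mul_assoc, hsq, neg_one_mul]
  refine ⟨fun h => ?_, fun h => ?_, fun h => ?_, fun h => ?_⟩
  · have h0 := hX.rel_zero i j hij h
    rw [Ring.lie_def] at h0
    rw [lie_smul, smul_lie, hlie, hg.comm i j hij (Or.inl h), ← sub_mul, ← map_sub, h0, map_zero,
      zero_mul, smul_zero, smul_zero]
  · have hcomm := hg.anti i j hij (Or.inl h)
    -- Anticommuting g's turn the commutator into the anticommutator D with X i, and g i² = −1 gives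
    -- −D² after two steps. With c² = 4 the relation t² + 1 becomes 4D² = 1 on X j.
    have h1 : ∀ Z, ⁅a (X i) * b (g i), a Z * b (g j)⁆ = a (X i * Z + Z * X i) * b (g i * g j) := by
      intro Z
      rw [hlie, eq_neg_iff_add_eq_zero.2 (by rw [hcomm]; abel : g j * g i + g i * g j = 0), map_neg,
        mul_neg, sub_neg_eq_add, ← add_mul, ← map_add]
    have h2 : ∀ Z, ⁅a (X i) * b (g i), a Z * b (g i * g j)⁆ =
        -(a (X i * Z + Z * X i) * b (g j)) := by
      intro Z
      rw [hlie, hsq', hcomm, neg_mul, mul_assoc, hsq]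
      simp only [mul_neg, mul_one, neg_neg, map_neg, map_add, add_mul]
      abel
    have h4 := hX.rel_one i j hij h
    simp only [one_mul] at h4
    have h5 : a (X j) = (4 : ℝ) •
        a (X i * (X i * X j + X j * X i) + (X i * X j + X j * X i) * X i) := by
      rw [← map_smul, Algebra.smul_def, map_ofNat, h4]
    simp only [lie_smul, smul_lie, h1, h2, smul_neg]
    rw [h5, smul_mul_assoc, smul_smul, smul_smul, smul_smul, ← neg_smul, ← add_smul,
      show -(c * c * c) + c * 4 = 0 by rw [hc]; ring, zero_smul]
  · have hcomm := hg.comm i j hij (Or.inr h)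
    -- Commuting g's leave a commutator on the X side; t³ + 4t becomes (ad X i)³ = ad X i on X j,
    -- again because g i² = −1 and c² = 4.
    have h1 : ∀ Z, ⁅a (X i) * b (g i), a Z * b (g j)⁆ = a ⁅X i, Z⁆ * b (g i * g j) := by
      intro Z
      rw [hlie, ← hcomm, ← sub_mul, ← map_sub, Ring.lie_def]
    have h2 : ∀ Z, ⁅a (X i) * b (g i), a Z * b (g i * g j)⁆ = -(a ⁅X i, Z⁆ * b (g j)) := by
      intro Z
      rw [hlie, hsq', hcomm, mul_assoc, hsq, Ring.lie_def]
      simp only [mul_neg, mul_one, map_neg, map_sub, sub_mul]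
      abel
    have h4 := hX.rel_two i j hij h
    simp only [one_mul] at h4
    simp only [lie_smul, smul_lie, h1, h2, lie_neg, h4, smul_neg, smul_smul]
    rw [← neg_smul, ← add_smul]
    convert zero_smul ℝ _
    linear_combination (-(c * c)) * hc
  · have hcomm := hg.anti i j hij (Or.inr h)
    let D : 𝒳 → 𝒳 := fun Z => X i * Z + Z * X i
    -- As in the anticommuting case above, t² acts as −4D², so t⁴ + 10t² + 9 becomes 16D⁴ − 40D² +
    -- 9.
    have h1 : ∀ Z, ⁅a (X i) * b (g i), a Z * b (g j)⁆ = a (D Z) * b (g i * g j) := by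
      intro Z
      rw [hlie, eq_neg_iff_add_eq_zero.2 (by rw [hcomm]; abel : g j * g i + g i * g j = 0), map_neg,
        mul_neg, sub_neg_eq_add, ← add_mul, ← map_add]
    have h2 : ∀ Z, ⁅a (X i) * b (g i), a Z * b (g i * g j)⁆ = -(a (D Z) * b (g j)) := by
      intro Z
      rw [hlie, hsq', hcomm, neg_mul, mul_assoc, hsq]
      simp only [D, mul_neg, mul_one, neg_neg, map_neg, map_add, add_mul]
      abel
    have h4 := hX.rel_three i j hij h D fun _ => rfl
    simp only [one_mul] at h4
    have h5 : (16 : ℝ) • a (D (D (D (D (X j))))) - (40 : ℝ) • a (D (D (X j))) +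
        (9 : ℝ) • a (X j) = 0 := by
      rw [← map_smul, ← map_smul, ← map_smul, ← map_sub, ← map_add, ← map_zero a, ← h4]
      simp only [Algebra.smul_def, map_ofNat]
    have h6 : (16 : ℝ) • (a (D (D (D (D (X j))))) * b (g j)) -
        (40 : ℝ) • (a (D (D (X j))) * b (g j)) + (9 : ℝ) • (a (X j) * b (g j)) = 0 := by
      rw [← smul_mul_assoc, ← smul_mul_assoc, ← smul_mul_assoc, ← sub_mul, ← add_mul, h5, zero_mul]
    simp only [lie_smul, smul_lie, h1, h2, lie_neg, smul_neg, neg_neg]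
    have h7 := congrArg (fun z => c • z) h6
    simp only [smul_zero] at h7
    rw [← h7]
    simp only [smul_smul, smul_add, smul_sub]
    match_scalars
    · linear_combination (c ^ 3 + 4 * c) * hc
    · linear_combination (-10 * c) * hc
    · ring

end solutions


/-! ### Operators on tensor-spinors through independent components -/

/-- An enumeration of the `r` independent components of a symmetric tensor with `s` indices. -/
structure SymIndex (n s r : ℕ) where
  rep : Fin r → Fin s → Fin n
  cls : (Fin s → Fin n) → Fin r
  cls_comp : ∀ (B : Fin s → Fin n) (σ : Equiv.Perm (Fin s)), cls (B ∘ σ) = cls B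
  cls_rep : ∀ c, cls (rep c) = c
  orbit : ∀ B : Fin s → Fin n, ∃ σ : Equiv.Perm (Fin s), rep (cls B) ∘ σ = B

namespace SymIndex

variable {n s r N : ℕ} (I : SymIndex n s r)

theorem apply_rep (φ : Spinor n s N) (B : Fin s → Fin n) : φ.1 (I.rep (I.cls B)) = φ.1 B := by
  obtain ⟨σ, hσ⟩ := I.orbit B
  have := φ.2 σ (I.rep (I.cls B))
  rw [hσ] at this
  exact this.symm

/-- Matrices in the independent components act on tensor-spinors. -/
def tensorAct : Matrix (Fin r) (Fin r) ℝ →ₐ[ℝ] Module.End ℝ (Spinor n s N) :=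
  AlgHom.ofLinearMap
    { toFun := fun m =>
        { toFun := fun φ => ⟨fun B α => ∑ d, m (I.cls B) d * φ.1 (I.rep d) α, fun σ B => by
            simp only [I.cls_comp]⟩
          map_add' := fun φ ψ => by
            ext B α; simp [mul_add, Finset.sum_add_distrib]
          map_smul' := fun c φ => by
            ext B α; simp [Finset.mul_sum, mul_left_comm] }
      map_add' := fun m m' => by
        ext φ B α; simp [add_mul, Finset.sum_add_distrib]
      map_smul' := fun c m => by
        ext φ B α; simp [Finset.mul_sum, mul_assoc] }
    (by
      ext φ B α
      simp [Matrix.one_apply, I.apply_rep])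
    (fun m m' => by
      ext φ B α
      simp only [LinearMap.coe_mk, AddHom.coe_mk, Module.End.mul_apply, I.cls_rep,
        Matrix.mul_apply, Finset.sum_mul, Finset.mul_sum]
      rw [Finset.sum_comm]
      simp only [mul_assoc])

theorem tensorAct_apply (m : Matrix (Fin r) (Fin r) ℝ) (φ : Spinor n s N) (B : Fin s → Fin n)
    (α : Fin N) : (I.tensorAct m φ).1 B α = ∑ d, m (I.cls B) d * φ.1 (I.rep d) α := rfl

end SymIndex

/-- Matrices act on the spinor index. -/
def spinAct (n s N : ℕ) : Matrix (Fin N) (Fin N) ℝ →ₐ[ℝ] Module.End ℝ (Spinor n s N) :=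
  AlgHom.ofLinearMap
    { toFun := fun g =>
        { toFun := fun φ => ⟨fun B α => ∑ β, g α β * φ.1 B β, fun σ B => by
            simp only [φ.2 σ B]⟩
          map_add' := fun φ ψ => by
            ext B α; simp [mul_add, Finset.sum_add_distrib]
          map_smul' := fun c φ => by
            ext B α; simp [Finset.mul_sum, mul_left_comm] }
      map_add' := fun m m' => by
        ext φ B α; simp [add_mul, Finset.sum_add_distrib]
      map_smul' := fun c m => by
        ext φ B α; simp [Finset.mul_sum, mul_assoc] }
    (by
      ext φ B α
      simp [Matrix.one_apply])
    (fun m m' => by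
      ext φ B α
      simp only [LinearMap.coe_mk, AddHom.coe_mk, Module.End.mul_apply,
        Matrix.mul_apply, Finset.sum_mul, Finset.mul_sum]
      rw [Finset.sum_comm]
      simp only [mul_assoc])

theorem spinAct_apply {n s N : ℕ} (g : Matrix (Fin N) (Fin N) ℝ) (φ : Spinor n s N)
    (B : Fin s → Fin n) (α : Fin N) : (spinAct n s N g φ).1 B α = ∑ β, g α β * φ.1 B β := rfl

namespace SymIndex

variable {n s r N : ℕ} (I : SymIndex n s r)

theorem tensorAct_spinAct (m : Matrix (Fin r) (Fin r) ℝ) (g : Matrix (Fin N) (Fin N) ℝ) :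
    I.tensorAct m * spinAct n s N g = spinAct n s N g * I.tensorAct m := by
  ext φ B α
  simp only [Module.End.mul_apply, tensorAct_apply, spinAct_apply, Finset.mul_sum]
  rw [Finset.sum_comm]
  simp only [mul_left_comm]

/-- The indicator of the orbit of index d is a symmetric spinor that reads off column d. Needed to
reflect an operator identity back to matrices. -/
theorem tensorAct_injective (hN : 0 < N) :
    Function.Injective (I.tensorAct : Matrix (Fin r) (Fin r) ℝ →ₐ[ℝ] Module.End ℝ (Spinor n s N)) := by
  intro m m' h
  ext c d
  let φ : Spinor n s N := ⟨fun B _ => if I.cls B = d then 1 else 0, fun σ B => by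
    simp only [I.cls_comp]⟩
  have h1 := congrFun (congrFun (congrArg Subtype.val (LinearMap.congr_fun h φ)) (I.rep c)) ⟨0, hN⟩
  simpa [tensorAct_apply, φ, I.cls_rep] using h1

/-- The matrix, up to a factor `s!`, by which a tensor `k` acts on the independent components. -/
def reduced {S : Type*} [CommRing S] (k : (Fin s → Fin n) → (Fin s → Fin n) → S) :
    Matrix (Fin r) (Fin r) S :=
  Matrix.of fun c d => ∑ σ : Equiv.Perm (Fin s), ∑ B : Fin s → Fin n,
    if I.cls B = d then k (I.rep c ∘ σ) B else 0

/-- Contraction with a symmetric spinor sums over orbits of upper indices, which absorbs the upper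
symmetrisation; only 1 / s! and the sum over lower permutations survive. Leaving out 1 / s! keeps
`reduced` integral. -/
theorem higherSpinJ_eq (k : Tensor n s) (g : Matrix (Fin N) (Fin N) ℝ) :
    higherSpinJ k g =
      (-2 : ℝ) • (I.tensorAct ((Nat.factorial s : ℝ)⁻¹ • I.reduced k) * spinAct n s N g) := by
  have key : ∀ (c d : Fin r), (∑ B : Fin s → Fin n, if I.cls B = d then
      symmetrise k (I.rep c) B else 0) = ((Nat.factorial s : ℝ)⁻¹ • I.reduced k) c d := by
    intro c d
    have hf : (Nat.factorial s : ℝ) ≠ 0 := by positivity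
    have h1 : ∀ σ τ : Equiv.Perm (Fin s),
        (∑ B : Fin s → Fin n, if I.cls B = d then k (I.rep c ∘ σ) (B ∘ τ) else 0) =
          ∑ B : Fin s → Fin n, if I.cls B = d then k (I.rep c ∘ σ) B else 0 := by
      intro σ τ
      refine Fintype.sum_equiv (Equiv.arrowCongr τ.symm (Equiv.refl (Fin n))) _ _ fun B => ?_
      have : (Equiv.arrowCongr τ.symm (Equiv.refl (Fin n))) B = B ∘ τ := by
        ext i; simp [Equiv.arrowCongr]
      rw [this, I.cls_comp]
    have h2 : (∑ B : Fin s → Fin n, if I.cls B = d then symmetrise k (I.rep c) B else 0) =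
        (1 / (Nat.factorial s : ℝ) ^ 2) * ∑ σ : Equiv.Perm (Fin s), ∑ τ : Equiv.Perm (Fin s),
          ∑ B : Fin s → Fin n, if I.cls B = d then k (I.rep c ∘ σ) (B ∘ τ) else 0 := by
      have h3 : ∀ B : Fin s → Fin n, (if I.cls B = d then symmetrise k (I.rep c) B else 0) =
          ∑ σ : Equiv.Perm (Fin s), ∑ τ : Equiv.Perm (Fin s), (1 / (Nat.factorial s : ℝ) ^ 2) *
            if I.cls B = d then k (I.rep c ∘ σ) (B ∘ τ) else 0 := by
        intro B
        split_ifs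
        · simp only [symmetrise, Finset.mul_sum]
        · simp
      rw [Finset.sum_congr rfl fun B _ => h3 B, Finset.sum_comm]
      simp only [Finset.mul_sum]
      exact Finset.sum_congr rfl fun σ _ => Finset.sum_comm
    rw [h2]
    simp only [h1, Finset.sum_const, Finset.card_univ, Fintype.card_perm, Fintype.card_fin,
      nsmul_eq_mul]
    rw [← Finset.mul_sum, Matrix.smul_apply, reduced, Matrix.of_apply, smul_eq_mul]
    field_simp
  refine LinearMap.ext fun φ => Subtype.ext (funext fun B => funext fun α => ?_)
  change -2 * ∑ C, ∑ β, symmetrise k B C * g α β * φ.1 C β =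
    -2 * (I.tensorAct _ (spinAct n s N g φ)).1 B α
  rw [I.tensorAct_apply]
  congr 1
  simp only [← key, Finset.sum_mul]
  conv_rhs => rw [Finset.sum_comm]
  refine Finset.sum_congr rfl fun C _ => ?_
  rw [Finset.sum_eq_single (I.cls C) (fun d _ hd => by rw [if_neg (Ne.symm hd), zero_mul])
    (fun h => absurd (Finset.mem_univ _) h), if_pos rfl, spinAct_apply, Finset.mul_sum]
  refine Finset.sum_congr rfl fun β _ => ?_
  rw [I.apply_rep]
  obtain ⟨σ, hσ⟩ := I.orbit B
  have : symmetrise k (I.rep (I.cls B)) C = symmetrise k B C := by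
    conv_rhs => rw [← hσ]
    rw [symmetrise_comp]
  rw [this, mul_assoc]

theorem reduced_map {S S' : Type*} [CommRing S] [CommRing S'] (φ : S →+* S')
    (k : (Fin s → Fin n) → (Fin s → Fin n) → S) :
    I.reduced (fun B C => φ (k B C)) = φ.mapMatrix (I.reduced k) := by
  ext c d
  simp only [reduced, Matrix.of_apply, RingHom.mapMatrix_apply, Matrix.map_apply, map_sum]
  refine Finset.sum_congr rfl fun σ _ => Finset.sum_congr rfl fun B _ => ?_
  split_ifs <;> simp

theorem reduced_smul (c : ℝ) (k : Tensor n s) :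
    I.reduced (fun B C => c * k B C) = c • I.reduced k := by
  ext i j
  simp only [reduced, Matrix.of_apply, Matrix.smul_apply, smul_eq_mul, Finset.mul_sum]
  refine Finset.sum_congr rfl fun σ _ => Finset.sum_congr rfl fun B _ => ?_
  split_ifs <;> simp

/-- Tensors whose matrices in independent components solve the polynomial equations define
representations. -/
theorem definesRep {A : Matrix (Fin n) (Fin n) ℤ} (hA : IsSmallCartan A)
    (k : Fin n → Tensor n s) {g : Fin n → Matrix (Fin N) (Fin N) ℝ} (hg : IsGammaSol A g)
    {S : Type*} [CommRing S] (M : S) (X : Fin n → Matrix (Fin r) (Fin r) S)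
    (hX : IsPolSol A (Matrix.scalar (Fin r) M) X) (φ : S →+* ℝ) (hM : φ M ≠ 0)
    (hk : ∀ i, (Nat.factorial s : ℝ)⁻¹ • I.reduced (k i) = (φ M)⁻¹ • φ.mapMatrix (X i)) :
    DefinesRep A fun i => higherSpinJ (k i) (g i) := by
  refine BermanRelations.definesRep hA ?_
  simp only [I.higherSpinJ_eq, hk]
  have hsol : IsPolSol A 1 fun i => (φ M)⁻¹ • φ.mapMatrix (X i) := by
    refine hX.map_inv φ.mapMatrix (φ M) hM ?_
    rw [RingHom.mapMatrix_apply, Matrix.scalar_apply, Matrix.algebraMap_eq_diagonal,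
      Matrix.diagonal_map (map_zero φ)]
    rfl
  have hb := bermanRelations_of_sol (ℬ := Module.End ℝ (Spinor n s N)) hA hsol hg I.tensorAct
    (spinAct n s N) I.tensorAct_spinAct (-2) (by norm_num)
  exact hb

end SymIndex

/-- Components of vectors. -/
def symIndexOne (n : ℕ) : SymIndex n 1 n where
  rep c := fun _ => c
  cls B := B 0
  cls_comp B σ := by rw [Function.comp_apply, Subsingleton.elim (σ 0) 0]
  cls_rep c := rfl
  orbit B := ⟨1, funext fun i => congrArg B (Subsingleton.elim 0 i)⟩

/-- Components of symmetric tensors of rank two in dimension three. -/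
def symIndexTwo : SymIndex 3 2 6 where
  rep := ![![0, 0], ![0, 1], ![0, 2], ![1, 1], ![1, 2], ![2, 2]]
  cls B := (![![0, 1, 2], ![1, 3, 4], ![2, 4, 5]] : Fin 3 → Fin 3 → Fin 6) (B 0) (B 1)
  cls_comp := by decide
  cls_rep := by decide
  orbit := by decide

/-- Components of symmetric tensors of rank three in dimension three. -/
def symIndexThree : SymIndex 3 3 10 where
  rep := ![![0, 0, 0], ![0, 0, 1], ![0, 0, 2], ![0, 1, 1], ![0, 1, 2], ![0, 2, 2], ![1, 1, 1],
    ![1, 1, 2], ![1, 2, 2], ![2, 2, 2]]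
  cls B := (![![0, 1, 2], ![1, 3, 4], ![2, 4, 5], ![3, 6, 7], ![4, 7, 8], ![5, 8, 9]] :
    Fin 6 → Fin 3 → Fin 10)
    ((![![0, 1, 2], ![1, 3, 4], ![2, 4, 5]] : Fin 3 → Fin 3 → Fin 6) (B 0) (B 1)) (B 2)
  cls_comp := by decide +kernel
  cls_rep := by decide
  orbit := by decide +kernel


/-! ### Spin 3/2 and spin 5/2 -/

/-- Products with scalar matrices and numerals become scalar multiplications, which leaves
equalities of explicit matrices suitable for `decide`. -/
theorem isPolSol_of_matrix {n r : ℕ} {A : Matrix (Fin n) (Fin n) ℤ} {S : Type*} [CommRing S] (M : S)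
    (X : Fin n → Matrix (Fin r) (Fin r) S)
    (h0 : ∀ i j, i ≠ j → A i j = 0 → X i * X j - X j * X i = 0)
    (h1 : ∀ i j, i ≠ j → A i j = -1 →
      (4 : S) • (X i * (X i * X j + X j * X i) + (X i * X j + X j * X i) * X i) = (M * M) • X j)
    (h2 : ∀ i j, i ≠ j → A i j = -2 → ∀ C, C = X i * X j - X j * X i →
      X i * (X i * C - C * X i) - (X i * C - C * X i) * X i = (M * M) • C)
    (h3 : ∀ i j, i ≠ j → A i j = -3 → ∀ D : Matrix (Fin r) (Fin r) S → Matrix (Fin r) (Fin r) S,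
      D = (fun Z => X i * Z + Z * X i) →
      (16 : S) • D (D (D (D (X j)))) - (40 * (M * M)) • D (D (X j)) + (9 * (M * M * (M * M))) • X j
        = 0) : IsPolSol A (Matrix.scalar (Fin r) M) X := by
  have hM : ∀ Z : Matrix (Fin r) (Fin r) S, Matrix.scalar (Fin r) M * Z = M • Z := fun Z => by
    rw [Matrix.scalar_apply, Matrix.smul_eq_diagonal_mul]
  have hn : ∀ (k : ℕ) [k.AtLeastTwo] (Z : Matrix (Fin r) (Fin r) S),
      (OfNat.ofNat k : Matrix (Fin r) (Fin r) S) * Z = (OfNat.ofNat k : S) • Z := fun k _ Z => by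
    rw [Algebra.smul_def, map_ofNat]
  constructor
  · intro i j hij h
    rw [Ring.lie_def]
    exact h0 i j hij h
  · intro i j hij h
    rw [hM, hM, hn, smul_smul]
    exact h1 i j hij h
  · intro i j hij h
    rw [hM, hM, smul_smul]
    simpa only [Ring.lie_def] using h2 i j hij h _ rfl
  · intro i j hij h D hD
    simp only [hM, hn, smul_smul]
    convert h3 i j hij h D (funext hD) using 3
    congr 1
    ring

theorem δ_eq_cast {n : ℕ} (a b : Fin n) : δ a b = ((if a = b then 1 else 0 : ℤ) : ℝ) := by
  unfold δ
  split_ifs <;> simp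

/-- Integral version of `X32`. -/
def tensor32 {n : ℕ} (c₁ c₂ : ℤ) (a U : Fin n → ℤ) (B C : Fin 1 → Fin n) : ℤ :=
  c₁ * (a (B 0) * U (C 0)) + c₂ * if B 0 = C 0 then 1 else 0

/-- Integral version of `X52`. -/
def tensor52 {n : ℕ} (a U : Fin n → ℤ) (B C : Fin 2 → Fin n) : ℤ :=
  2 * (a (B 0) * a (B 1) * U (C 0) * U (C 1))
    - 4 * (a (B 0) * (if B 1 = C 0 then 1 else 0) * U (C 1))
    + (if B 0 = C 0 then 1 else 0) * (if B 1 = C 1 then 1 else 0)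

/-- Clears denominators: d is the factor relating the raised components to integers, and M the
common denominator of the two coefficients. -/
theorem reduced_X32 {n : ℕ} (k₁ k₂ : ℝ) (c₁ c₂ M : ℤ) (a U : Fin n → ℤ) (d : ℝ)
    (hU : up (toReal a) = fun b => d * (U b : ℝ)) (h₁ : k₁ * d = c₁ / M) (h₂ : k₂ = c₂ / M) :
    (Nat.factorial 1 : ℝ)⁻¹ • (symIndexOne n).reduced (X32 k₁ k₂ (toReal a)) =
      (Int.castRingHom ℝ M)⁻¹ • (Int.castRingHom ℝ).mapMatrix
        ((symIndexOne n).reduced (tensor32 c₁ c₂ a U)) := by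
  rw [Nat.factorial_one, Nat.cast_one, inv_one, one_smul, ← SymIndex.reduced_map,
    ← SymIndex.reduced_smul]
  congr 1
  funext B C
  simp only [X32, tensor32, hU, toReal, δ_eq_cast, eq_intCast]
  push_cast
  rw [h₂, mul_add]
  congr 1
  · rw [show k₁ * ((a (B 0) : ℝ) * (d * U (C 0))) = (k₁ * d) * ((a (B 0) : ℝ) * U (C 0)) by ring, h₁]
    ring
  · ring

/-- The raised components of the simple roots of `AE₃`. -/
def upAE3 : Fin 3 → Fin 3 → ℤ := ![![1, -1, 0], ![0, 1, -1], ![-1, -1, 1]]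

theorem up_rootAE3 (i : Fin 3) : up (toReal (rootAE3 i)) = fun b => (upAE3 i b : ℝ) := by
  funext b
  have h : ∑ a, (if b = a then 2 * rootAE3 i a else 0) - ∑ a, rootAE3 i a = 2 * upAE3 i b := by
    revert i b
    decide
  have h2 := congrArg (Int.cast : ℤ → ℝ) h
  push_cast at h2
  simp only [Finset.sum_ite_eq, Finset.mem_univ, if_true] at h2
  simp only [up, deWitt, toReal, Matrix.mulVec, dotProduct, sub_mul, Finset.sum_sub_distrib, ite_mul,
    one_mul, zero_mul, Finset.sum_ite_eq, Finset.mem_univ, if_true, ← Finset.mul_sum]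
  norm_num
  linarith

theorem isPolSol_AE3_spin32 : IsPolSol cartanAE3 (Matrix.scalar (Fin 3) 4) fun i =>
    (symIndexOne 3).reduced (tensor32 (-2) 1 (rootAE3 i) (upAE3 i)) := by
  refine isPolSol_of_matrix _ _ ?_ ?_ ?_ ?_
  · intro i j _ h
    fin_cases i <;> fin_cases j <;> first | exact absurd h (by decide) | decide +kernel
  · intro i j _ h
    fin_cases i <;> fin_cases j <;> first | exact absurd h (by decide) | decide +kernel
  · intro i j _ h C hC
    subst hC
    fin_cases i <;> fin_cases j <;> first | exact absurd h (by decide) | decide +kernel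
  · intro i j _ h
    fin_cases i <;> fin_cases j <;> exact absurd h (by decide)

theorem definesRep_AE3_spin32 {N : ℕ} {g : Fin 3 → Matrix (Fin N) (Fin N) ℝ}
    (hg : IsGammaSol cartanAE3 g) : DefinesRep cartanAE3 fun i =>
      higherSpinJ (X32 (-(1 / 2)) (1 / 4) (toReal (rootAE3 i))) (g i) :=
  (symIndexOne 3).definesRep isSmallCartan_AE3 _ hg 4 _ isPolSol_AE3_spin32 (Int.castRingHom ℝ)
    (by simp) fun i => reduced_X32 _ _ (-2) 1 4 _ _ 1 (by simp [up_rootAE3])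
      (by norm_num) (by norm_num)

/-- The denominator 8 combines the factor 4 of `tensor52` with the 2! omitted in `reduced`. -/
theorem isPolSol_AE3_spin52 : IsPolSol cartanAE3 (Matrix.scalar (Fin 6) 8) fun i =>
    symIndexTwo.reduced (tensor52 (rootAE3 i) (upAE3 i)) := by
  refine isPolSol_of_matrix _ _ ?_ ?_ ?_ ?_
  · intro i j _ h
    fin_cases i <;> fin_cases j <;> first | exact absurd h (by decide) | decide +kernel
  · intro i j _ h
    fin_cases i <;> fin_cases j <;> first | exact absurd h (by decide) | decide +kernel
  · intro i j _ h C hC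
    subst hC
    fin_cases i <;> fin_cases j <;> first | exact absurd h (by decide) | decide +kernel
  · intro i j _ h
    fin_cases i <;> fin_cases j <;> exact absurd h (by decide)

theorem definesRep_AE3_spin52 {N : ℕ} {g : Fin 3 → Matrix (Fin N) (Fin N) ℝ}
    (hg : IsGammaSol cartanAE3 g) : DefinesRep cartanAE3 fun i =>
      higherSpinJ (X52 (toReal (rootAE3 i))) (g i) := by
  refine symIndexTwo.definesRep isSmallCartan_AE3 _ hg 8 _ isPolSol_AE3_spin52 (Int.castRingHom ℝ)
    (by simp) fun i => ?_
  have h : X52 (toReal (rootAE3 i)) = fun B C =>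
      (1 / 4 : ℝ) * (Int.castRingHom ℝ) (tensor52 (rootAE3 i) (upAE3 i) B C) := by
    funext B C
    simp only [X52, tensor52, up_rootAE3, toReal, δ_eq_cast, eq_intCast]
    push_cast
    ring
  rw [h, SymIndex.reduced_smul, SymIndex.reduced_map, smul_smul]
  norm_num [Nat.factorial]

/-- Three times the raised components of the simple roots of `G₂⁺⁺`. -/
def upG2pp : Fin 4 → Fin 4 → ℤ :=
  ![![3, -3, 0, 0], ![0, 3, -3, 0], ![0, 0, 3, -3], ![-1, -1, -1, 2]]

theorem up_rootG2pp (i : Fin 4) :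
    up (toReal (rootG2pp i)) = fun b => (1 / 3 : ℝ) * (upG2pp i b : ℝ) := by
  funext b
  have h : ∑ a, (if b = a then 3 * rootG2pp i a else 0) - ∑ a, rootG2pp i a = upG2pp i b := by
    revert i b
    decide
  have h2 := congrArg (Int.cast : ℤ → ℝ) h
  push_cast at h2
  simp only [Finset.sum_ite_eq, Finset.mem_univ, if_true] at h2
  simp only [up, deWitt, toReal, Matrix.mulVec, dotProduct, sub_mul, Finset.sum_sub_distrib, ite_mul,
    one_mul, zero_mul, Finset.sum_ite_eq, Finset.mem_univ, if_true, ← Finset.mul_sum]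
  norm_num
  linarith

/-- The polarisation tensors of spin 3/2 for `G₂⁺⁺`, in terms of the two signs. -/
def matG2pp (ε ε' : ℤ) (i : Fin 4) : Matrix (Fin 4) (Fin 4) ℤ :=
  (symIndexOne 4).reduced (tensor32 (if i = 3 then 6 * ε' else -(2 * ε))
    (if i = 3 then -(9 * ε') else 3 * ε) (rootG2pp i) (upG2pp i))

/-- The signs are free because the relations that occur are linear in X j and, unless they just say
that a commutator vanishes, even in X i; the proof simply evaluates all four choices. The
denominator 12 clears quarters and the 1 / 3 of the raised components. -/
theorem isPolSol_G2pp_spin32 (ε ε' : ℤ) (hε : ε = 1 ∨ ε = -1) (hε' : ε' = 1 ∨ ε' = -1) :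
    IsPolSol cartanG2pp (Matrix.scalar (Fin 4) 12) (matG2pp ε ε') := by
  refine isPolSol_of_matrix _ _ ?_ ?_ ?_ ?_
  · intro i j _ h
    rcases hε with rfl | rfl <;> rcases hε' with rfl | rfl <;>
    fin_cases i <;> fin_cases j <;> first | exact absurd h (by decide) | decide +kernel
  · intro i j _ h
    rcases hε with rfl | rfl <;> rcases hε' with rfl | rfl <;>
    fin_cases i <;> fin_cases j <;> first | exact absurd h (by decide) | decide +kernel
  · intro i j _ h
    fin_cases i <;> fin_cases j <;> exact absurd h (by decide)
  · intro i j _ h D hD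
    subst hD
    rcases hε with rfl | rfl <;> rcases hε' with rfl | rfl <;>
    fin_cases i <;> fin_cases j <;> first | exact absurd h (by decide) | decide +kernel

theorem definesRep_G2pp_spin32 {N : ℕ} {g : Fin 4 → Matrix (Fin N) (Fin N) ℝ}
    (hg : IsGammaSol cartanG2pp g) (ε ε' : ℝ) (hε : ε = 1 ∨ ε = -1) (hε' : ε' = 1 ∨ ε' = -1) :
    DefinesRep cartanG2pp fun i => higherSpinJ
      (if i = 3 then X32 (ε' * (3 / 2)) (-(ε' * (3 / 4))) (toReal (rootG2pp i))
        else X32 (-(ε * (1 / 2))) (ε * (1 / 4)) (toReal (rootG2pp i))) (g i) := by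
  obtain ⟨e, he, rfl⟩ : ∃ e : ℤ, (e = 1 ∨ e = -1) ∧ ε = e := by
    rcases hε with rfl | rfl
    exacts [⟨1, by simp⟩, ⟨-1, by simp⟩]
  obtain ⟨e', he', rfl⟩ : ∃ e : ℤ, (e = 1 ∨ e = -1) ∧ ε' = e := by
    rcases hε' with rfl | rfl
    exacts [⟨1, by simp⟩, ⟨-1, by simp⟩]
  refine (symIndexOne 4).definesRep isSmallCartan_G2pp _ hg 12 _ (isPolSol_G2pp_spin32 e e' he he')
    (Int.castRingHom ℝ) (by simp) fun i => ?_
  simp only [matG2pp]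
  split_ifs
  all_goals
    refine reduced_X32 _ _ _ _ 12 _ _ (1 / 3) (up_rootG2pp i) ?_ ?_
    all_goals
      push_cast
      ring


/-! ### Spin 7/2 -/

/-- A multiple of `X72` with coefficients in an extension of the integers. -/
def tensor72 {n : ℕ} {S : Type*} [CommRing S] (p q : S) (a U : Fin n → ℤ) (B C : Fin 3 → Fin n) : S :=
  let D : Fin n → Fin n → ℤ := fun b c => if b = c then 1 else 0
  let x := a (B 0) * a (B 1) * a (B 2)
  let y := U (C 0) * U (C 1) * U (C 2)
  let z := (D (B 1) (B 2) - 1) * a (B 0)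
  let w := (2 * D (C 0) (C 1) - 1) * U (C 2)
  25 * ((-4 * (x * y) + 18 * (a (B 0) * a (B 1) * D (B 2) (C 0) * U (C 1) * U (C 2))
      - 18 * (a (B 0) * D (B 1) (C 0) * D (B 2) (C 1) * U (C 2))
      + 3 * (D (B 0) (C 0) * D (B 1) (C 1) * D (B 2) (C 2)) : ℤ) : S)
    + p * ((z * w : ℤ) : S) - q * ((x * w + 2 * (z * y) : ℤ) : S)

/-- The matrices of the spin 7/2 polarisation tensors over `ℤ√66`, multiplied by `900`. -/
def mat72_66 : Fin 3 → Matrix (Fin 10) (Fin 10) (ℤ√66) := ![Matrix.of ![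
  ![⟨-165, -15⟩, ⟨-180, 45⟩, ⟨180, 30⟩, ⟨180, -45⟩, ⟨0, 0⟩, ⟨-90, -15⟩, ⟨390, 15⟩, ⟨-180, -30⟩,
    ⟨90, 15⟩, ⟨0, 0⟩],
  ![⟨-144, 11⟩, ⟨207, -33⟩, ⟨228, 18⟩, ⟨18, 33⟩, ⟨0, 0⟩, ⟨-114, -9⟩, ⟨144, -11⟩, ⟨-228, -18⟩,
    ⟨114, 9⟩, ⟨0, 0⟩],
  ![⟨-84, -4⟩, ⟨252, 12⟩, ⟨183, 48⟩, ⟨-252, -12⟩, ⟨0, 0⟩, ⟨-204, -24⟩, ⟨84, 4⟩, ⟨42, -48⟩,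
    ⟨204, 24⟩, ⟨0, 0⟩],
  ![⟨144, -11⟩, ⟨18, 33⟩, ⟨-228, -18⟩, ⟨207, -33⟩, ⟨0, 0⟩, ⟨114, 9⟩, ⟨-144, 11⟩, ⟨228, 18⟩,
    ⟨-114, -9⟩, ⟨0, 0⟩],
  ![⟨0, 0⟩, ⟨0, 0⟩, ⟨0, 0⟩, ⟨0, 0⟩, ⟨225, 0⟩, ⟨0, 0⟩, ⟨0, 0⟩, ⟨0, 0⟩, ⟨0, 0⟩, ⟨0, 0⟩],
  ![⟨0, 0⟩, ⟨0, 0⟩, ⟨0, 0⟩, ⟨0, 0⟩, ⟨0, 0⟩, ⟨-225, 0⟩, ⟨0, 0⟩, ⟨0, 0⟩, ⟨450, 0⟩, ⟨0, 0⟩],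
  ![⟨390, 15⟩, ⟨180, -45⟩, ⟨-180, -30⟩, ⟨-180, 45⟩, ⟨0, 0⟩, ⟨90, 15⟩, ⟨-165, -15⟩, ⟨180, 30⟩,
    ⟨-90, -15⟩, ⟨0, 0⟩],
  ![⟨84, 4⟩, ⟨-252, -12⟩, ⟨42, -48⟩, ⟨252, 12⟩, ⟨0, 0⟩, ⟨204, 24⟩, ⟨-84, -4⟩, ⟨183, 48⟩,
    ⟨-204, -24⟩, ⟨0, 0⟩],
  ![⟨0, 0⟩, ⟨0, 0⟩, ⟨0, 0⟩, ⟨0, 0⟩, ⟨0, 0⟩, ⟨450, 0⟩, ⟨0, 0⟩, ⟨0, 0⟩, ⟨-225, 0⟩, ⟨0, 0⟩],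
  ![⟨0, 0⟩, ⟨0, 0⟩, ⟨0, 0⟩, ⟨0, 0⟩, ⟨0, 0⟩, ⟨0, 0⟩, ⟨0, 0⟩, ⟨0, 0⟩, ⟨0, 0⟩, ⟨225, 0⟩]],
  Matrix.of ![
  ![⟨225, 0⟩, ⟨0, 0⟩, ⟨0, 0⟩, ⟨0, 0⟩, ⟨0, 0⟩, ⟨0, 0⟩, ⟨0, 0⟩, ⟨0, 0⟩, ⟨0, 0⟩, ⟨0, 0⟩],
  ![⟨0, 0⟩, ⟨-225, 0⟩, ⟨450, 0⟩, ⟨0, 0⟩, ⟨0, 0⟩, ⟨0, 0⟩, ⟨0, 0⟩, ⟨0, 0⟩, ⟨0, 0⟩, ⟨0, 0⟩],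
  ![⟨0, 0⟩, ⟨450, 0⟩, ⟨-225, 0⟩, ⟨0, 0⟩, ⟨0, 0⟩, ⟨0, 0⟩, ⟨0, 0⟩, ⟨0, 0⟩, ⟨0, 0⟩, ⟨0, 0⟩],
  ![⟨0, 0⟩, ⟨-204, -24⟩, ⟨204, 24⟩, ⟨183, 48⟩, ⟨0, 0⟩, ⟨42, -48⟩, ⟨-84, -4⟩, ⟨252, 12⟩,
    ⟨-252, -12⟩, ⟨84, 4⟩],
  ![⟨0, 0⟩, ⟨0, 0⟩, ⟨0, 0⟩, ⟨0, 0⟩, ⟨225, 0⟩, ⟨0, 0⟩, ⟨0, 0⟩, ⟨0, 0⟩, ⟨0, 0⟩, ⟨0, 0⟩],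
  ![⟨0, 0⟩, ⟨204, 24⟩, ⟨-204, -24⟩, ⟨42, -48⟩, ⟨0, 0⟩, ⟨183, 48⟩, ⟨84, 4⟩, ⟨-252, -12⟩, ⟨252, 12⟩,
    ⟨-84, -4⟩],
  ![⟨0, 0⟩, ⟨-90, -15⟩, ⟨90, 15⟩, ⟨180, 30⟩, ⟨0, 0⟩, ⟨-180, -30⟩, ⟨-165, -15⟩, ⟨-180, 45⟩,
    ⟨180, -45⟩, ⟨390, 15⟩],
  ![⟨0, 0⟩, ⟨-114, -9⟩, ⟨114, 9⟩, ⟨228, 18⟩, ⟨0, 0⟩, ⟨-228, -18⟩, ⟨-144, 11⟩, ⟨207, -33⟩,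
    ⟨18, 33⟩, ⟨144, -11⟩],
  ![⟨0, 0⟩, ⟨114, 9⟩, ⟨-114, -9⟩, ⟨-228, -18⟩, ⟨0, 0⟩, ⟨228, 18⟩, ⟨144, -11⟩, ⟨18, 33⟩,
    ⟨207, -33⟩, ⟨-144, 11⟩],
  ![⟨0, 0⟩, ⟨90, 15⟩, ⟨-90, -15⟩, ⟨-180, -30⟩, ⟨0, 0⟩, ⟨180, 30⟩, ⟨390, 15⟩, ⟨180, -45⟩,
    ⟨-180, 45⟩, ⟨-165, -15⟩]],
  Matrix.of ![
  ![⟨225, 0⟩, ⟨0, 0⟩, ⟨0, 0⟩, ⟨0, 0⟩, ⟨0, 0⟩, ⟨0, 0⟩, ⟨0, 0⟩, ⟨0, 0⟩, ⟨0, 0⟩, ⟨0, 0⟩],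
  ![⟨0, 0⟩, ⟨225, 0⟩, ⟨0, 0⟩, ⟨0, 0⟩, ⟨0, 0⟩, ⟨0, 0⟩, ⟨0, 0⟩, ⟨0, 0⟩, ⟨0, 0⟩, ⟨0, 0⟩],
  ![⟨900, 0⟩, ⟨900, 0⟩, ⟨-675, 0⟩, ⟨0, 0⟩, ⟨0, 0⟩, ⟨0, 0⟩, ⟨0, 0⟩, ⟨0, 0⟩, ⟨0, 0⟩, ⟨0, 0⟩],
  ![⟨0, 0⟩, ⟨0, 0⟩, ⟨0, 0⟩, ⟨225, 0⟩, ⟨0, 0⟩, ⟨0, 0⟩, ⟨0, 0⟩, ⟨0, 0⟩, ⟨0, 0⟩, ⟨0, 0⟩],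
  ![⟨84, 4⟩, ⟨336, -84⟩, ⟨-252, -12⟩, ⟨336, -84⟩, ⟨-363, 72⟩, ⟨252, 12⟩, ⟨84, 4⟩, ⟨-252, -12⟩,
    ⟨252, 12⟩, ⟨-84, -4⟩],
  ![⟨1968, 8⟩, ⟨2472, -168⟩, ⟨-2304, -24⟩, ⟨672, -168⟩, ⟨-1176, 144⟩, ⟨729, 24⟩, ⟨168, 8⟩,
    ⟨-504, -24⟩, ⟨504, 24⟩, ⟨-168, -8⟩],
  ![⟨0, 0⟩, ⟨0, 0⟩, ⟨0, 0⟩, ⟨0, 0⟩, ⟨0, 0⟩, ⟨0, 0⟩, ⟨225, 0⟩, ⟨0, 0⟩, ⟨0, 0⟩, ⟨0, 0⟩],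
  ![⟨0, 0⟩, ⟨0, 0⟩, ⟨0, 0⟩, ⟨900, 0⟩, ⟨0, 0⟩, ⟨0, 0⟩, ⟨900, 0⟩, ⟨-675, 0⟩, ⟨0, 0⟩, ⟨0, 0⟩],
  ![⟨168, 8⟩, ⟨672, -168⟩, ⟨-504, -24⟩, ⟨2472, -168⟩, ⟨-1176, 144⟩, ⟨504, 24⟩, ⟨1968, 8⟩,
    ⟨-2304, -24⟩, ⟨729, 24⟩, ⟨-168, -8⟩],
  ![⟨3120, 120⟩, ⟨6480, -120⟩, ⟨-3960, -360⟩, ⟨6480, -120⟩, ⟨-5040, -240⟩, ⟨1260, 360⟩,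
    ⟨3120, 120⟩, ⟨-3960, -360⟩, ⟨1260, 360⟩, ⟨-195, -120⟩]]]

/-- The matrices of the spin 7/2 polarisation tensors over `ℤ√21`, multiplied by `900`. -/
def mat72_21 : Fin 3 → Matrix (Fin 10) (Fin 10) (ℤ√21) := ![Matrix.of ![
  ![⟨-165, -15⟩, ⟨-180, 45⟩, ⟨180, 30⟩, ⟨180, -45⟩, ⟨0, 0⟩, ⟨-90, -15⟩, ⟨390, 15⟩, ⟨-180, -30⟩,
    ⟨90, 15⟩, ⟨0, 0⟩],
  ![⟨-54, 11⟩, ⟨-63, -33⟩, ⟨48, 18⟩, ⟨288, 33⟩, ⟨0, 0⟩, ⟨-24, -9⟩, ⟨54, -11⟩, ⟨-48, -18⟩, ⟨24, 9⟩,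
    ⟨0, 0⟩],
  ![⟨6, -4⟩, ⟨-18, 12⟩, ⟨3, 48⟩, ⟨18, -12⟩, ⟨0, 0⟩, ⟨-114, -24⟩, ⟨-6, 4⟩, ⟨222, -48⟩, ⟨114, 24⟩,
    ⟨0, 0⟩],
  ![⟨54, -11⟩, ⟨288, 33⟩, ⟨-48, -18⟩, ⟨-63, -33⟩, ⟨0, 0⟩, ⟨24, 9⟩, ⟨-54, 11⟩, ⟨48, 18⟩, ⟨-24, -9⟩,
    ⟨0, 0⟩],
  ![⟨0, 0⟩, ⟨0, 0⟩, ⟨0, 0⟩, ⟨0, 0⟩, ⟨225, 0⟩, ⟨0, 0⟩, ⟨0, 0⟩, ⟨0, 0⟩, ⟨0, 0⟩, ⟨0, 0⟩],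
  ![⟨0, 0⟩, ⟨0, 0⟩, ⟨0, 0⟩, ⟨0, 0⟩, ⟨0, 0⟩, ⟨-225, 0⟩, ⟨0, 0⟩, ⟨0, 0⟩, ⟨450, 0⟩, ⟨0, 0⟩],
  ![⟨390, 15⟩, ⟨180, -45⟩, ⟨-180, -30⟩, ⟨-180, 45⟩, ⟨0, 0⟩, ⟨90, 15⟩, ⟨-165, -15⟩, ⟨180, 30⟩,
    ⟨-90, -15⟩, ⟨0, 0⟩],
  ![⟨-6, 4⟩, ⟨18, -12⟩, ⟨222, -48⟩, ⟨-18, 12⟩, ⟨0, 0⟩, ⟨114, 24⟩, ⟨6, -4⟩, ⟨3, 48⟩, ⟨-114, -24⟩,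
    ⟨0, 0⟩],
  ![⟨0, 0⟩, ⟨0, 0⟩, ⟨0, 0⟩, ⟨0, 0⟩, ⟨0, 0⟩, ⟨450, 0⟩, ⟨0, 0⟩, ⟨0, 0⟩, ⟨-225, 0⟩, ⟨0, 0⟩],
  ![⟨0, 0⟩, ⟨0, 0⟩, ⟨0, 0⟩, ⟨0, 0⟩, ⟨0, 0⟩, ⟨0, 0⟩, ⟨0, 0⟩, ⟨0, 0⟩, ⟨0, 0⟩, ⟨225, 0⟩]],
  Matrix.of ![
  ![⟨225, 0⟩, ⟨0, 0⟩, ⟨0, 0⟩, ⟨0, 0⟩, ⟨0, 0⟩, ⟨0, 0⟩, ⟨0, 0⟩, ⟨0, 0⟩, ⟨0, 0⟩, ⟨0, 0⟩],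
  ![⟨0, 0⟩, ⟨-225, 0⟩, ⟨450, 0⟩, ⟨0, 0⟩, ⟨0, 0⟩, ⟨0, 0⟩, ⟨0, 0⟩, ⟨0, 0⟩, ⟨0, 0⟩, ⟨0, 0⟩],
  ![⟨0, 0⟩, ⟨450, 0⟩, ⟨-225, 0⟩, ⟨0, 0⟩, ⟨0, 0⟩, ⟨0, 0⟩, ⟨0, 0⟩, ⟨0, 0⟩, ⟨0, 0⟩, ⟨0, 0⟩],
  ![⟨0, 0⟩, ⟨-114, -24⟩, ⟨114, 24⟩, ⟨3, 48⟩, ⟨0, 0⟩, ⟨222, -48⟩, ⟨6, -4⟩, ⟨-18, 12⟩, ⟨18, -12⟩,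
    ⟨-6, 4⟩],
  ![⟨0, 0⟩, ⟨0, 0⟩, ⟨0, 0⟩, ⟨0, 0⟩, ⟨225, 0⟩, ⟨0, 0⟩, ⟨0, 0⟩, ⟨0, 0⟩, ⟨0, 0⟩, ⟨0, 0⟩],
  ![⟨0, 0⟩, ⟨114, 24⟩, ⟨-114, -24⟩, ⟨222, -48⟩, ⟨0, 0⟩, ⟨3, 48⟩, ⟨-6, 4⟩, ⟨18, -12⟩, ⟨-18, 12⟩,
    ⟨6, -4⟩],
  ![⟨0, 0⟩, ⟨-90, -15⟩, ⟨90, 15⟩, ⟨180, 30⟩, ⟨0, 0⟩, ⟨-180, -30⟩, ⟨-165, -15⟩, ⟨-180, 45⟩,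
    ⟨180, -45⟩, ⟨390, 15⟩],
  ![⟨0, 0⟩, ⟨-24, -9⟩, ⟨24, 9⟩, ⟨48, 18⟩, ⟨0, 0⟩, ⟨-48, -18⟩, ⟨-54, 11⟩, ⟨-63, -33⟩, ⟨288, 33⟩,
    ⟨54, -11⟩],
  ![⟨0, 0⟩, ⟨24, 9⟩, ⟨-24, -9⟩, ⟨-48, -18⟩, ⟨0, 0⟩, ⟨48, 18⟩, ⟨54, -11⟩, ⟨288, 33⟩, ⟨-63, -33⟩,
    ⟨-54, 11⟩],
  ![⟨0, 0⟩, ⟨90, 15⟩, ⟨-90, -15⟩, ⟨-180, -30⟩, ⟨0, 0⟩, ⟨180, 30⟩, ⟨390, 15⟩, ⟨180, -45⟩,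
    ⟨-180, 45⟩, ⟨-165, -15⟩]],
  Matrix.of ![
  ![⟨225, 0⟩, ⟨0, 0⟩, ⟨0, 0⟩, ⟨0, 0⟩, ⟨0, 0⟩, ⟨0, 0⟩, ⟨0, 0⟩, ⟨0, 0⟩, ⟨0, 0⟩, ⟨0, 0⟩],
  ![⟨0, 0⟩, ⟨225, 0⟩, ⟨0, 0⟩, ⟨0, 0⟩, ⟨0, 0⟩, ⟨0, 0⟩, ⟨0, 0⟩, ⟨0, 0⟩, ⟨0, 0⟩, ⟨0, 0⟩],
  ![⟨900, 0⟩, ⟨900, 0⟩, ⟨-675, 0⟩, ⟨0, 0⟩, ⟨0, 0⟩, ⟨0, 0⟩, ⟨0, 0⟩, ⟨0, 0⟩, ⟨0, 0⟩, ⟨0, 0⟩],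
  ![⟨0, 0⟩, ⟨0, 0⟩, ⟨0, 0⟩, ⟨225, 0⟩, ⟨0, 0⟩, ⟨0, 0⟩, ⟨0, 0⟩, ⟨0, 0⟩, ⟨0, 0⟩, ⟨0, 0⟩],
  ![⟨-6, 4⟩, ⟨426, -84⟩, ⟨18, -12⟩, ⟨426, -84⟩, ⟨-183, 72⟩, ⟨-18, 12⟩, ⟨-6, 4⟩, ⟨18, -12⟩,
    ⟨-18, 12⟩, ⟨6, -4⟩],
  ![⟨1788, 8⟩, ⟨2652, -168⟩, ⟨-1764, -24⟩, ⟨852, -168⟩, ⟨-816, 144⟩, ⟨189, 24⟩, ⟨-12, 8⟩,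
    ⟨36, -24⟩, ⟨-36, 24⟩, ⟨12, -8⟩],
  ![⟨0, 0⟩, ⟨0, 0⟩, ⟨0, 0⟩, ⟨0, 0⟩, ⟨0, 0⟩, ⟨0, 0⟩, ⟨225, 0⟩, ⟨0, 0⟩, ⟨0, 0⟩, ⟨0, 0⟩],
  ![⟨0, 0⟩, ⟨0, 0⟩, ⟨0, 0⟩, ⟨900, 0⟩, ⟨0, 0⟩, ⟨0, 0⟩, ⟨900, 0⟩, ⟨-675, 0⟩, ⟨0, 0⟩, ⟨0, 0⟩],
  ![⟨-12, 8⟩, ⟨852, -168⟩, ⟨36, -24⟩, ⟨2652, -168⟩, ⟨-816, 144⟩, ⟨-36, 24⟩, ⟨1788, 8⟩,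
    ⟨-1764, -24⟩, ⟨189, 24⟩, ⟨12, -8⟩],
  ![⟨3120, 120⟩, ⟨6480, -120⟩, ⟨-3960, -360⟩, ⟨6480, -120⟩, ⟨-5040, -240⟩, ⟨1260, 360⟩,
    ⟨3120, 120⟩, ⟨-3960, -360⟩, ⟨1260, 360⟩, ⟨-195, -120⟩]]]

-- `tensor72` is 300 times `X72`, with p = 150u = 102 + 12√66 and q = 150v = 30 + 5√66. With 3! from
-- `reduced` the denominator is 1800; a common factor 2 is removed, leaving 900.
set_option maxRecDepth 100000 in
theorem mat72_66_eq (i : Fin 3) : (2 : ℤ√66) • mat72_66 i =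
    symIndexThree.reduced (tensor72 ⟨102, 12⟩ ⟨30, 5⟩ (rootAE3 i) (upAE3 i)) := by
  fin_cases i <;> decide +kernel

-- Computing in ℤ√66 treats both signs at once, since they correspond to the two embeddings into ℝ.
set_option maxRecDepth 100000 in
theorem isPolSol_mat72_66 : IsPolSol cartanAE3 (Matrix.scalar (Fin 10) ⟨900, 0⟩) mat72_66 := by
  refine isPolSol_of_matrix _ _ ?_ ?_ ?_ ?_
  · intro i j _ h
    fin_cases i <;> fin_cases j <;> first | exact absurd h (by decide) | decide +kernel
  · intro i j _ h
    fin_cases i <;> fin_cases j <;> first | exact absurd h (by decide) | decide +kernel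
  · intro i j _ h C hC
    subst hC
    fin_cases i <;> fin_cases j <;> first | exact absurd h (by decide) | decide +kernel
  · intro i j _ h
    fin_cases i <;> fin_cases j <;> exact absurd h (by decide)

set_option maxRecDepth 100000 in
theorem mat72_21_eq (i : Fin 3) : (2 : ℤ√21) • mat72_21 i =
    symIndexThree.reduced (tensor72 ⟨57, 12⟩ ⟨30, 5⟩ (rootAE3 i) (upAE3 i)) := by
  fin_cases i <;> decide +kernel

set_option maxRecDepth 100000 in
theorem isPolSol_mat72_21 : IsPolSol cartanAE3 (Matrix.scalar (Fin 10) ⟨900, 0⟩) mat72_21 := by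
  refine isPolSol_of_matrix _ _ ?_ ?_ ?_ ?_
  · intro i j _ h
    fin_cases i <;> fin_cases j <;> first | exact absurd h (by decide) | decide +kernel
  · intro i j _ h
    fin_cases i <;> fin_cases j <;> first | exact absurd h (by decide) | decide +kernel
  · intro i j _ h C hC
    subst hC
    fin_cases i <;> fin_cases j <;> first | exact absurd h (by decide) | decide +kernel
  · intro i j _ h
    fin_cases i <;> fin_cases j <;> exact absurd h (by decide)


/-- The quartic polynomial annihilating the operators of the `√21` solution. -/
def quartic {S : Type*} [CommRing S] {r : ℕ} (M : S) (X : Matrix (Fin r) (Fin r) S) :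
    Matrix (Fin r) (Fin r) S :=
  (16 • (X * X) - (M * M) • 1) * (16 • (X * X) - (9 * (M * M)) • 1)

-- The normalised operator X / 900 of the first simple root is annihilated by (16t² − 1)(16t² − 9),
-- whose roots are ±1/4 and ±3/4. For √66 this fails, which separates the two solutions.
set_option maxRecDepth 100000 in
theorem quartic_mat72_21 : quartic ⟨900, 0⟩ (mat72_21 0) = 0 := by
  unfold quartic
  decide +kernel

set_option maxRecDepth 100000 in
theorem quartic_mat72_66 : quartic ⟨900, 0⟩ (mat72_66 0) ≠ 0 := by
  unfold quartic
  decide +kernel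


/-! ### From the exact spin 7/2 matrices to real tensors -/

theorem deWitt_three_mul :
    deWitt 3 * Matrix.of (fun a b => (if a = b then 1 else 0) - 1) = 1 := by
  ext a b
  simp only [Matrix.mul_apply, deWitt, Matrix.of_apply, mul_sub, Finset.sum_sub_distrib,
    Matrix.one_apply, mul_ite, mul_one, mul_zero, Finset.sum_ite_eq,
    Finset.sum_ite_eq', Finset.mem_univ, if_true, Finset.sum_const, Finset.card_univ,
    Fintype.card_fin]
  norm_num

theorem inv_deWitt_three : (deWitt 3)⁻¹ = Matrix.of fun a b => (if a = b then 1 else 0) - 1 :=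
  Matrix.inv_eq_right_inv deWitt_three_mul

theorem deWitt_three_mul_inv : deWitt 3 * (deWitt 3)⁻¹ = 1 := by
  rw [inv_deWitt_three, deWitt_three_mul]

/-- In dimension three the inverse metric is δ − 1 and twice the metric is 2δ − 1, so all
coefficients except u and v become integral after multiplication by 300. -/
theorem reduced_X72 {S : Type*} [CommRing S] (φ : S →+* ℝ) (p q : S) (u v : ℝ)
    (hu : 150 * u = φ p) (hv : 150 * v = φ q) (i : Fin 3) (X : Matrix (Fin 10) (Fin 10) S)
    (hX : (2 : S) • X = symIndexThree.reduced (tensor72 p q (rootAE3 i) (upAE3 i))) :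
    (Nat.factorial 3 : ℝ)⁻¹ • symIndexThree.reduced (X72 u v (toReal (rootAE3 i))) =
      (900 : ℝ)⁻¹ • φ.mapMatrix X := by
  have h : X72 u v (toReal (rootAE3 i)) = fun B C =>
      (1 / 300 : ℝ) * φ (tensor72 p q (rootAE3 i) (upAE3 i) B C) := by
    funext B C
    have hG : ∀ a b : Fin 3, deWitt 3 a b = (if a = b then 1 else 0) - 1 / 2 := fun a b => by
      rw [deWitt]; norm_num
    simp only [X72, tensor72, inv_deWitt_three, hG, up_rootAE3, toReal, Matrix.of_apply, map_add,
      map_sub, map_mul, map_ofNat, map_intCast, ← hu, ← hv, δ]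
    push_cast
    ring
  have h2 : φ.mapMatrix ((2 : S) • X) = (2 : ℝ) • φ.mapMatrix X := by
    ext a b
    simp [map_ofNat φ 2]
  rw [h, SymIndex.reduced_smul, SymIndex.reduced_map, ← hX, h2, smul_smul, smul_smul]
  congr 1
  norm_num [Nat.factorial]

/-- The homomorphisms `ℤ√d → ℝ`. -/
def sqrtHom (d : ℕ) (ε : ℝ) (hε : ε = 1 ∨ ε = -1) : ℤ√(d : ℤ) →+* ℝ :=
  Zsqrtd.lift ⟨ε * √(d : ℝ), by
    have : ε * ε = 1 := by rcases hε with rfl | rfl <;> norm_num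
    rw [mul_mul_mul_comm, this, Real.mul_self_sqrt (Nat.cast_nonneg d), one_mul, Int.cast_natCast]⟩

theorem sqrtHom_mk (d : ℕ) (ε : ℝ) (hε : ε = 1 ∨ ε = -1) (a b : ℤ) :
    sqrtHom d ε hε ⟨a, b⟩ = a + b * (ε * √(d : ℝ)) := rfl

section

variable (ε : ℝ) (hε : ε = 1 ∨ ε = -1) (i : Fin 3)

theorem reduced_X72_66 :
    (Nat.factorial 3 : ℝ)⁻¹ • symIndexThree.reduced
      (X72 (1 / 25 * (17 + ε * (2 * √66))) (1 / 30 * (6 + ε * √66)) (toReal (rootAE3 i))) =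
      (900 : ℝ)⁻¹ • (sqrtHom 66 ε hε).mapMatrix (mat72_66 i) :=
  reduced_X72 (sqrtHom 66 ε hε) _ _ _ _ (by rw [sqrtHom_mk]; push_cast; ring)
    (by rw [sqrtHom_mk]; push_cast; ring) i _ (mat72_66_eq i)

theorem reduced_X72_21 :
    (Nat.factorial 3 : ℝ)⁻¹ • symIndexThree.reduced
      (X72 (1 / 50 * (19 + ε * (4 * √21))) (1 / 30 * (6 + ε * √21)) (toReal (rootAE3 i))) =
      (900 : ℝ)⁻¹ • (sqrtHom 21 ε hε).mapMatrix (mat72_21 i) :=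
  reduced_X72 (sqrtHom 21 ε hε) _ _ _ _ (by rw [sqrtHom_mk]; push_cast; ring)
    (by rw [sqrtHom_mk]; push_cast; ring) i _ (mat72_21_eq i)

theorem sqrtHom_denominator (d : ℕ) : sqrtHom d ε hε ⟨900, 0⟩ = 900 := by
  simp [sqrtHom_mk]

variable {N : ℕ} {g : Fin 3 → Matrix (Fin N) (Fin N) ℝ}

include hε in
theorem definesRep_AE3_spin72_66 (hg : IsGammaSol cartanAE3 g) :
    DefinesRep cartanAE3 fun i => higherSpinJ
      (X72 (1 / 25 * (17 + ε * (2 * √66))) (1 / 30 * (6 + ε * √66)) (toReal (rootAE3 i))) (g i) :=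
  symIndexThree.definesRep isSmallCartan_AE3 _ hg _ _ isPolSol_mat72_66 (sqrtHom 66 ε hε)
    (by rw [sqrtHom_denominator]; norm_num) fun i => by
      rw [sqrtHom_denominator, ← reduced_X72_66]

include hε in
theorem definesRep_AE3_spin72_21 (hg : IsGammaSol cartanAE3 g) :
    DefinesRep cartanAE3 fun i => higherSpinJ
      (X72 (1 / 50 * (19 + ε * (4 * √21))) (1 / 30 * (6 + ε * √21)) (toReal (rootAE3 i))) (g i) :=
  symIndexThree.definesRep isSmallCartan_AE3 _ hg _ _ isPolSol_mat72_21 (sqrtHom 21 ε hε)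
    (by rw [sqrtHom_denominator]; norm_num) fun i => by
      rw [sqrtHom_denominator, ← reduced_X72_21]

end

/-! ### Inequivalence of the two spin 7/2 solutions -/

theorem map_quartic {S S' : Type*} [CommRing S] [CommRing S'] {r : ℕ} (φ : S →+* S') (M : S)
    (X : Matrix (Fin r) (Fin r) S) :
    quartic (φ M) (φ.mapMatrix X) = φ.mapMatrix (quartic M X) := by
  have h : ∀ (c : S) (Y : Matrix (Fin r) (Fin r) S),
      φ.mapMatrix (c • Y) = φ c • φ.mapMatrix Y := fun c Y => by
    ext a b
    simp
  simp only [quartic, map_mul, map_sub, map_nsmul, h, map_one, map_ofNat]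

/-- Since w² = −1 and w commutes with the tensor factor, J² = −4X² / M². Hence 4J² + 1 and 4J² + 9
are minus the two factors of the quartic divided by M², and the signs cancel. -/
theorem quartic_of_commute {ℬ : Type*} [Ring ℬ] [Algebra ℝ ℬ] {r : ℕ}
    (a : Matrix (Fin r) (Fin r) ℝ →ₐ[ℝ] ℬ) (w : ℬ) (hw : w * w = -1) (hc : ∀ m, a m * w = w * a m)
    (M : ℝ) (hM : M ≠ 0) (X : Matrix (Fin r) (Fin r) ℝ) (J : ℬ)
    (hJ : J = (-2 : ℝ) • (a (M⁻¹ • X) * w)) :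
    (4 • (J * J) + 1) * (4 • (J * J) + 9) = (M⁻¹ ^ 4) • a (quartic M X) := by
  have h1 : J * J = (-4 * M⁻¹ ^ 2) • a (X * X) := by
    have h0 : a (M⁻¹ • X) * w * (a (M⁻¹ • X) * w) = -a (M⁻¹ • X * M⁻¹ • X) := by
      rw [mul_assoc, ← mul_assoc w, ← hc, mul_assoc, hw, mul_neg_one, mul_neg, map_mul]
    rw [hJ, smul_mul_smul_comm, h0, smul_mul_smul_comm, map_smul, smul_neg, smul_smul, ← neg_smul]
    congr 1
    ring
  have h9 : (9 : ℬ) = (9 : ℝ) • 1 := by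
    rw [Algebra.smul_def, mul_one, map_ofNat]
  rw [h1, h9, quartic]
  simp only [map_mul, map_sub, map_smul, map_nsmul, map_one]
  generalize a X * a X = Y
  simp only [mul_add, add_mul, mul_sub, sub_mul, smul_mul_assoc, mul_smul_comm, one_mul, mul_one,
    ← Nat.cast_smul_eq_nsmul ℝ]
  match_scalars <;> field_simp <;> norm_num

/-- The quartic polynomial of a tensor in terms of the operator on tensor-spinors. -/
theorem tensorAct_quartic {n s r N : ℕ} (I : SymIndex n s r) (k : Tensor n s)
    {g : Matrix (Fin N) (Fin N) ℝ} (hg : g * g = -1) (M : ℝ) (hM : M ≠ 0)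
    (X : Matrix (Fin r) (Fin r) ℝ) (hX : (Nat.factorial s : ℝ)⁻¹ • I.reduced k = M⁻¹ • X) :
    (4 • (higherSpinJ k g * higherSpinJ k g) + 1) * (4 • (higherSpinJ k g * higherSpinJ k g) + 9) =
      (M⁻¹ ^ 4) • I.tensorAct (N := N) (quartic M X) :=
  quartic_of_commute (ℬ := Module.End ℝ (Spinor n s N)) I.tensorAct (spinAct n s N g) (by rw [← map_mul, hg, map_neg, map_one])
    (fun m => I.tensorAct_spinAct m g) M hM X _ (by rw [I.higherSpinJ_eq, hX])

/-- A polynomial equation satisfied by the first generator is invariant under intertwining; (4J² +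
1)(4J² + 9) = 0 holds for √21 and fails for √66, whatever the signs. -/
theorem not_equivalent_spin72 {N : ℕ} (hN : 0 < N) {g : Fin 3 → Matrix (Fin N) (Fin N) ℝ}
    (hg : g 0 * g 0 = -1) (ε ε' : ℝ) (hε : ε = 1 ∨ ε = -1) (hε' : ε' = 1 ∨ ε' = -1) :
    ¬ Equivalent
      (fun i => higherSpinJ (X72 (1 / 25 * (17 + ε * (2 * √66))) (1 / 30 * (6 + ε * √66))
        (toReal (rootAE3 i))) (g i))
      (fun i => higherSpinJ (X72 (1 / 50 * (19 + ε' * (4 * √21))) (1 / 30 * (6 + ε' * √21))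
        (toReal (rootAE3 i))) (g i)) := by
  rintro ⟨T, hT⟩
  set J := higherSpinJ (X72 (1 / 25 * (17 + ε * (2 * √66))) (1 / 30 * (6 + ε * √66))
    (toReal (rootAE3 0))) (g 0) with hJ
  set J' := higherSpinJ (X72 (1 / 50 * (19 + ε' * (4 * √21))) (1 / 30 * (6 + ε' * √21))
    (toReal (rootAE3 0))) (g 0) with hJ'
  have h21 : (4 • (J' * J') + 1) * (4 • (J' * J') + 9) = 0 := by
    rw [hJ', tensorAct_quartic symIndexThree _ hg 900 (by norm_num) _ (reduced_X72_21 ε' hε' 0),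
      ← sqrtHom_denominator ε' hε' 21, map_quartic, quartic_mat72_21, map_zero, map_zero, smul_zero]
  have h66 : (4 • (J * J) + 1) * (4 • (J * J) + 9) = 0 := by
    refine LinearMap.ext fun v => T.injective ?_
    have h9 : ∀ (V : Type) [AddCommGroup V] [Module ℝ V] (w : V), (9 : Module.End ℝ V) w = 9 • w :=
      fun V _ _ w => rfl
    have hT0 : ∀ w, T (J w) = J' (T w) := hT 0
    have := LinearMap.congr_fun h21 (T v)
    simpa [hT0] using this
  rw [hJ, tensorAct_quartic symIndexThree _ hg 900 (by norm_num) _ (reduced_X72_66 ε hε 0),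
    ← sqrtHom_denominator ε hε 66, map_quartic] at h66
  have h0 := (smul_eq_zero.1 h66).resolve_left (by rw [sqrtHom_denominator]; norm_num)
  have h1 := symIndexThree.tensorAct_injective hN (h0.trans (map_zero _).symm)
  refine quartic_mat72_66 ?_
  -- 66 lies strictly between 8² and 9², so it is not a square and ℤ√66 embeds in ℝ.
  have hinj : Function.Injective (sqrtHom 66 ε hε) := by
    refine Zsqrtd.lift_injective _ fun n hn => ?_
    have h8 : n.natAbs * n.natAbs = 66 := by
      have := congrArg Int.natAbs hn
      rw [Int.natAbs_mul] at this
      exact this.symm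
    have : n.natAbs ≤ 8 := by nlinarith
    interval_cases n.natAbs <;> omega
  ext1 a b
  refine hinj ?_
  rw [Matrix.zero_apply, map_zero]
  exact congrFun (congrFun h1 a) b


/-! ### Gamma matrices -/

section units

variable {R : Type*} [Ring R]

theorem neg_one_zpow_congr {H : Type*} [Group H] [HasDistribNeg H] {m m' : ℤ} (h : Even (m - m')) :
    (-1 : H) ^ m = (-1) ^ m' := by
  rw [← sub_add_cancel m m', zpow_add, h.neg_one_zpow, one_mul]

/-- Two units commute up to the sign `(-1) ^ m`. -/
def SignComm (a b : Rˣ) (m : ℤ) : Prop := SemiconjBy a b ((-1) ^ m * b)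

theorem neg_one_zpow_comm (m : ℤ) (a : Rˣ) : Commute ((-1 : Rˣ) ^ m) a :=
  (Commute.neg_one_left a).zpow_left m

theorem SignComm.congr {a b : Rˣ} {m m' : ℤ} (h : SignComm a b m) (hm : Even (m - m')) :
    SignComm a b m' := by
  rw [SignComm, ← neg_one_zpow_congr hm]
  exact h

theorem SignComm.self (a : Rˣ) : SignComm a a 0 := by
  simp [SignComm, SemiconjBy]

theorem SignComm.symm {a b : Rˣ} {m : ℤ} (h : SignComm a b m) : SignComm b a m := by
  have h1 : a * b = (-1) ^ m * b * a := h
  change b * a = (-1) ^ m * a * b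
  rw [mul_assoc, h1, mul_assoc, ← mul_assoc, ← zpow_add, Even.neg_one_zpow ⟨m, rfl⟩, one_mul]

/-- Signs add under products, so exchanging monomials in the gamma matrices reduces to a bilinear
form modulo 2 in the exponents. -/
theorem SignComm.mul_right {a b c : Rˣ} {m k : ℤ} (h : SignComm a b m) (h' : SignComm a c k) :
    SignComm a (b * c) (m + k) := by
  have := SemiconjBy.mul_right h h'
  rwa [mul_assoc, ← mul_assoc b, ← (neg_one_zpow_comm k b).eq, mul_assoc, ← mul_assoc,
    ← zpow_add] at this

theorem SignComm.zpow_right {a b : Rˣ} {m : ℤ} (h : SignComm a b m) (j : ℤ) :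
    SignComm a (b ^ j) (m * j) := by
  have := SemiconjBy.zpow_right h j
  rwa [(neg_one_zpow_comm m b).mul_zpow, ← zpow_mul] at this

theorem SignComm.mul_left {a b c : Rˣ} {m k : ℤ} (h : SignComm a c m) (h' : SignComm b c k) :
    SignComm (a * b) c (m + k) := (h.symm.mul_right h'.symm).symm

theorem SignComm.zpow_left {a b : Rˣ} {m : ℤ} (h : SignComm a b m) (j : ℤ) :
    SignComm (a ^ j) b (m * j) := (h.symm.zpow_right j).symm

theorem SignComm.prod_right {a : Rˣ} : ∀ {n : ℕ} {u : Fin n → Rˣ} {m : Fin n → ℤ},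
    (∀ i, SignComm a (u i) (m i)) → SignComm a (List.ofFn u).prod (∑ i, m i)
  | 0, _, _, _ => by simp [SignComm, SemiconjBy]
  | n + 1, u, m, h => by
    rw [List.ofFn_succ, List.prod_cons, Fin.sum_univ_succ]
    exact (h 0).mul_right (SignComm.prod_right fun i => h i.succ)

/-- The sign of the square of a product. -/
theorem SignComm.sq_mul {a b : Rˣ} {m s t : ℤ} (h : SignComm a b m) (ha : a * a = (-1) ^ s)
    (hb : b * b = (-1) ^ t) : a * b * (a * b) = (-1) ^ (s + t + m) := by
  have h1 : b * a = (-1) ^ m * a * b := h.symm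
  rw [mul_assoc, ← mul_assoc b, h1, mul_assoc, mul_assoc, hb, ← mul_assoc a,
    ← (neg_one_zpow_comm m a).eq, mul_assoc, ← mul_assoc a, ha, ← zpow_add, ← zpow_add]
  congr 1
  ring

theorem sq_zpow {a : Rˣ} {s : ℤ} (ha : a * a = (-1) ^ s) (j : ℤ) :
    a ^ j * a ^ j = (-1) ^ (s * j) := by
  rw [← (Commute.refl a).mul_zpow, ha, zpow_mul]

end units

/-! ### Orthogonal units and gamma relations -/

section matrices

variable {N : ℕ}

theorem coe_neg_one_zpow (m : ℤ) :
    (((-1 : (Matrix (Fin N) (Fin N) ℝ)ˣ) ^ m : (Matrix (Fin N) (Fin N) ℝ)ˣ) :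
      Matrix (Fin N) (Fin N) ℝ) = ((-1 : ℝ) ^ m) • 1 := by
  rcases Int.even_or_odd m with h | h
  · simp [h.neg_one_zpow]
  · simp [h.neg_one_zpow]

theorem SignComm.coe {a b : (Matrix (Fin N) (Fin N) ℝ)ˣ} {m : ℤ} (h : SignComm a b m) :
    (a * b : Matrix (Fin N) (Fin N) ℝ) = ((-1 : ℝ) ^ m) • (b * a : Matrix (Fin N) (Fin N) ℝ) := by
  have h1 : a * b = (-1) ^ m * b * a := h
  have := congrArg Units.val h1
  rwa [Units.val_mul, Units.val_mul, Units.val_mul, coe_neg_one_zpow, smul_mul_assoc, one_mul,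
    smul_mul_assoc] at this

/-- The orthogonal group, as a group of units. -/
def orthogonalUnits (N : ℕ) : Subgroup (Matrix (Fin N) (Fin N) ℝ)ˣ where
  carrier := {u | (u : Matrix (Fin N) (Fin N) ℝ)ᵀ = (u⁻¹ : (Matrix (Fin N) (Fin N) ℝ)ˣ)}
  mul_mem' {a b} ha hb := by
    simp only [Set.mem_ofPred_eq] at ha hb ⊢
    rw [Units.val_mul, Matrix.transpose_mul, ha, hb, mul_inv_rev, Units.val_mul]
  one_mem' := by simp
  inv_mem' {a} ha := by
    simp only [Set.mem_ofPred_eq] at ha ⊢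
    rw [← ha, Matrix.transpose_transpose, inv_inv]

/-- For an orthogonal matrix the transpose is the inverse, and a square ±1 makes the inverse ±u. The
transposition rule thus follows from the rule for squares. -/
theorem transpose_of_sq {u : (Matrix (Fin N) (Fin N) ℝ)ˣ} (hu : u ∈ orthogonalUnits N) {m : ℤ}
    (h : u * u = (-1) ^ m) : (u : Matrix (Fin N) (Fin N) ℝ)ᵀ =
      ((-1 : ℝ) ^ m) • (u : Matrix (Fin N) (Fin N) ℝ) := by
  have h1 : (u : Matrix (Fin N) (Fin N) ℝ)ᵀ = (u⁻¹ : (Matrix (Fin N) (Fin N) ℝ)ˣ) := hu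
  have h2 : u⁻¹ = (-1) ^ m * u := by
    rw [inv_eq_iff_mul_eq_one, ← mul_assoc, ← (neg_one_zpow_comm m u).eq, mul_assoc, h, ← zpow_add,
      Even.neg_one_zpow ⟨m, rfl⟩]
  rw [h1, h2, Units.val_mul, coe_neg_one_zpow, smul_mul_assoc, one_mul]

/-- Gamma relations from orthogonal units with known commutation signs and squares. -/
theorem gammaRelations_of_units {n : ℕ} {ι : Type*} {G : Matrix (Fin n) (Fin n) ℝ}
    {α : ι → Fin n → ℝ} (u : ι → (Matrix (Fin N) (Fin N) ℝ)ˣ) (hu : ∀ i, u i ∈ orthogonalUnits N)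
    (m : ι → ι → ℤ) (hm : ∀ i j, (m i j : ℝ) = rootInner G (α i) (α j))
    (s : ι → ℤ) (hs : ∀ i, 2 * s i = m i i)
    (hcomm : ∀ i j, SignComm (u i) (u j) (m i j)) (hsq : ∀ i, u i * u i = (-1) ^ s i) :
    GammaRelations G α fun i => (u i : Matrix (Fin N) (Fin N) ℝ) := by
  refine ⟨fun i j => ⟨m i j, hm i j, (hcomm i j).coe⟩, fun i => ⟨s i, ?_, ?_, ?_⟩⟩
  · rw [← hm i i, ← hs i]
    push_cast
    ring
  · exact transpose_of_sq (hu i) (hsq i)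
  · rw [← Units.val_mul, hsq i, coe_neg_one_zpow]

/-- Gamma relations on simple roots. -/
theorem GammaRelations.isGammaSol {n : ℕ} {A : Matrix (Fin n) (Fin n) ℤ}
    {G : Matrix (Fin n) (Fin n) ℝ} {α : Fin n → Fin n → ℝ} {g : Fin n → Matrix (Fin N) (Fin N) ℝ}
    (h : GammaRelations G α g) (D : Fin n → ℤ) (hD : ∀ i, Odd (D i)) (hA : ∀ i, A i i = 2)
    (hG : ∀ i j, rootInner G (α i) (α j) = D i * A i j) : IsGammaSol A g := by
  -- Odd D i do not change the parity of A i j, so symmetrised and Cartan entries give the same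
  -- signs.
  have hodd : ∀ i j, Odd (A i j) → g i * g j = -(g j * g i) := fun i j hij => by
    obtain ⟨m, hm, hm'⟩ := h.1 i j
    have : m = D i * A i j := by
      rw [hG] at hm
      exact_mod_cast hm
    rw [hm', this, ((hD i).mul hij).neg_one_zpow, neg_smul, one_smul]
  refine ⟨fun i => ?_, fun i j _ hij => ?_, fun i j _ hij => ?_⟩
  · obtain ⟨m, hm, -, hm'⟩ := h.2 i
    have : m = D i := by
      rw [hG, hA] at hm
      have : (m : ℝ) = D i := by rw [hm]; push_cast; ring
      exact_mod_cast this
    rw [hm', this, (hD i).neg_one_zpow, neg_smul, one_smul]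
  · obtain ⟨m, hm, hm'⟩ := h.1 i j
    have : m = D i * A i j := by
      rw [hG] at hm
      exact_mod_cast hm
    have he : Even (A i j) := by
      rcases hij with hij | hij <;> rw [hij] <;> decide
    rw [hm', this, (he.mul_left (D i)).neg_one_zpow, one_smul]
  · refine hodd i j ?_
    rcases hij with hij | hij <;> rw [hij] <;> decide

end matrices

theorem rootInner_deWitt {n : ℕ} (p q : Fin n → ℤ) : rootInner (deWitt n) (toReal p) (toReal q) =
    ((∑ a, p a * q a : ℤ) : ℝ) - ((∑ a, p a : ℤ) : ℝ) * ((∑ a, q a : ℤ) : ℝ) / ((n : ℝ) - 1) := by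
  simp only [rootInner, deWitt, toReal, Matrix.mulVec, dotProduct, sub_mul, Finset.sum_sub_distrib,
    ite_mul, one_mul, zero_mul, Finset.sum_ite_eq, Finset.mem_univ, if_true, ← Finset.mul_sum,
    mul_sub, ← Finset.sum_mul]
  push_cast
  ring

namespace IsGamma

variable {d N : ℕ} {Γ : Fin (d + 1) → Matrix (Fin N) (Fin N) ℝ} (h : IsGamma Γ)

theorem η_mul_η (μ : Fin (d + 1)) : η μ * η μ = 1 := by
  unfold η
  split_ifs <;> norm_num

include h in
theorem sq (μ : Fin (d + 1)) : Γ μ * Γ μ = η μ • 1 := by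
  have h1 := h.clifford μ μ
  rw [if_pos rfl, mul_smul, two_smul ℝ (η μ • (1 : Matrix (Fin N) (Fin N) ℝ)), ← two_smul ℝ,
    ← two_smul ℝ (η μ • (1 : Matrix (Fin N) (Fin N) ℝ))] at h1
  exact smul_right_injective _ two_ne_zero h1

/-- The gamma matrices as units. -/
def unit (μ : Fin (d + 1)) : (Matrix (Fin N) (Fin N) ℝ)ˣ where
  val := Γ μ
  inv := η μ • Γ μ
  val_inv := by rw [mul_smul_comm, h.sq, smul_smul, η_mul_η, one_smul]
  inv_val := by rw [smul_mul_assoc, h.sq, smul_smul, η_mul_η, one_smul]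

theorem unit_sq (μ : Fin (d + 1)) : h.unit μ * h.unit μ = (-1) ^ (if μ = 0 then 1 else 0 : ℤ) := by
  refine Units.ext ?_
  rw [coe_neg_one_zpow]
  refine (h.sq μ).trans ?_
  unfold η
  split_ifs <;> simp

theorem unit_signComm (μ ν : Fin (d + 1)) :
    SignComm (h.unit μ) (h.unit ν) (if μ = ν then 0 else 1) := by
  split_ifs with hμν
  · rw [hμν]
    exact SignComm.self _
  · refine Units.ext ?_
    have := h.clifford μ ν
    rw [if_neg hμν] at this
    rw [zpow_one, neg_one_mul, neg_mul]
    exact eq_neg_of_add_eq_zero_left this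

theorem unit_mem (μ : Fin (d + 1)) : h.unit μ ∈ orthogonalUnits N := h.transpose μ

/-- `Γ_*` as a unit. -/
def star : (Matrix (Fin N) (Fin N) ℝ)ˣ := (List.ofFn h.unit).prod

theorem coe_star : (h.star : Matrix (Fin N) (Fin N) ℝ) = gammaStar Γ := by
  rw [star, gammaStar, ← Units.coeHom_apply, map_list_prod, List.map_ofFn]
  rfl

/-- Γ_μ commutes with itself and anticommutes with the d other factors of Γ_*. -/
theorem unit_star (μ : Fin (d + 1)) : SignComm (h.unit μ) h.star d := by
  have := SignComm.prod_right (h.unit_signComm μ)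
  have h1 : ∑ ν, (if μ = ν then 0 else 1 : ℤ) = d := by
    rw [Finset.sum_congr rfl fun ν _ => (by split_ifs <;> simp :
      (if μ = ν then 0 else 1 : ℤ) = 1 - if μ = ν then 1 else 0), Finset.sum_sub_distrib]
    simp
  rwa [h1] at this

theorem star_mem : h.star ∈ orthogonalUnits N :=
  Subgroup.list_prod_mem _ fun u hu => by
    obtain ⟨μ, rfl⟩ := List.mem_ofFn.1 hu
    exact h.unit_mem μ

end IsGamma

/-! ### The matrices Γ(α) on the root lattice of AE₃ -/

section AE3

theorem rootInner_AE3 (i j : Fin 3) : rootInner (deWitt 3) (toReal (rootAE3 i)) (toReal (rootAE3 j)) =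
    (cartanAE3 i j : ℝ) := by
  have h : 2 * ∑ a, rootAE3 i a * rootAE3 j a - (∑ a, rootAE3 i a) * (∑ a, rootAE3 j a) =
      2 * cartanAE3 i j := by
    revert i j
    decide
  have h2 := congrArg (Int.cast : ℤ → ℝ) h
  rw [rootInner_deWitt]
  rw [Int.cast_sub, Int.cast_mul, Int.cast_mul, Int.cast_mul] at h2
  norm_num at h2 ⊢
  linarith

variable {Γ : Fin 4 → Matrix (Fin 4) (Fin 4) ℝ} (h : IsGamma Γ)

namespace IsGamma

/-- The sign counts one timelike factor and the 6 pairs of distinct gamma matrices, which is odd. -/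
theorem star_sq_three : h.star * h.star = (-1) ^ (1 : ℤ) := by
  have e : h.star = h.unit 0 * h.unit 1 * h.unit 2 * h.unit 3 := by
    simp [IsGamma.star, List.ofFn_succ, mul_assoc]
  have s := h.unit_signComm
  have q := h.unit_sq
  have h2 := (s 0 1).sq_mul (q 0) (q 1)
  have h3 := ((s 0 2).mul_left (s 1 2)).sq_mul h2 (q 2)
  have h4 := (((s 0 3).mul_left (s 1 3)).mul_left (s 2 3)).sq_mul h3 (q 3)
  rw [e, h4]
  exact neg_one_zpow_congr (by decide)

/-- `Γ(α)` as a unit. -/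
def unitAE3 (p : Fin 3 → ℤ) : (Matrix (Fin 4) (Fin 4) ℝ)ˣ :=
  h.unit 1 ^ p 0 * h.unit 2 ^ p 1 * h.unit 3 ^ p 2 * h.star ^ ((p 0 + p 1 + p 2) / 2)

theorem coe_unitAE3 (p : Fin 3 → ℤ) : (h.unitAE3 p : Matrix (Fin 4) (Fin 4) ℝ) = gammaAE3 Γ p := by
  simp only [unitAE3, gammaAE3, Units.val_mul, Matrix.coe_units_zpow, coe_star]
  rfl

theorem unitAE3_mem (p : Fin 3 → ℤ) : h.unitAE3 p ∈ orthogonalUnits 4 :=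
  mul_mem (mul_mem (mul_mem (zpow_mem (h.unit_mem _) _) (zpow_mem (h.unit_mem _) _))
    (zpow_mem (h.unit_mem _) _)) (zpow_mem h.star_mem _)

theorem unitAE3_signComm (p q : Fin 3 → ℤ) (x y : ℤ) (hx : p 0 + p 1 + p 2 = 2 * x)
    (hy : q 0 + q 1 + q 2 = 2 * y) :
    SignComm (h.unitAE3 p) (h.unitAE3 q) (p 0 * q 0 + p 1 * q 1 + p 2 * q 2 - 2 * (x * y)) := by
  have s : ∀ (i j : Fin 4) (a b : ℤ),
      SignComm (h.unit i ^ a) (h.unit j ^ b) ((if i = j then 0 else 1) * a * b) :=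
    fun i j a b => ((h.unit_signComm i j).zpow_left a).zpow_right b
  have t : ∀ (i : Fin 4) (a b : ℤ), SignComm (h.unit i ^ a) (h.star ^ b) (3 * a * b) :=
    fun i a b => ((h.unit_star i).zpow_left a).zpow_right b
  have t' : ∀ (i : Fin 4) (a b : ℤ), SignComm (h.star ^ b) (h.unit i ^ a) (3 * a * b) :=
    fun i a b => (t i a b).symm
  have r : ∀ a b : ℤ, SignComm (h.star ^ a) (h.star ^ b) (0 * a * b) :=
    fun a b => ((SignComm.self _).zpow_left a).zpow_right b
  unfold unitAE3
  rw [hx, hy, Int.mul_ediv_cancel_left _ two_ne_zero, Int.mul_ediv_cancel_left _ two_ne_zero]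
  refine SignComm.congr
    ((((((s 1 1 _ _).mul_left (s 2 1 _ _)).mul_left (s 3 1 _ _)).mul_left (t' 1 _ _)).mul_right
    ((((s 1 2 _ _).mul_left (s 2 2 _ _)).mul_left (s 3 2 _ _)).mul_left (t' 2 _ _))).mul_right
    ((((s 1 3 _ _).mul_left (s 2 3 _ _)).mul_left (s 3 3 _ _)).mul_left (t' 3 _ _)) |>.mul_right
    ((((t 1 _ _).mul_left (t 2 _ _)).mul_left (t 3 _ _)).mul_left (r _ _))) ?_
  have e2 : p 2 = 2 * x - p 0 - p 1 := by linarith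
  have f2 : q 2 = 2 * y - q 0 - q 1 := by linarith
  -- The collected exponent is the sum of p_a q_b over a ≠ b, which is 4xy − ∑ p_a q_a, plus 12xy
  -- from Γ_*. Its difference from α·β = ∑ p_a q_a − 2xy is twice this witness.
  refine ⟨9 * (x * y) - (p 0 * q 0 + p 1 * q 1 + p 2 * q 2), ?_⟩
  simp only [Fin.reduceEq, if_true, if_false, e2, f2]
  ring

theorem unitAE3_sq (p : Fin 3 → ℤ) (x : ℤ) (hx : p 0 + p 1 + p 2 = 2 * x) :
    h.unitAE3 p * h.unitAE3 p = (-1) ^ (x * x - (p 0 * p 1 + p 0 * p 2 + p 1 * p 2)) := by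
  have s : ∀ (i j : Fin 4) (a b : ℤ),
      SignComm (h.unit i ^ a) (h.unit j ^ b) ((if i = j then 0 else 1) * a * b) :=
    fun i j a b => ((h.unit_signComm i j).zpow_left a).zpow_right b
  have t : ∀ (i : Fin 4) (a b : ℤ), SignComm (h.unit i ^ a) (h.star ^ b) (3 * a * b) :=
    fun i a b => ((h.unit_star i).zpow_left a).zpow_right b
  have q := fun i a => sq_zpow (h.unit_sq i) a
  have h2 := (s 1 2 (p 0) (p 1)).sq_mul (q 1 _) (q 2 _)
  have h3 := ((s 1 3 _ (p 2)).mul_left (s 2 3 _ _)).sq_mul h2 (q 3 _)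
  have h4 := (((t 1 _ x).mul_left (t 2 _ _)).mul_left (t 3 _ _)).sq_mul h3
    (sq_zpow h.star_sq_three x)
  unfold unitAE3
  rw [hx, Int.mul_ediv_cancel_left _ two_ne_zero, h4]
  refine neg_one_zpow_congr ?_
  -- The powers of Γ_* contribute x from Γ_*² = −1 and 6x² from exchanges; parity against ½ α·α then
  -- requires x² + x to be even.
  obtain ⟨k, hk⟩ := Int.even_mul_succ_self x
  have e2 : p 2 = 2 * x - p 0 - p 1 := by linarith
  refine ⟨p 0 * p 1 + p 0 * p 2 + p 1 * p 2 + 2 * (x * x) + k, ?_⟩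
  simp only [Fin.reduceEq, if_false, e2]
  linear_combination hk

theorem cast_inner_three (p q : Fin 3 → ℤ) (x y : ℤ) (hx : p 0 + p 1 + p 2 = 2 * x)
    (hy : q 0 + q 1 + q 2 = 2 * y) :
    ((p 0 * q 0 + p 1 * q 1 + p 2 * q 2 - 2 * (x * y) : ℤ) : ℝ) =
      rootInner (deWitt 3) (toReal p) (toReal q) := by
  rw [rootInner_deWitt, Fin.sum_univ_three, Fin.sum_univ_three, Fin.sum_univ_three, hx, hy]
  push_cast
  ring

include h in
/-- The relations of the matrices `Γ(α)` on the root lattice. -/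
theorem gammaRelations_AE3 : GammaRelations (deWitt 3)
    (fun c : Fin 3 → ℤ => toReal (∑ i, c i • rootAE3 i))
    (fun c : Fin 3 → ℤ => gammaAE3 Γ (∑ i, c i • rootAE3 i)) := by
  have hx : ∀ c : Fin 3 → ℤ, (∑ i, c i • rootAE3 i) 0 + (∑ i, c i • rootAE3 i) 1 +
      (∑ i, c i • rootAE3 i) 2 = 2 * c 2 := by
    intro c
    simp [Fin.sum_univ_three, rootAE3]
    ring
  have := gammaRelations_of_units (G := deWitt 3)
    (α := fun c : Fin 3 → ℤ => toReal (∑ i, c i • rootAE3 i))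
    (fun c => h.unitAE3 (∑ i, c i • rootAE3 i)) (fun c => h.unitAE3_mem _) _ (fun c c' => ?_) _
    (fun c => ?_) (fun c c' => h.unitAE3_signComm _ _ _ _ (hx c) (hx c'))
    (fun c => h.unitAE3_sq _ _ (hx c))
  · simpa only [coe_unitAE3] using this
  · exact cast_inner_three _ _ _ _ (hx c) (hx c')
  · have := hx c
    have e2 : (∑ i, c i • rootAE3 i) 2 =
        2 * c 2 - (∑ i, c i • rootAE3 i) 0 - (∑ i, c i • rootAE3 i) 1 := by linarith
    rw [e2]
    ring

include h in
theorem gammaAE3_simple : gammaAE3 Γ (rootAE3 0) = Γ 1 * Γ 2 ∧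
    gammaAE3 Γ (rootAE3 1) = Γ 2 * Γ 3 ∧ gammaAE3 Γ (rootAE3 2) = gammaStar Γ := by
  -- Spatial gamma matrices are their own inverses, so negative exponents of simple roots are
  -- harmless.
  have hinv : ∀ i : Fin 3, (h.unit i.succ)⁻¹ = h.unit i.succ := fun i => by
    rw [inv_eq_iff_mul_eq_one, h.unit_sq, if_neg (Fin.succ_ne_zero i), zpow_zero]
  have h2 : h.unit 3 * h.unit 3 = 1 := by
    rw [h.unit_sq, if_neg (by decide), zpow_zero]
  refine ⟨?_, ?_, ?_⟩
  · rw [← h.coe_unitAE3]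
    have : h.unitAE3 (rootAE3 0) = h.unit 1 * h.unit 2 := by
      simpa [unitAE3, rootAE3] using hinv 1
    rw [this]
    rfl
  · rw [← h.coe_unitAE3]
    have : h.unitAE3 (rootAE3 1) = h.unit 2 * h.unit 3 := by
      simpa [unitAE3, rootAE3] using hinv 2
    rw [this]
    rfl
  · rw [← h.coe_unitAE3, ← h.coe_star]
    congr 1
    simp [unitAE3, rootAE3, zpow_ofNat, pow_two, h2]

include h in
theorem isGammaSol_AE3 : IsGammaSol cartanAE3 fun i => gammaAE3 Γ (rootAE3 i) := by
  have h1 := h.gammaRelations_AE3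
  have h2 : GammaRelations (deWitt 3) (fun i => toReal (rootAE3 i))
      (fun i => gammaAE3 Γ (rootAE3 i)) := by
    have hc : ∀ i : Fin 3, ∑ j, (Pi.single i 1 : Fin 3 → ℤ) j • rootAE3 j = rootAE3 i := fun i => by
      simp [Pi.single_apply]
    exact ⟨fun i j => by simpa only [hc] using h1.1 (Pi.single i 1) (Pi.single j 1),
      fun i => by simpa only [hc] using h1.2 (Pi.single i 1)⟩
  exact h2.isGammaSol (fun _ => 1) (fun _ => odd_one) (by decide)
    fun i j => by rw [rootInner_AE3]; simp

end IsGamma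
end AE3

/-! ### The gamma matrices of the simple roots of G₂⁺⁺ -/

section G2pp

theorem rootInner_G2pp (i j : Fin 4) : rootInner ((3 : ℝ) • deWitt 4) (toReal (rootG2pp i))
    (toReal (rootG2pp j)) = ((![3, 3, 3, 1] : Fin 4 → ℤ) i : ℝ) * (cartanG2pp i j : ℝ) := by
  have h : 3 * ∑ a, rootG2pp i a * rootG2pp j a - (∑ a, rootG2pp i a) * (∑ a, rootG2pp j a) =
      (![3, 3, 3, 1] : Fin 4 → ℤ) i * cartanG2pp i j := by
    revert i j
    decide
  rw [← Int.cast_mul, ← h]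
  have h3 : rootInner ((3 : ℝ) • deWitt 4) (toReal (rootG2pp i)) (toReal (rootG2pp j)) =
      3 * rootInner (deWitt 4) (toReal (rootG2pp i)) (toReal (rootG2pp j)) := by
    rw [rootInner, rootInner, Matrix.smul_mulVec, dotProduct_smul, smul_eq_mul]
  rw [h3, rootInner_deWitt, Int.cast_sub, Int.cast_mul, Int.cast_mul]
  norm_num
  ring

variable {Γ : Fin 5 → Matrix (Fin 8) (Fin 8) ℝ} (h : IsGamma Γ)

namespace IsGamma

theorem star_sq_four : h.star * h.star = (-1) ^ (1 : ℤ) := by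
  have e : h.star = h.unit 0 * h.unit 1 * h.unit 2 * h.unit 3 * h.unit 4 := by
    simp [IsGamma.star, List.ofFn_succ, mul_assoc]
  have s := h.unit_signComm
  have q := h.unit_sq
  have h2 := (s 0 1).sq_mul (q 0) (q 1)
  have h3 := ((s 0 2).mul_left (s 1 2)).sq_mul h2 (q 2)
  have h4 := (((s 0 3).mul_left (s 1 3)).mul_left (s 2 3)).sq_mul h3 (q 3)
  have h5 := ((((s 0 4).mul_left (s 1 4)).mul_left (s 2 4)).mul_left (s 3 4)).sq_mul h4 (q 4)
  rw [e, h5]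
  exact neg_one_zpow_congr (by decide)

/-- The spatial gamma matrices and `Γ_*`. -/
def unitG2pp : Fin 5 → (Matrix (Fin 8) (Fin 8) ℝ)ˣ :=
  Fin.snoc (fun i : Fin 4 => h.unit i.succ) h.star

/-- For d = 4, which is even, Γ_* commutes with all gamma matrices. -/
theorem unitG2pp_signComm (i j : Fin 5) : SignComm (h.unitG2pp i) (h.unitG2pp j)
    (if i = j ∨ i = Fin.last 4 ∨ j = Fin.last 4 then 0 else 1) := by
  induction i using Fin.lastCases with
  | last =>
    induction j using Fin.lastCases with
    | last => exact SignComm.self _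
    | cast j =>
      rw [if_pos (Or.inr (Or.inl rfl))]
      simp only [unitG2pp, Fin.snoc_last, Fin.snoc_castSucc]
      exact (h.unit_star _).symm.congr (by decide)
  | cast i =>
    induction j using Fin.lastCases with
    | last =>
      rw [if_pos (Or.inr (Or.inr rfl))]
      simp only [unitG2pp, Fin.snoc_last, Fin.snoc_castSucc]
      exact (h.unit_star _).congr (by decide)
    | cast j =>
      simp only [unitG2pp, Fin.snoc_castSucc]
      refine (h.unit_signComm _ _).congr ?_
      revert i j
      decide

theorem unitG2pp_sq (i : Fin 5) :
    h.unitG2pp i * h.unitG2pp i = (-1) ^ (if i = Fin.last 4 then 1 else 0 : ℤ) := by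
  induction i using Fin.lastCases with
  | last =>
    simp only [unitG2pp, Fin.snoc_last]
    exact h.star_sq_four
  | cast i =>
    simp only [unitG2pp, Fin.snoc_castSucc]
    rw [h.unit_sq, if_neg (Fin.succ_ne_zero i), if_neg (Fin.castSucc_lt_last i).ne]

theorem unitG2pp_mem (i : Fin 5) : h.unitG2pp i ∈ orthogonalUnits 8 := by
  induction i using Fin.lastCases with
  | last =>
    simp only [unitG2pp, Fin.snoc_last]
    exact h.star_mem
  | cast i =>
    simp only [unitG2pp, Fin.snoc_castSucc]
    exact h.unit_mem _

-- With Γ_* listed after Γ_4, the four matrices are products of consecutive members of one list, and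
-- all signs become a finite parity check.
include h in
theorem gammaRelations_G2pp : GammaRelations ((3 : ℝ) • deWitt 4)
    (fun i => toReal (rootG2pp i)) (gammaG2pp Γ) := by
  have := gammaRelations_of_units (G := (3 : ℝ) • deWitt 4) (α := fun i => toReal (rootG2pp i))
    (fun i : Fin 4 => h.unitG2pp i.castSucc * h.unitG2pp i.succ)
    (fun i => mul_mem (h.unitG2pp_mem _) (h.unitG2pp_mem _))
    (fun i j => (![3, 3, 3, 1] : Fin 4 → ℤ) i * cartanG2pp i j)
    (fun i j => by rw [rootInner_G2pp, Int.cast_mul]) (![3, 3, 3, 1] : Fin 4 → ℤ) (by decide)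
    (fun i j => (((h.unitG2pp_signComm _ _).mul_left (h.unitG2pp_signComm _ _)).mul_right
      ((h.unitG2pp_signComm _ _).mul_left (h.unitG2pp_signComm _ _))).congr
        (by revert i j; decide))
    (fun i => ((h.unitG2pp_signComm _ _).sq_mul (h.unitG2pp_sq _) (h.unitG2pp_sq _)).trans
      (neg_one_zpow_congr (by revert i; decide)))
  have e : (fun i : Fin 4 => ((h.unitG2pp i.castSucc * h.unitG2pp i.succ :
      (Matrix (Fin 8) (Fin 8) ℝ)ˣ) : Matrix (Fin 8) (Fin 8) ℝ)) = gammaG2pp Γ := by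
    funext i
    have hs : ((h.unitG2pp 4 : (Matrix (Fin 8) (Fin 8) ℝ)ˣ) : Matrix (Fin 8) (Fin 8) ℝ) =
      gammaStar Γ := h.coe_star
    fin_cases i
    · rfl
    · rfl
    · rfl
    · change Γ 4 * ((h.unitG2pp 4 : (Matrix (Fin 8) (Fin 8) ℝ)ˣ) : Matrix (Fin 8) (Fin 8) ℝ) = _
      rw [hs]
      rfl
  rwa [e] at this

include h in
theorem isGammaSol_G2pp : IsGammaSol cartanG2pp (gammaG2pp Γ) :=
  h.gammaRelations_G2pp.isGammaSol _ (by decide) (by decide) rootInner_G2pp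

end IsGamma
end G2pp

/-! ### Spin 1/2 -/

/-- Spin 1/2 is a scalar polarisation c = ±1/4: commutators vanish and the anticommutator is
multiplication by 2c = ±1/2, a root of both 4t² − 1 and 16t⁴ − 40t² + 9. -/
theorem isPolSol_spin12 {n : ℕ} (A : Matrix (Fin n) (Fin n) ℤ) (c : ℝ) (hc : 16 * (c * c) = 1) :
    IsPolSol A 1 fun _ => c := by
  constructor
  · intros
    rw [lie_self]
  · intros
    linear_combination c * hc
  · intros
    simp
  · intro i j _ _ D hD
    simp only [hD]
    linear_combination (16 * c * (c * c) - 9 * c) * hc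

theorem definesRep_spin12 {n N : ℕ} {A : Matrix (Fin n) (Fin n) ℤ} (hA : IsSmallCartan A)
    {g : Fin n → Matrix (Fin N) (Fin N) ℝ} (hg : IsGammaSol A g) :
    DefinesRep A fun i => (1 / 2 : ℝ) • g i := by
  refine BermanRelations.definesRep hA ?_
  have := bermanRelations_of_sol hA (isPolSol_spin12 A (1 / 4) (by norm_num)) hg
    (Algebra.ofId ℝ (Matrix (Fin N) (Fin N) ℝ)) (AlgHom.id ℝ _) (fun u v => Algebra.commutes _ _) 2
    (by norm_num)
  convert this using 2 with i
  rw [AlgHom.id_apply, Algebra.ofId_apply, ← Algebra.smul_def, smul_smul]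
  norm_num

/-! ### Existence of gamma matrices -/

/-- Gamma matrices with integral entries. -/
theorem isGamma_of_int {d N : ℕ} (Γ : Fin (d + 1) → Matrix (Fin N) (Fin N) ℤ)
    (hc : ∀ μ ν, Γ μ * Γ ν + Γ ν * Γ μ = if μ = ν then (2 * if μ = 0 then -1 else 1 : ℤ) • 1 else 0)
    (ht : ∀ μ, (Γ μ)ᵀ = (if μ = 0 then -1 else 1 : ℤ) • Γ μ) :
    IsGamma fun μ => (Int.castRingHom ℝ).mapMatrix (Γ μ) := by
  have hs : ∀ (c : ℤ) (Y : Matrix (Fin N) (Fin N) ℤ),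
      (Int.castRingHom ℝ).mapMatrix (c • Y) = (c : ℝ) • (Int.castRingHom ℝ).mapMatrix Y :=
    fun c Y => by
      ext a b
      exact Int.cast_mul c (Y a b)
  constructor
  · intro μ ν
    rw [← map_mul, ← map_mul, ← map_add, hc, apply_ite (Int.castRingHom ℝ).mapMatrix, hs, map_one,
      map_zero]
    unfold η
    push_cast
    rfl
  · intro μ
    have := congrArg (Int.castRingHom ℝ).mapMatrix (ht μ)
    rw [hs] at this
    unfold η
    push_cast at this
    exact this

/-- With ε = iσ₂ real, the matrices are 1⊗ε, 1⊗σ₁, σ₁⊗σ₃, σ₃⊗σ₃. -/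
theorem exists_isGamma_three : ∃ Γ : Fin 4 → Matrix (Fin 4) (Fin 4) ℝ, IsGamma Γ :=
  ⟨_, isGamma_of_int ![
    !![0, 1, 0, 0; -1, 0, 0, 0; 0, 0, 0, 1; 0, 0, -1, 0],
    !![0, 1, 0, 0; 1, 0, 0, 0; 0, 0, 0, 1; 0, 0, 1, 0],
    !![0, 0, 1, 0; 0, 0, 0, -1; 1, 0, 0, 0; 0, -1, 0, 0],
    !![1, 0, 0, 0; 0, -1, 0, 0; 0, 0, -1, 0; 0, 0, 0, 1]] (by decide) (by decide)⟩

/-- The previous four matrices tensored with 1 on the left, together with the symmetric matrix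
ε⊗ε⊗σ₃. -/
theorem exists_isGamma_four : ∃ Γ : Fin 5 → Matrix (Fin 8) (Fin 8) ℝ, IsGamma Γ :=
  ⟨_, isGamma_of_int ![
    !![0, 1, 0, 0, 0, 0, 0, 0; -1, 0, 0, 0, 0, 0, 0, 0; 0, 0, 0, 1, 0, 0, 0, 0;
      0, 0, -1, 0, 0, 0, 0, 0; 0, 0, 0, 0, 0, 1, 0, 0; 0, 0, 0, 0, -1, 0, 0, 0;
      0, 0, 0, 0, 0, 0, 0, 1; 0, 0, 0, 0, 0, 0, -1, 0],
    !![0, 1, 0, 0, 0, 0, 0, 0; 1, 0, 0, 0, 0, 0, 0, 0; 0, 0, 0, 1, 0, 0, 0, 0;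
      0, 0, 1, 0, 0, 0, 0, 0; 0, 0, 0, 0, 0, 1, 0, 0; 0, 0, 0, 0, 1, 0, 0, 0;
      0, 0, 0, 0, 0, 0, 0, 1; 0, 0, 0, 0, 0, 0, 1, 0],
    !![0, 0, 1, 0, 0, 0, 0, 0; 0, 0, 0, -1, 0, 0, 0, 0; 1, 0, 0, 0, 0, 0, 0, 0;
      0, -1, 0, 0, 0, 0, 0, 0; 0, 0, 0, 0, 0, 0, 1, 0; 0, 0, 0, 0, 0, 0, 0, -1;
      0, 0, 0, 0, 1, 0, 0, 0; 0, 0, 0, 0, 0, -1, 0, 0],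
    !![1, 0, 0, 0, 0, 0, 0, 0; 0, -1, 0, 0, 0, 0, 0, 0; 0, 0, -1, 0, 0, 0, 0, 0;
      0, 0, 0, 1, 0, 0, 0, 0; 0, 0, 0, 0, 1, 0, 0, 0; 0, 0, 0, 0, 0, -1, 0, 0;
      0, 0, 0, 0, 0, 0, -1, 0; 0, 0, 0, 0, 0, 0, 0, 1],
    !![0, 0, 0, 0, 0, 0, 1, 0; 0, 0, 0, 0, 0, 0, 0, -1; 0, 0, 0, 0, -1, 0, 0, 0;
      0, 0, 0, 0, 0, 1, 0, 0; 0, 0, -1, 0, 0, 0, 0, 0; 0, 0, 0, 1, 0, 0, 0, 0;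
      1, 0, 0, 0, 0, 0, 0, 0; 0, -1, 0, 0, 0, 0, 0, 0]] (by decide +kernel) (by decide +kernel)⟩


/-! ### Second quantisation -/

section quad

variable {I : Type*} [Fintype I] {𝒜 : Type*} [Ring 𝒜] [Algebra ℝ 𝒜] (ψ : I → 𝒜)

/-- Quadratic expressions in the fermions. -/
def quad : Matrix I I ℝ →ₗ[ℝ] 𝒜 where
  toFun S := ∑ A, ∑ B, S A B • (ψ A * ψ B)
  map_add' S S' := by simp [add_smul, Finset.sum_add_distrib]
  map_smul' c S := by simp [smul_smul, Finset.smul_sum]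

theorem quad_apply (S : Matrix I I ℝ) : quad ψ S = ∑ A, ∑ B, S A B • (ψ A * ψ B) := rfl

/-- Lie brackets of matrices of the form `2 S g`. -/
theorem lie_two_smul_mul (g S S' : Matrix I I ℝ) : ⁅(2 : ℝ) • (S * g), (2 : ℝ) • (S' * g)⁆ =
    (2 : ℝ) • ((2 : ℝ) • (S * g * S' - S' * g * S) * g) := by
  simp only [Ring.lie_def, smul_mul_assoc, mul_smul_comm, smul_smul, sub_mul, mul_assoc,
    smul_sub]

variable {ψ} {g : Matrix I I ℝ} (hψ : ∀ A B, ψ A * ψ B + ψ B * ψ A = algebraMap ℝ 𝒜 (g A B))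

include hψ

/-- A product of two fermions acts on a third by two anticommutators; antisymmetry makes the two
contributions equal, whence the factor 2. -/
theorem quad_lie_apply (S : Matrix I I ℝ) (hS : Sᵀ = -S) (C : I) :
    ⁅quad ψ S, ψ C⁆ = ∑ A, ((2 : ℝ) • (S * g)) A C • ψ A := by
  have h1 : ∀ A B, ⁅ψ A * ψ B, ψ C⁆ = g B C • ψ A - g A C • ψ B := by
    intro A B
    rw [Algebra.smul_def, Algebra.smul_def, Algebra.commutes (g B C), ← hψ, ← hψ, Ring.lie_def]
    noncomm_ring
  have h2 : ∀ A B, S B A = -S A B := fun A B => congrFun (congrFun hS A) B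
  simp only [quad_apply, LieRing.of_associative_ring_bracket] at h1 ⊢
  have h3 : (∑ A, ∑ B, S A B • (ψ A * ψ B)) * ψ C - ψ C * (∑ A, ∑ B, S A B • (ψ A * ψ B)) =
      ∑ A, ∑ B, S A B • (g B C • ψ A - g A C • ψ B) := by
    simp only [← h1, Finset.sum_mul, Finset.mul_sum, ← Finset.sum_sub_distrib, smul_sub,
      smul_mul_assoc, mul_smul_comm]
  rw [h3]
  simp only [smul_sub, Finset.sum_sub_distrib]
  have h4 : ∑ A, ∑ B, S A B • g A C • ψ B = -∑ A, ∑ B, S A B • g B C • ψ A := by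
    rw [Finset.sum_comm]
    simp only [← Finset.sum_neg_distrib]
    refine Finset.sum_congr rfl fun A _ => Finset.sum_congr rfl fun B _ => ?_
    rw [h2, neg_smul]
  rw [h4, sub_neg_eq_add, ← Finset.sum_add_distrib]
  refine Finset.sum_congr rfl fun A _ => ?_
  simp only [Matrix.smul_apply, Matrix.mul_apply, smul_eq_mul, smul_smul, ← Finset.sum_smul,
    ← add_smul, two_mul]

/-- The bracket with `quad ψ S` is a derivation acting linearly on the ψ by T = 2Sg, so it sends S'
to T S' + S' Tᵀ. -/
theorem quad_lie_quad (hg : gᵀ = g) (S S' : Matrix I I ℝ) (hS : Sᵀ = -S) :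
    ⁅quad ψ S, quad ψ S'⁆ = quad ψ ((2 : ℝ) • (S * g * S' - S' * g * S)) := by
  have h1 := quad_lie_apply hψ S hS
  set T := (2 : ℝ) • (S * g) with hT
  have h2 : ∀ C D, ⁅quad ψ S, ψ C * ψ D⁆ =
      (∑ A, T A C • (ψ A * ψ D)) + ∑ A, T A D • (ψ C * ψ A) := by
    intro C D
    have : ⁅quad ψ S, ψ C * ψ D⁆ = ⁅quad ψ S, ψ C⁆ * ψ D + ψ C * ⁅quad ψ S, ψ D⁆ := by
      simp only [Ring.lie_def]
      noncomm_ring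
    rw [this, h1, h1, Finset.sum_mul, Finset.mul_sum]
    simp only [smul_mul_assoc, mul_smul_comm]
  have h3 : (2 : ℝ) • (S * g * S' - S' * g * S) = T * S' + S' * Tᵀ := by
    rw [hT, Matrix.transpose_smul, Matrix.transpose_mul, hg, hS]
    simp only [Matrix.mul_neg, Matrix.mul_smul, Matrix.smul_mul, smul_neg, smul_add, mul_assoc,
      sub_eq_add_neg]
  rw [h3, map_add, quad_apply ψ S', lie_sum]
  simp only [lie_sum, lie_smul, h2, smul_add, Finset.sum_add_distrib]
  congr 1
  · simp only [quad_apply, Matrix.mul_apply, Finset.sum_smul, Finset.smul_sum, smul_smul]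
    rw [Finset.sum_congr rfl fun C _ => Finset.sum_comm, Finset.sum_comm]
    refine Finset.sum_congr rfl fun A _ => ?_
    rw [Finset.sum_comm]
    exact Finset.sum_congr rfl fun D _ => Finset.sum_congr rfl fun C _ => by rw [mul_comm]
  · simp only [quad_apply, Matrix.mul_apply, Matrix.transpose_apply, Finset.sum_smul,
      Finset.smul_sum, smul_smul]
    exact Finset.sum_congr rfl fun C _ => Finset.sum_comm

/-- The matrices 2Sg with S antisymmetric form an orthogonal Lie algebra, and 2Sg ↦ `quad ψ S` is a
Lie homomorphism on it; relations among the matrices pass to the fermion bilinears. -/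
theorem bermanRelations_quad [DecidableEq I] (hg : gᵀ = g) (gi : Matrix I I ℝ) (hgi : g * gi = 1)
    {n : ℕ} {A : Matrix (Fin n) (Fin n) ℤ} (S : Fin n → Matrix I I ℝ) (hS : ∀ i, (S i)ᵀ = -S i)
    (hT : BermanRelations A fun i => (2 : ℝ) • (S i * g)) :
    BermanRelations A fun i => quad ψ (S i) := by
  let L : LieSubalgebra ℝ (Matrix I I ℝ) :=
    { carrier := {T | ∃ S : Matrix I I ℝ, Sᵀ = -S ∧ T = (2 : ℝ) • (S * g)}
      add_mem' := by
        rintro _ _ ⟨S, hS, rfl⟩ ⟨S', hS', rfl⟩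
        exact ⟨S + S', by rw [Matrix.transpose_add, hS, hS', neg_add], by rw [add_mul, smul_add]⟩
      zero_mem' := ⟨0, by simp, by simp⟩
      smul_mem' := by
        rintro c _ ⟨S, hS, rfl⟩
        exact ⟨c • S, by rw [Matrix.transpose_smul, hS, smul_neg], by
          rw [smul_mul_assoc, smul_comm]⟩
      lie_mem' := by
        rintro _ _ ⟨S, hS, rfl⟩ ⟨S', hS', rfl⟩
        refine ⟨_, ?_, lie_two_smul_mul g S S'⟩
        rw [Matrix.transpose_smul, Matrix.transpose_sub, Matrix.transpose_mul, Matrix.transpose_mul,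
          Matrix.transpose_mul, Matrix.transpose_mul, hS, hS', hg, ← smul_neg, neg_sub]
        simp only [Matrix.mul_neg, Matrix.neg_mul, neg_neg, mul_assoc] }
  have hinv : ∀ S : Matrix I I ℝ, (1 / 2 : ℝ) • ((2 : ℝ) • (S * g) * gi) = S := fun S => by
    rw [smul_mul_assoc, mul_assoc, hgi, mul_one, smul_smul]
    norm_num
  let τ : L →ₗ⁅ℝ⁆ 𝒜 :=
    { toFun := fun T => quad ψ ((1 / 2 : ℝ) • (T.1 * gi))
      map_add' := fun T T' => by
        rw [← map_add, ← smul_add, ← add_mul]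
        rfl
      map_smul' := fun c T => by
        rw [RingHom.id_apply, ← map_smul, smul_comm c, ← smul_mul_assoc c]
        rfl
      map_lie' := by
        rintro ⟨_, S, hS, rfl⟩ ⟨_, S', hS', rfl⟩
        change quad ψ ((1 / 2 : ℝ) • (⁅(2 : ℝ) • (S * g), (2 : ℝ) • (S' * g)⁆ * gi)) =
          ⁅quad ψ ((1 / 2 : ℝ) • ((2 : ℝ) • (S * g) * gi)),
            quad ψ ((1 / 2 : ℝ) • ((2 : ℝ) • (S' * g) * gi))⁆
        rw [lie_two_smul_mul, hinv, hinv, hinv, quad_lie_quad hψ hg S S' hS] }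
  let y : Fin n → L := fun i => ⟨(2 : ℝ) • (S i * g), S i, hS i, rfl⟩
  have hy : BermanRelations A y := by
    intro i j hij
    refine Subtype.ext ?_
    exact (map_aeval_ad L.incl (y i) (y j) _).trans (hT i j hij)
  have h := hy.map τ
  simp only [show ∀ i, τ (y i) = quad ψ (S i) from fun i => congrArg (quad ψ) (hinv (S i))] at h
  exact h

theorem commute_quad (hg : gᵀ = g) {S S' : Matrix I I ℝ} (hS : Sᵀ = -S)
    (h : S * g * S' = S' * g * S) : Commute (quad ψ S) (quad ψ S') := by
  refine sub_eq_zero.1 ?_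
  rw [← Ring.lie_def, quad_lie_quad hψ hg S S' hS, h, sub_self, smul_zero, map_zero]

/-- A quadratic expression with invertible matrix is not a scalar. -/
theorem quad_notMem_range [DecidableEq I] [Nontrivial 𝒜] {S U : Matrix I I ℝ} (hS : Sᵀ = -S)
    (hU : S * g * U = 1) (C : I) (hC : g C C ≠ 0) :
    quad ψ S ∉ Set.range (algebraMap ℝ 𝒜) := by
  rintro ⟨r, hr⟩
  -- A scalar commutes with each ψ D, so the linear action of S g on the fermions vanishes; as S g
  -- is invertible every ψ is then zero, against ψ C² = ½ g C C ≠ 0.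
  have h1 : ∀ D, ∑ A, (S * g) A D • ψ A = 0 := by
    intro D
    have := quad_lie_apply hψ S hS D
    rw [← hr, Ring.lie_def, Algebra.commutes, sub_self] at this
    have h2 : (2 : ℝ) • ∑ A, (S * g) A D • ψ A = 0 := by
      rw [this, Finset.smul_sum]
      simp only [smul_smul, Matrix.smul_apply, smul_eq_mul]
    exact (smul_eq_zero.1 h2).resolve_left two_ne_zero
  have h3 : ψ C = 0 := by
    calc ψ C = ∑ A, (S * g * U) A C • ψ A := by simp [hU, Matrix.one_apply]
      _ = ∑ D, U D C • ∑ A, (S * g) A D • ψ A := by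
        change ∑ A, (∑ D, (S * g) A D * U D C) • ψ A = _
        simp only [Finset.sum_smul, Finset.smul_sum, smul_smul]
        rw [Finset.sum_comm]
        simp only [mul_comm]
      _ = 0 := by simp [h1]
  have h4 := hψ C C
  rw [h3, mul_zero, add_zero, eq_comm, map_eq_zero_iff _ (algebraMap ℝ 𝒜).injective] at h4
  exact hC h4

end quad

section kronecker

variable {m k : Type*} [Fintype m] [DecidableEq m] [Fintype k] [DecidableEq k]

open scoped Kronecker

/-- `X ↦ X ⊗ 1`. -/
def kronLeft : Matrix m m ℝ →ₐ[ℝ] Matrix (m × k) (m × k) ℝ :=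
  AlgHom.ofLinearMap
    { toFun := fun X => X ⊗ₖ 1
      map_add' := fun X Y => Matrix.add_kronecker X Y 1
      map_smul' := fun c X => Matrix.smul_kronecker c X 1 }
    (Matrix.one_kronecker_one)
    (fun X Y => by
      change (X * Y) ⊗ₖ (1 : Matrix k k ℝ) = X ⊗ₖ 1 * Y ⊗ₖ 1
      rw [← Matrix.mul_kronecker_mul, one_mul])

/-- `M ↦ 1 ⊗ M`. -/
def kronRight : Matrix k k ℝ →ₐ[ℝ] Matrix (m × k) (m × k) ℝ :=
  AlgHom.ofLinearMap
    { toFun := fun M => 1 ⊗ₖ M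
      map_add' := fun X Y => Matrix.kronecker_add 1 X Y
      map_smul' := fun c X => Matrix.kronecker_smul c 1 X }
    (Matrix.one_kronecker_one)
    (fun X Y => by
      change (1 : Matrix m m ℝ) ⊗ₖ (X * Y) = 1 ⊗ₖ X * 1 ⊗ₖ Y
      rw [← Matrix.mul_kronecker_mul, one_mul])

theorem kronLeft_mul_kronRight (X : Matrix m m ℝ) (M : Matrix k k ℝ) :
    kronLeft X * kronRight M = X ⊗ₖ M := by
  change X ⊗ₖ 1 * 1 ⊗ₖ M = _
  rw [← Matrix.mul_kronecker_mul, one_mul, mul_one]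

theorem kronRight_mul_kronLeft (X : Matrix m m ℝ) (M : Matrix k k ℝ) :
    kronRight M * kronLeft X = X ⊗ₖ M := by
  change 1 ⊗ₖ M * X ⊗ₖ 1 = _
  rw [← Matrix.mul_kronecker_mul, one_mul, mul_one]

end kronecker

theorem commute_of_generators {n : ℕ} {A : Matrix (Fin n) (Fin n) ℤ} {ℬ : Type*} [Ring ℬ]
    [Algebra ℝ ℬ] (ρ : K A →ₗ⁅ℝ⁆ ℬ) (z : ℬ) (h : ∀ i, Commute z (ρ (x A i))) (k : K A) :
    Commute z (ρ k) := by
  have hk : k ∈ LieSubalgebra.lieSpan ℝ (K A) (Set.range (x A)) := by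
    rw [K_lieSpan]; exact Set.mem_univ k
  induction hk using LieSubalgebra.lieSpan_induction with
  | mem w hw => obtain ⟨i, rfl⟩ := hw; exact h i
  | zero => rw [map_zero]; exact Commute.zero_right z
  | add a b _ _ ha hb => rw [map_add]; exact ha.add_right hb
  | smul c a _ ha => rw [map_smul]; exact ha.smul_right c
  | lie a b _ _ ha hb =>
    rw [LieHom.map_lie, Ring.lie_def]
    exact (ha.mul_right hb).sub_right (hb.mul_right ha)

open scoped Kronecker

/-! ### Fermions with the DeWitt metric -/

section car

variable {n N : ℕ} {𝒜 : Type*} [Ring 𝒜] [Algebra ℝ 𝒜] {φ : Fin n → Fin N → 𝒜}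

theorem bilinearOp_eq_quad (φ : Fin n → Fin N → 𝒜) (X : Matrix (Fin n) (Fin n) ℝ)
    (M : Matrix (Fin N) (Fin N) ℝ) :
    bilinearOp φ X M = quad (fun A : Fin n × Fin N => φ A.1 A.2) (X ⊗ₖ M) := by
  simp only [bilinearOp, quad_apply, Fintype.sum_prod_type, Matrix.kroneckerMap_apply]
  exact Finset.sum_congr rfl fun a _ => Finset.sum_comm

theorem IsCAR.anticomm (h : IsCAR φ) (A B : Fin n × Fin N) :
    φ A.1 A.2 * φ B.1 B.2 + φ B.1 B.2 * φ A.1 A.2 =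
      algebraMap ℝ 𝒜 ((deWitt n ⊗ₖ (1 : Matrix (Fin N) (Fin N) ℝ)) A B) := by
  rw [h, Matrix.kroneckerMap_apply, δ, Matrix.one_apply]

theorem deWitt_transpose : (deWitt n)ᵀ = deWitt n := by
  ext a b
  simp [deWitt, eq_comm]

/-- Raising the second index turns the form appearing in the bilinears into the spin 3/2
polarisation tensor, so its solution of the relations can be reused. -/
theorem X32low_mul (hn : deWitt n * (deWitt n)⁻¹ = 1) (α : Fin n → ℝ) :
    X32low α * deWitt n = Matrix.of fun a b => -(1 / 2) * (α a * up α b) + 1 / 4 * δ a b := by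
  have h1 : X32low α = (-(1 / 2) : ℝ) • Matrix.vecMulVec α α + (1 / 4 : ℝ) • (deWitt n)⁻¹ := rfl
  have h2 : α ᵥ* deWitt n = up α := by
    rw [up, ← Matrix.vecMul_transpose, deWitt_transpose]
  rw [h1, add_mul, smul_mul_assoc, smul_mul_assoc, Matrix.vecMulVec_mul, h2,
    mul_eq_one_comm.1 hn]
  ext a b
  simp [Matrix.vecMulVec_apply, Matrix.one_apply, δ]

end car

theorem isPolSol_X32low : IsPolSol cartanAE3 1 fun i => X32low (toReal (rootAE3 i)) * deWitt 3 := by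
  have h := isPolSol_AE3_spin32.map_inv (Int.castRingHom ℝ).mapMatrix 4 (by norm_num) (by
    rw [RingHom.mapMatrix_apply, Matrix.scalar_apply, Matrix.algebraMap_eq_diagonal,
      Matrix.diagonal_map (map_zero _)]
    rfl)
  convert h using 2 with i
  rw [X32low_mul deWitt_three_mul_inv, up_rootAE3]
  have h2 : (symIndexOne 3).reduced (tensor32 (-2) 1 (rootAE3 i) (upAE3 i)) =
      Matrix.of fun a b => -2 * (rootAE3 i a * upAE3 i b) + if a = b then 1 else 0 := by
    revert i
    decide +kernel
  ext a b
  rw [h2]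
  simp only [toReal, δ_eq_cast, Matrix.of_apply, Matrix.smul_apply, RingHom.mapMatrix_apply,
    Matrix.map_apply, smul_eq_mul, eq_intCast]
  push_cast
  ring

section AE3

variable {𝒜 : Type*} [Ring 𝒜] [Algebra ℝ 𝒜] {φ : Fin 3 → Fin 4 → 𝒜} (hφ : IsCAR φ)
  {Γ : Fin 4 → Matrix (Fin 4) (Fin 4) ℝ} (h : IsGamma Γ)

theorem transpose_kronecker_X32low {N : ℕ} {n : ℕ} (α : Fin n → ℝ) {M : Matrix (Fin N) (Fin N) ℝ}
    (hM : Mᵀ = -M) : (X32low α ⊗ₖ M)ᵀ = -(X32low α ⊗ₖ M) := by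
  have h1 : (X32low α)ᵀ = X32low α := by
    have h2 : ((deWitt n)⁻¹)ᵀ = (deWitt n)⁻¹ := by
      rw [Matrix.transpose_nonsing_inv, deWitt_transpose]
    ext a b
    have h3 : (deWitt n)⁻¹ b a = (deWitt n)⁻¹ a b := congrFun (congrFun h2 a) b
    rw [Matrix.transpose_apply, X32low, X32low, h3, mul_comm (α b)]
  rw [← Matrix.kroneckerMap_transpose, h1, hM]
  ext A B
  simp

theorem transpose_inv_kronecker {N n : ℕ} {M : Matrix (Fin N) (Fin N) ℝ} (hM : Mᵀ = -M) :
    ((deWitt n)⁻¹ ⊗ₖ M)ᵀ = -((deWitt n)⁻¹ ⊗ₖ M) := by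
  rw [← Matrix.kroneckerMap_transpose, Matrix.transpose_nonsing_inv, deWitt_transpose, hM]
  ext A B
  simp

include h in
theorem IsGamma.transpose_simple (i : Fin 3) :
    (gammaAE3 Γ (rootAE3 i))ᵀ = -gammaAE3 Γ (rootAE3 i) := by
  obtain ⟨m, hm, hm', -⟩ := h.gammaRelations_AE3.2 (Pi.single i 1)
  have hc : ∑ j, (Pi.single i 1 : Fin 3 → ℤ) j • rootAE3 j = rootAE3 i := by
    simp [Pi.single_apply]
  simp only [hc] at hm hm'
  have h2 : cartanAE3 i i = 2 := (by decide : ∀ i, cartanAE3 i i = 2) i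
  have : m = 1 := by
    rw [rootInner_AE3, h2] at hm
    have h1 : (m : ℝ) = ((1 : ℤ) : ℝ) := by rw [hm]; norm_num
    exact_mod_cast h1
  rw [hm', this, zpow_one, neg_smul, one_smul]

include h in
theorem IsGamma.commute_gammaStar_simple (i : Fin 3) :
    Commute (gammaStar Γ) (gammaAE3 Γ (rootAE3 i)) := by
  have h2 := h.gammaAE3_simple.2.2
  have h3 := h.isGammaSol_AE3
  rw [← h2]
  rcases (by revert i; decide : i = 2 ∨ (2 ≠ i ∧ (cartanAE3 2 i = 0 ∨ cartanAE3 2 i = -2)))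
    with rfl | ⟨h4, h5⟩
  · exact Commute.refl _
  · exact h3.comm 2 i h4 h5

include hφ h

/-- The action on fermions is 2 (X ⊗ Γ)(G ⊗ 1) = 2 (XG) ⊗ Γ, which is the spin 3/2 solution with
prefactor +2 instead of −2. -/
theorem definesRep_bilinearOp : DefinesRep cartanAE3 fun i =>
    bilinearOp φ (X32low (toReal (rootAE3 i))) (gammaAE3 Γ (rootAE3 i)) := by
  refine BermanRelations.definesRep isSmallCartan_AE3 ?_
  simp only [bilinearOp_eq_quad]
  refine bermanRelations_quad hφ.anticomm ?_ ((deWitt 3)⁻¹ ⊗ₖ 1) ?_ _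
    (fun i => transpose_kronecker_X32low _ (h.transpose_simple i)) ?_
  · rw [← Matrix.kroneckerMap_transpose, deWitt_transpose, Matrix.transpose_one]
  · rw [← Matrix.mul_kronecker_mul, deWitt_three_mul_inv, one_mul, Matrix.one_kronecker_one]
  · have := bermanRelations_of_sol isSmallCartan_AE3 isPolSol_X32low h.isGammaSol_AE3
      (kronLeft (k := Fin 4)) (kronRight (m := Fin 3))
      (fun X M => (kronLeft_mul_kronRight X M).trans (kronRight_mul_kronLeft X M).symm) 2
      (by norm_num)
    convert this using 3 with i
    rw [kronLeft_mul_kronRight, ← Matrix.mul_kronecker_mul, mul_one]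

theorem commute_centralZ (i : Fin 3) : Commute (centralZ φ Γ) (bilinearOp φ
    (X32low (toReal (rootAE3 i))) (gammaAE3 Γ (rootAE3 i))) := by
  have hcomm := h.commute_gammaStar_simple i
  have hst : (gammaStar Γ)ᵀ = -gammaStar Γ := by
    rw [← h.gammaAE3_simple.2.2, h.transpose_simple]
  rw [centralZ, bilinearOp_eq_quad, bilinearOp_eq_quad]
  refine commute_quad hφ.anticomm ?_ (transpose_inv_kronecker hst) ?_
  · rw [← Matrix.kroneckerMap_transpose, deWitt_transpose, Matrix.transpose_one]
  -- The metric cancels its inverse, leaving X ⊗ Γ_*Γ(α) on one side and X ⊗ Γ(α)Γ_* on the other.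
  · rw [← Matrix.mul_kronecker_mul, ← Matrix.mul_kronecker_mul, ← Matrix.mul_kronecker_mul,
      ← Matrix.mul_kronecker_mul, mul_eq_one_comm.1 deWitt_three_mul_inv, one_mul, mul_one, mul_one,
      mul_assoc, deWitt_three_mul_inv, mul_one, hcomm.eq]

theorem centralZ_notMem_range [Nontrivial 𝒜] : centralZ φ Γ ∉ Set.range (algebraMap ℝ 𝒜) := by
  have hst : (gammaStar Γ)ᵀ = -gammaStar Γ := by
    rw [← h.gammaAE3_simple.2.2, h.transpose_simple]
  have hsq : gammaStar Γ * gammaStar Γ = -1 := by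
    rw [← h.gammaAE3_simple.2.2]
    exact h.isGammaSol_AE3.sq 2
  rw [centralZ, bilinearOp_eq_quad]
  refine quad_notMem_range hφ.anticomm (U := 1 ⊗ₖ (-gammaStar Γ)) (transpose_inv_kronecker hst)
    ?_ (0, 0) ?_
  · rw [← Matrix.mul_kronecker_mul, ← Matrix.mul_kronecker_mul,
      mul_eq_one_comm.1 deWitt_three_mul_inv, mul_one, mul_one, mul_neg, hsq, neg_neg,
      Matrix.one_kronecker_one]
  · norm_num [Matrix.kroneckerMap_apply, deWitt]

end AE3

/-! ### Existence of the fermions -/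

/-- The Clifford algebra of the form ½ G ⊗ 1: anticommutators are values of the polar form, which
restores the factor 2. -/
theorem exists_isCAR : ∃ (𝒜 : Type) (_ : Ring 𝒜) (_ : Algebra ℝ 𝒜) (φ : Fin 3 → Fin 4 → 𝒜),
    Nontrivial 𝒜 ∧ IsCAR φ := by
  let B : LinearMap.BilinForm ℝ (Fin 3 × Fin 4 → ℝ) :=
    Matrix.toBilin' ((1 / 2 : ℝ) • (deWitt 3 ⊗ₖ (1 : Matrix (Fin 4) (Fin 4) ℝ)))
  let Q : QuadraticForm ℝ (Fin 3 × Fin 4 → ℝ) := LinearMap.BilinMap.toQuadraticMap B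
  refine ⟨CliffordAlgebra Q, inferInstance, inferInstance,
    fun a α => CliffordAlgebra.ι Q (Pi.single (a, α) 1), ?_, fun a b α β => ?_⟩
  · have : Invertible (2 : ℝ) := invertibleOfNonzero two_ne_zero
    infer_instance
  · rw [CliffordAlgebra.ι_mul_ι_add_swap]
    congr 1
    change QuadraticMap.polar (LinearMap.BilinMap.toQuadraticMap B) _ _ = _
    rw [LinearMap.BilinMap.polar_toQuadraticMap]
    simp only [B, Matrix.toBilin'_single, Matrix.smul_apply, Matrix.kroneckerMap_apply, smul_eq_mul]
    have h1 : deWitt 3 b a = deWitt 3 a b := congrFun (congrFun deWitt_transpose a) b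
    rw [h1, Matrix.one_apply, Matrix.one_apply, δ]
    simp only [eq_comm (a := β)]
    ring


/-! ### The image of the spin 1/2 representation -/

section unitary

variable {ℬ : Type*} [Ring ℬ] [Algebra ℝ ℬ]

/-- Two anticommuting imaginary units and a third one commuting with both. -/
structure IsQuaternionic (P Q G : ℬ) : Prop where
  sq_left : P * P = -1
  sq_right : Q * Q = -1
  anti : Q * P = -(P * Q)
  sq_center : G * G = -1
  comm_left : G * P = P * G
  comm_right : G * Q = Q * G

/-- The span of the four units. -/
def quaternionicComb (P Q G : ℬ) (s r b c : ℝ) : ℬ := s • G - r • (P * Q) + b • Q + c • P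

namespace IsQuaternionic

variable {P Q G : ℬ} (h : IsQuaternionic P Q G)

include h

theorem lie_PQ : ⁅P, Q⁆ = (2 : ℝ) • (P * Q) := by
  rw [Ring.lie_def, h.anti, sub_neg_eq_add, two_smul]

theorem lie_mul_left : ⁅P * Q, P⁆ = (2 : ℝ) • Q := by
  rw [Ring.lie_def, mul_assoc, h.anti, mul_neg, ← mul_assoc, h.sq_left, two_smul]
  noncomm_ring

theorem lie_mul_right : ⁅P * Q, Q⁆ = -((2 : ℝ) • P) := by
  rw [Ring.lie_def, ← mul_assoc Q, h.anti, mul_assoc, neg_mul, mul_assoc, h.sq_right, two_smul]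
  noncomm_ring

omit [Algebra ℝ ℬ] in
theorem lie_center_left : ⁅G, P⁆ = 0 := by rw [Ring.lie_def, h.comm_left, sub_self]

omit [Algebra ℝ ℬ] in
theorem lie_center_right : ⁅G, Q⁆ = 0 := by rw [Ring.lie_def, h.comm_right, sub_self]

omit [Algebra ℝ ℬ] in
theorem lie_center_mul : ⁅G, P * Q⁆ = 0 := by
  rw [Ring.lie_def, ← mul_assoc, h.comm_left, mul_assoc, h.comm_right, mul_assoc, sub_self]

theorem lie_comb (s r b c s' r' b' c' : ℝ) :
    ⁅quaternionicComb P Q G s r b c, quaternionicComb P Q G s' r' b' c'⁆ =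
      quaternionicComb P Q G 0 (2 * (b * c' - b' * c)) (2 * (r' * c - r * c'))
        (2 * (r * b' - r' * b)) := by
  have h1 : ⁅Q, P⁆ = -((2 : ℝ) • (P * Q)) := by rw [← lie_skew, h.lie_PQ]
  have h2 : ⁅P, P * Q⁆ = -((2 : ℝ) • Q) := by rw [← lie_skew, h.lie_mul_left]
  have h3 : ⁅Q, P * Q⁆ = (2 : ℝ) • P := by rw [← lie_skew, h.lie_mul_right, neg_neg]
  have h4 : ⁅P, G⁆ = 0 := by rw [← lie_skew, h.lie_center_left, neg_zero]
  have h5 : ⁅Q, G⁆ = 0 := by rw [← lie_skew, h.lie_center_right, neg_zero]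
  have h6 : ⁅P * Q, G⁆ = 0 := by rw [← lie_skew, h.lie_center_mul, neg_zero]
  simp only [quaternionicComb, lie_add, add_lie, lie_sub, sub_lie, lie_smul, smul_lie, lie_self,
    h1, h2, h3, h4, h5, h6, h.lie_PQ, h.lie_mul_left, h.lie_mul_right, h.lie_center_left,
    h.lie_center_right, h.lie_center_mul]
  match_scalars <;> ring

/-- Brackets with P and then Q isolate one coefficient at a time, and an element squaring to −1 is
nonzero in a nontrivial ring. The central coefficient remains at the end. -/
theorem comb_eq_zero [Nontrivial ℬ] {s r b c : ℝ} (h0 : quaternionicComb P Q G s r b c = 0) :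
    s = 0 ∧ r = 0 ∧ b = 0 ∧ c = 0 := by
  have hne : ∀ {U : ℬ}, U * U = -1 → ∀ {t : ℝ}, t • U = 0 → t = 0 := by
    intro U hU t ht
    refine (smul_eq_zero.1 ht).resolve_right fun hz => ?_
    rw [hz, mul_zero, eq_comm, neg_eq_zero] at hU
    exact one_ne_zero hU
  have hP : quaternionicComb P Q G 0 0 0 1 = P := by simp [quaternionicComb]
  have hQ : quaternionicComb P Q G 0 0 1 0 = Q := by simp [quaternionicComb]
  have e1 : ∀ s r b c : ℝ, quaternionicComb P Q G s r b c = 0 →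
      quaternionicComb P Q G 0 (2 * b) (-(2 * r)) 0 = 0 := by
    intro s r b c h0
    have := h.lie_comb s r b c 0 0 0 1
    rw [h0, zero_lie] at this
    rw [this]
    congr 1 <;> ring
  have e2 : ∀ s r b c : ℝ, quaternionicComb P Q G s r b c = 0 →
      quaternionicComb P Q G 0 (-(2 * c)) 0 (2 * r) = 0 := by
    intro s r b c h0
    have := h.lie_comb s r b c 0 0 1 0
    rw [h0, zero_lie] at this
    rw [this]
    congr 1 <;> ring
  have f1 : ∀ s r b c : ℝ, quaternionicComb P Q G s r b c = 0 → b = 0 := by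
    intro s r b c h0
    have := e2 _ _ _ _ (e1 _ _ _ _ h0)
    simp only [quaternionicComb, mul_zero, neg_zero, zero_smul, sub_zero, zero_add] at this
    have := hne h.sq_left this
    linarith
  have f2 : ∀ s r b c : ℝ, quaternionicComb P Q G s r b c = 0 → r = 0 := by
    intro s r b c h0
    have := f1 _ _ _ _ (e1 _ _ _ _ h0)
    linarith
  have f3 : c = 0 := by
    have := f2 _ _ _ _ (e2 _ _ _ _ h0)
    linarith
  have hb := f1 _ _ _ _ h0
  have hr := f2 _ _ _ _ h0
  refine ⟨?_, hr, hb, f3⟩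
  rw [hb, hr, f3] at h0
  simp only [quaternionicComb, zero_smul, sub_zero, add_zero] at h0
  exact hne h.sq_center h0

end IsQuaternionic

theorem mem_unitaryLie_two {M : Matrix (Fin 2) (Fin 2) ℂ} : M ∈ unitaryLie 2 ↔
    (M 0 0).re = 0 ∧ (M 1 1).re = 0 ∧ (M 1 0).re = -(M 0 1).re ∧ (M 1 0).im = (M 0 1).im := by
  change Mᴴ = -M ↔ _
  rw [← Matrix.ext_iff]
  simp only [Fin.forall_fin_two, Matrix.conjTranspose_apply, Matrix.neg_apply, Complex.ext_iff,
    Complex.star_def, Complex.conj_re, Complex.conj_im, Complex.neg_re, Complex.neg_im]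
  constructor
  · rintro ⟨⟨⟨h1, -⟩, h2, h3⟩, -, h4, -⟩
    refine ⟨by linarith, by linarith, by linarith, by linarith⟩
  · rintro ⟨h1, h2, h3, h4⟩
    refine ⟨⟨⟨by linarith, trivial⟩, by linarith, by linarith⟩, ⟨by linarith, by linarith⟩,
      by linarith, trivial⟩

/-- The homomorphism of `𝔲(2)` defined by quaternionic units. -/
def IsQuaternionic.unitaryHom {P Q G : ℬ} (h : IsQuaternionic P Q G) : unitaryLie 2 →ₗ⁅ℝ⁆ ℬ where
  toFun M := quaternionicComb P Q G (((M.1 0 0).im + (M.1 1 1).im) / 2)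
    (((M.1 0 0).im - (M.1 1 1).im) / 2) (M.1 0 1).re (M.1 0 1).im
  map_add' M M' := by
    have e : ∀ i j, (M + M').1 i j = M.1 i j + M'.1 i j := fun i j => rfl
    simp only [quaternionicComb, e, Complex.add_im, Complex.add_re]
    match_scalars <;> ring
  map_smul' t M := by
    have e : ∀ i j, (t • M).1 i j = t • M.1 i j := fun i j => rfl
    simp only [quaternionicComb, e, Complex.smul_im, Complex.smul_re, RingHom.id_apply, smul_eq_mul]
    match_scalars <;> ring
  map_lie' := by
    rintro ⟨M, hM⟩ ⟨M', hM'⟩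
    obtain ⟨h1, h2, h3, h4⟩ := mem_unitaryLie_two.1 hM
    obtain ⟨h1', h2', h3', h4'⟩ := mem_unitaryLie_two.1 hM'
    -- The coordinates (r, b, c) are those of iσ₃, iσ₂, iσ₁; the minus sign of P * Q in
    -- `quaternionicComb` makes the structure constants agree.
    rw [h.lie_comb]
    simp only [LieSubalgebra.coe_bracket, Ring.lie_def, Matrix.sub_apply, Matrix.mul_apply,
      Fin.sum_univ_two, Complex.sub_re, Complex.sub_im, Complex.add_re, Complex.add_im,
      Complex.mul_re, Complex.mul_im, h1, h2, h3, h4, h1', h2', h3', h4']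
    congr 1 <;> ring

theorem IsQuaternionic.comb_mem_range {P Q G : ℬ} (h : IsQuaternionic P Q G) (s r b c : ℝ) :
    quaternionicComb P Q G s r b c ∈ h.unitaryHom.range := by
  refine (LieHom.mem_range _ _).2 ⟨⟨!![⟨0, s + r⟩, ⟨b, c⟩; ⟨-b, c⟩, ⟨0, s - r⟩], ?_⟩, ?_⟩
  · rw [mem_unitaryLie_two]
    simp
  · change quaternionicComb P Q G _ _ _ _ = _
    congr 1 <;> simp

theorem IsQuaternionic.unitaryHom_injective [Nontrivial ℬ] {P Q G : ℬ} (h : IsQuaternionic P Q G) :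
    Function.Injective h.unitaryHom := by
  refine (injective_iff_map_eq_zero h.unitaryHom).2 ?_
  rintro ⟨M, hM⟩ h0
  obtain ⟨h1, h2, h3, h4⟩ := mem_unitaryLie_two.1 hM
  obtain ⟨e1, e2, e3, e4⟩ := h.comb_eq_zero h0
  refine Subtype.ext (Matrix.ext fun i j => ?_)
  simp only at e1 e2 e3 e4
  have e5 : (M 0 0).im = 0 := by linarith
  have e6 : (M 1 1).im = 0 := by linarith
  fin_cases i <;> fin_cases j <;> refine Complex.ext ?_ ?_
  · exact h1
  · exact e5
  · exact e3
  · exact e4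
  · exact h3.trans (by rw [e3, neg_zero]; rfl)
  · exact h4.trans e4
  · exact h2
  · exact e6

theorem range_le_of_generators {n : ℕ} {A : Matrix (Fin n) (Fin n) ℤ} {L : Type*} [LieRing L]
    [LieAlgebra ℝ L] (ρ : K A →ₗ⁅ℝ⁆ L) (S : LieSubalgebra ℝ L) (h : ∀ i, ρ (x A i) ∈ S) :
    ρ.range ≤ S := by
  rintro _ ⟨k, rfl⟩
  have hk : k ∈ LieSubalgebra.lieSpan ℝ (K A) (Set.range (x A)) := by
    rw [K_lieSpan]; exact Set.mem_univ k
  have : LieSubalgebra.lieSpan ℝ (K A) (Set.range (x A)) ≤ S.comap ρ := by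
    rw [LieSubalgebra.lieSpan_le]
    rintro _ ⟨i, rfl⟩
    exact h i
  exact this hk

end unitary

/-! ### The spin 1/2 image -/

section AE3

variable {Γ : Fin 4 → Matrix (Fin 4) (Fin 4) ℝ} (h : IsGamma Γ)

include h in
theorem IsGamma.isQuaternionic : IsQuaternionic (gammaAE3 Γ (rootAE3 0)) (gammaAE3 Γ (rootAE3 1))
    (gammaAE3 Γ (rootAE3 2)) := by
  have hg := h.isGammaSol_AE3
  exact ⟨hg.sq 0, hg.sq 1, hg.anti 1 0 (by decide) (by decide), hg.sq 2,
    hg.comm 2 0 (by decide) (by decide), hg.comm 2 1 (by decide) (by decide)⟩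

-- The image contains Γ(α) for the three simple roots, and the bracket of the first two supplies
-- their product; these four span the copy of 𝔲(2).
include h in
theorem IsGamma.nonempty_range_equiv (ρ : K cartanAE3 →ₗ⁅ℝ⁆ Matrix (Fin 4) (Fin 4) ℝ)
    (hρ : ∀ i, ρ (x cartanAE3 i) = (1 / 2 : ℝ) • gammaAE3 Γ (rootAE3 i)) :
    Nonempty (ρ.range ≃ₗ⁅ℝ⁆ unitaryLie 2) := by
  have hq := h.isQuaternionic
  have h1 : ρ.range = hq.unitaryHom.range := by
    refine le_antisymm (range_le_of_generators ρ _ fun i => ?_) ?_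
    · rw [hρ]
      fin_cases i
      · convert hq.comb_mem_range 0 0 0 (1 / 2) using 1
        simp [quaternionicComb]
      · convert hq.comb_mem_range 0 0 (1 / 2) 0 using 1
        simp [quaternionicComb]
      · convert hq.comb_mem_range (1 / 2) 0 0 0 using 1
        simp [quaternionicComb]
    · have hm : ∀ i, gammaAE3 Γ (rootAE3 i) ∈ ρ.range := fun i => by
        refine (LieHom.mem_range _ _).2 ⟨(2 : ℝ) • x cartanAE3 i, ?_⟩
        rw [map_smul, hρ, smul_smul]
        norm_num
      have hm2 : gammaAE3 Γ (rootAE3 0) * gammaAE3 Γ (rootAE3 1) ∈ ρ.range := by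
        have := ρ.range.smul_mem (1 / 2 : ℝ) (ρ.range.lie_mem (hm 0) (hm 1))
        rwa [hq.lie_PQ, smul_smul, one_div, inv_mul_cancel₀ two_ne_zero, one_smul] at this
      rintro _ ⟨M, rfl⟩
      exact add_mem (add_mem (sub_mem (ρ.range.smul_mem _ (hm 2)) (ρ.range.smul_mem _ hm2))
        (ρ.range.smul_mem _ (hm 1))) (ρ.range.smul_mem _ (hm 0))
  rw [h1]
  exact ⟨(LieEquiv.ofInjective _ hq.unitaryHom_injective).symm⟩

include h in
theorem IsGamma.commute_gammaStar (ρ : K cartanAE3 →ₗ⁅ℝ⁆ Matrix (Fin 4) (Fin 4) ℝ)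
    (hρ : ∀ i, ρ (x cartanAE3 i) = (1 / 2 : ℝ) • gammaAE3 Γ (rootAE3 i)) (k : K cartanAE3) :
    Commute (gammaStar Γ) (ρ k) :=
  commute_of_generators ρ _ (fun i => by
    rw [hρ]
    exact (h.commute_gammaStar_simple i).smul_right _) k

end AE3

end KacMoody
end

theorem mainTheorem3 :
    -- Part I: `K(AE₃)`
    (∀ i j, KacMoody.rootInner (KacMoody.deWitt 3) (KacMoody.toReal (KacMoody.rootAE3 i))
        (KacMoody.toReal (KacMoody.rootAE3 j)) = (KacMoody.cartanAE3 i j : ℝ)) ∧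
    (∃ Γ : Fin 4 → Matrix (Fin 4) (Fin 4) ℝ, KacMoody.IsGamma Γ) ∧
    (∃ (𝒜 : Type) (_ : Ring 𝒜) (_ : Algebra ℝ 𝒜) (φ : Fin 3 → Fin 4 → 𝒜),
        Nontrivial 𝒜 ∧ KacMoody.IsCAR φ) ∧
    (∀ Γ : Fin 4 → Matrix (Fin 4) (Fin 4) ℝ, KacMoody.IsGamma Γ →
      -- the matrices `Γ(α)`
      (KacMoody.gammaAE3 Γ (KacMoody.rootAE3 0) = Γ 1 * Γ 2 ∧
        KacMoody.gammaAE3 Γ (KacMoody.rootAE3 1) = Γ 2 * Γ 3 ∧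
        KacMoody.gammaAE3 Γ (KacMoody.rootAE3 2) = KacMoody.gammaStar Γ) ∧
      KacMoody.GammaRelations (KacMoody.deWitt 3)
        (fun c : Fin 3 → ℤ => KacMoody.toReal (∑ i, c i • KacMoody.rootAE3 i))
        (fun c : Fin 3 → ℤ => KacMoody.gammaAE3 Γ (∑ i, c i • KacMoody.rootAE3 i)) ∧
      -- spin 1/2, with image `𝔲(2)`
      KacMoody.DefinesRep KacMoody.cartanAE3
        (fun i => (1 / 2 : ℝ) • KacMoody.gammaAE3 Γ (KacMoody.rootAE3 i)) ∧
      (∀ ρ : KacMoody.K KacMoody.cartanAE3 →ₗ⁅ℝ⁆ Matrix (Fin 4) (Fin 4) ℝ,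
        (∀ i, ρ (KacMoody.x KacMoody.cartanAE3 i) =
          (1 / 2 : ℝ) • KacMoody.gammaAE3 Γ (KacMoody.rootAE3 i)) →
        Nonempty (ρ.range ≃ₗ⁅ℝ⁆ KacMoody.unitaryLie 2) ∧
          ∀ k, Commute (KacMoody.gammaStar Γ) (ρ k)) ∧
      -- the central element of the second-quantised representation
      (∀ (𝒜 : Type*) [Ring 𝒜] [Algebra ℝ 𝒜] [Nontrivial 𝒜] (φ : Fin 3 → Fin 4 → 𝒜),
        KacMoody.IsCAR φ →
        KacMoody.DefinesRep KacMoody.cartanAE3 (fun i => KacMoody.bilinearOp φ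
            (KacMoody.X32low (KacMoody.toReal (KacMoody.rootAE3 i)))
            (KacMoody.gammaAE3 Γ (KacMoody.rootAE3 i))) ∧
        (∀ ρ : KacMoody.K KacMoody.cartanAE3 →ₗ⁅ℝ⁆ 𝒜,
          (∀ i, ρ (KacMoody.x KacMoody.cartanAE3 i) = KacMoody.bilinearOp φ
            (KacMoody.X32low (KacMoody.toReal (KacMoody.rootAE3 i)))
            (KacMoody.gammaAE3 Γ (KacMoody.rootAE3 i))) →
          ∀ k, Commute (KacMoody.centralZ φ Γ) (ρ k)) ∧
        KacMoody.centralZ φ Γ ∉ Set.range (algebraMap ℝ 𝒜)) ∧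
      -- spin 3/2
      KacMoody.DefinesRep KacMoody.cartanAE3 (fun i => KacMoody.higherSpinJ
        (KacMoody.X32 (-(1 / 2)) (1 / 4) (KacMoody.toReal (KacMoody.rootAE3 i)))
        (KacMoody.gammaAE3 Γ (KacMoody.rootAE3 i))) ∧
      -- spin 5/2
      KacMoody.DefinesRep KacMoody.cartanAE3 (fun i => KacMoody.higherSpinJ
        (KacMoody.X52 (KacMoody.toReal (KacMoody.rootAE3 i)))
        (KacMoody.gammaAE3 Γ (KacMoody.rootAE3 i))) ∧
      -- spin 7/2: the two solutions, and their inequivalence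
      (∀ ε : ℝ, ε = 1 ∨ ε = -1 →
        KacMoody.DefinesRep KacMoody.cartanAE3 (fun i => KacMoody.higherSpinJ
          (KacMoody.X72 (1 / 25 * (17 + ε * (2 * √66))) (1 / 30 * (6 + ε * √66))
            (KacMoody.toReal (KacMoody.rootAE3 i)))
          (KacMoody.gammaAE3 Γ (KacMoody.rootAE3 i))) ∧
        KacMoody.DefinesRep KacMoody.cartanAE3 (fun i => KacMoody.higherSpinJ
          (KacMoody.X72 (1 / 50 * (19 + ε * (4 * √21))) (1 / 30 * (6 + ε * √21))
            (KacMoody.toReal (KacMoody.rootAE3 i)))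
          (KacMoody.gammaAE3 Γ (KacMoody.rootAE3 i)))) ∧
      (∀ ε ε' : ℝ, ε = 1 ∨ ε = -1 → ε' = 1 ∨ ε' = -1 →
        ¬ KacMoody.Equivalent
          (fun i => KacMoody.higherSpinJ
            (KacMoody.X72 (1 / 25 * (17 + ε * (2 * √66))) (1 / 30 * (6 + ε * √66))
              (KacMoody.toReal (KacMoody.rootAE3 i)))
            (KacMoody.gammaAE3 Γ (KacMoody.rootAE3 i)))
          (fun i => KacMoody.higherSpinJ
            (KacMoody.X72 (1 / 50 * (19 + ε' * (4 * √21))) (1 / 30 * (6 + ε' * √21))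
              (KacMoody.toReal (KacMoody.rootAE3 i)))
            (KacMoody.gammaAE3 Γ (KacMoody.rootAE3 i))))) ∧
    -- Part II: `K(G₂⁺⁺)`
    (∀ i j, KacMoody.rootInner ((3 : ℝ) • KacMoody.deWitt 4) (KacMoody.toReal (KacMoody.rootG2pp i))
        (KacMoody.toReal (KacMoody.rootG2pp j)) =
        (![3, 3, 3, 1] : Fin 4 → ℝ) i * (KacMoody.cartanG2pp i j : ℝ)) ∧
    (∃ Γ : Fin 5 → Matrix (Fin 8) (Fin 8) ℝ, KacMoody.IsGamma Γ) ∧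
    (∀ Γ : Fin 5 → Matrix (Fin 8) (Fin 8) ℝ, KacMoody.IsGamma Γ →
      KacMoody.GammaRelations ((3 : ℝ) • KacMoody.deWitt 4)
        (fun i => KacMoody.toReal (KacMoody.rootG2pp i)) (KacMoody.gammaG2pp Γ) ∧
      -- spin 1/2
      KacMoody.DefinesRep KacMoody.cartanG2pp
        (fun i => (1 / 2 : ℝ) • KacMoody.gammaG2pp Γ i) ∧
      -- spin 3/2, with different coefficients on the long roots and on the short root
      (∀ ε ε' : ℝ, ε = 1 ∨ ε = -1 → ε' = 1 ∨ ε' = -1 →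
        KacMoody.DefinesRep KacMoody.cartanG2pp (fun i => KacMoody.higherSpinJ
          (if i = 3 then
            KacMoody.X32 (ε' * (3 / 2)) (-(ε' * (3 / 4))) (KacMoody.toReal (KacMoody.rootG2pp i))
          else
            KacMoody.X32 (-(ε * (1 / 2))) (ε * (1 / 4)) (KacMoody.toReal (KacMoody.rootG2pp i)))
          (KacMoody.gammaG2pp Γ i)))) := by
  refine ⟨KacMoody.rootInner_AE3, KacMoody.exists_isGamma_three, KacMoody.exists_isCAR,
    fun Γ h => ⟨h.gammaAE3_simple, h.gammaRelations_AE3,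
      KacMoody.definesRep_spin12 KacMoody.isSmallCartan_AE3 h.isGammaSol_AE3,
      fun ρ hρ => ⟨h.nonempty_range_equiv ρ hρ, h.commute_gammaStar ρ hρ⟩, ?_,
      KacMoody.definesRep_AE3_spin32 h.isGammaSol_AE3,
      KacMoody.definesRep_AE3_spin52 h.isGammaSol_AE3,
      fun ε hε => ⟨KacMoody.definesRep_AE3_spin72_66 ε hε h.isGammaSol_AE3,
        KacMoody.definesRep_AE3_spin72_21 ε hε h.isGammaSol_AE3⟩,
      fun ε ε' hε hε' => KacMoody.not_equivalent_spin72 (by norm_num) (h.isGammaSol_AE3.sq 0) ε ε'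
        hε hε'⟩, fun i j => ?_, KacMoody.exists_isGamma_four,
    fun Γ h => ⟨h.gammaRelations_G2pp,
      KacMoody.definesRep_spin12 KacMoody.isSmallCartan_G2pp h.isGammaSol_G2pp,
      fun ε ε' hε hε' => KacMoody.definesRep_G2pp_spin32 h.isGammaSol_G2pp ε ε' hε hε'⟩⟩
  · intro 𝒜 _ _ _ φ hφ
    refine ⟨KacMoody.definesRep_bilinearOp hφ h,
      fun ρ hρ => KacMoody.commute_of_generators ρ _ fun i => ?_,
      KacMoody.centralZ_notMem_range hφ h⟩
    rw [hρ]
    exact KacMoody.commute_centralZ hφ h i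
  · rw [KacMoody.rootInner_G2pp]
    congr 1
    fin_cases i <;> simp
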